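/- **Setting.** Let $d,n\ge1$, let $\Sigma\in\mathbb R^{d\times d}$ be symmetric positive definite with eigenvalues $\sigma_1^2\ge\dots\ge\sigma_d^2>0$, and let $d_{\rm eff}(r)=\sum_{i=1}^d(\sigma_i/\sigma_1)^{2/r}$. Let $a_1,\dots,a_n$ be independent random vectors in $\mathbb R^d$ that are $\Sigma$-subgaussian, i.e. $\mathbb P(|a_i^\top x|>t)\le 2\exp\left(-\frac{t^2}{2x^\top\Sigma x}\right)$ for all $t>0$, $\|x\|\le 1$. Let $f(x)=\frac1n\sum_{i=1}^n\ell_i(a_i^\top x)$ with $\ell_i:\mathbb R\to\mathbb R$ convex and $L$-Lipschitz ($L>0$), let $\psi$ be convex with domain ${\rm Dom}_\psi\subset\mathcal B(0,R)$ ($R>0$), let $x^*$ minimize $f+\psi$ over ${\rm Dom}_\psi$, and let $L_0>0$ be a Lipschitz constant of each of the functions $x\mapsto\ell_i(a_i^\top x)$. **Algorithm** (accelerated stochastic dual averaging with smoothing distribution $\mu=\mathcal N(0,\sqrt\Sigma)$ and $m\ge1$ samples per step). Put $\theta_0=1$, $\theta_{t+1}=2/(1+\sqrt{1+4/\theta_t^2})$,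 $x_0=z_0=0$. For $t\ge0$: set $y_t=(1-\theta_t)x_t+\theta_tz_t$; draw i.i.d. $Z_{1,t},\dots,Z_{m,t}\sim\mu$ and, independently, i.i.d. uniform indices $I_{1,t},\dots,I_{m,t}\in\{1,\dots,n\}$, all draws being independent over $t$; take subgradients $g_{j,t}$ of $x\mapsto \ell_{I_{j,t}}(a_{I_{j,t}}^\top x)$ at $y_t+u_tZ_{j,t}$ and $g_t=\frac1m\sum_jg_{j,t}$; set $$z_{t+1}=\operatorname*{arg\,min}_{x\in{\rm Dom}_\psi}\Big\{\sum_{\tau=0}^t\tfrac1{\theta_\tau}\langle g_\tau,x\rangle+\sum_{\tau=0}^t\tfrac1{\theta_\tau}\psi(x)+\tfrac12\Big(L_{t+1}+\tfrac{\eta_{t+1}}{\theta_{t+1}}\Big)\|x\|^2\Big\},\qquad x_{t+1}=(1-\theta_t)x_t+\theta_tz_{t+1}.$$ **Step sizes.** For $\delta\in(0,1)$ put $\kappa=1+\sqrt{\frac{d_{\rm eff}(1)\ln d+\ln(\delta^{-1})}{n}}$ and $\Lambda=\ln(e\,d/\delta)$. With numerical constants $c>0$, $p\in\mathbb N$, take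 $u_t=\theta_tu$, $L_t=L_1/u_t$ and $\eta_t=\frac{L_0\sqrt{t+1}}{R\sqrt m}$, where $$u=\frac{R\sqrt{d_{\rm eff}(2)\,\kappa}}{\sigma_1^{1/2}d_{\rm eff}(1)^{3/4}},\qquad L_1=c\Lambda^{p}\,L\,\sigma_1^{1/2}\,\frac{d_{\rm eff}(2)}{d_{\rm eff}(1)}\,\kappa .$$ **Statement.** The numerical constants $c,C>0$ and $p\in\mathbb N$ can be chosen so that for all $d,n,\Sigma$, all laws of the $a_i$ as above and all $\delta\in(0,1)$ the following holds. With probability at least $1-\delta$ over the data $a_1,\dots,a_n$, simultaneously for all $L,R,(\ell_i),\psi,x^*,L_0,m$ as above and all $T\ge1$, the random variable $f(x_T)+\psi(x_T)$ is integrable and, the expectation being over the randomness of the algorithm conditionally on the data, $$\mathbb E\big[f(x_T)+\psi(x_T)-f(x^*)-\psi(x^*)\big]\le C\,\Lambda^{p}\sqrt{\kappa}\;\frac{LR\,\sigma_1\sqrt{d_{\rm eff}(2)/\sqrt{d_{\rm eff}(1)}}}{T}+\frac{5L_0R}{\sqrt{Tm}} .$$ In particular, when $n\ge d_{\rm eff}(1)\ln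 d+\ln(\delta^{-1})$ one has $\kappa\le2$, and the first term is $\tilde O\big(LR\sigma_1\sqrt{d_{\rm eff}(2)/\sqrt{d_{\rm eff}(1)}}/T\big)$, where $\tilde O$ hides only logarithmic factors in $d$ and $\delta^{-1}$. -/

import Mathlib

open MeasureTheory ProbabilityTheory
open scoped RealInnerProductSpace MatrixOrder

noncomputable section

namespace NonIsoSmoothing

/-- The Euclidean space `ℝ^d`. -/
abbrev Vec (d : ℕ) : Type := EuclideanSpace ℝ (Fin d)

/-- A random vector `a` is `S`-subgaussian: for all `t > 0` and all `x` in the unit ball,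
`P(|aᵀx| > t) ≤ 2 exp(-t² / (2 xᵀSx))`. -/
def IsSubgaussianVec {d : ℕ} {Ω : Type*} [MeasurableSpace Ω] (P : Measure Ω)
    (S : Matrix (Fin d) (Fin d) ℝ) (a : Ω → Vec d) : Prop :=
  ∀ t : ℝ, 0 < t → ∀ x : Vec d, ‖x‖ ≤ 1 →
    P.real {ω | t < |⟪a ω, x⟫|} ≤
      2 * Real.exp (-(1 / 2) * (t ^ 2 / dotProduct x.ofLp (S.mulVec x.ofLp)))

/-- `σ₁²`, the largest eigenvalue of the Hermitian matrix `S`. -/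
def topEig {d : ℕ} {S : Matrix (Fin d) (Fin d) ℝ} (hS : S.IsHermitian) : ℝ :=
  ⨆ i, hS.eigenvalues i

/-- `σ₁`, the square root of the largest eigenvalue of `S`. -/
def sigmaOne {d : ℕ} {S : Matrix (Fin d) (Fin d) ℝ} (hS : S.IsHermitian) : ℝ :=
  √(topEig hS)

/-- The effective dimension `d_eff(r) = ∑ i, (σ_i / σ₁)^(2/r)`, where the `σ_i²` are the
eigenvalues of `S`. -/
def effDim {d : ℕ} {S : Matrix (Fin d) (Fin d) ℝ} (hS : S.IsHermitian) (r : ℕ) : ℝ :=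
  ∑ i, (√(hS.eigenvalues i) / sigmaOne hS) ^ (2 / (r : ℝ))

/-- `g` is a subgradient of `F` at `x`. -/
def IsSubgradient {d : ℕ} (F : Vec d → ℝ) (x g : Vec d) : Prop :=
  ∀ y, F x + ⟪g, y - x⟫ ≤ F y

/-- The individual loss `F(x, i) = ℓ_i(a_iᵀ x)` of a linear model. -/
def linLoss {d n : ℕ} (loss : Fin n → ℝ → ℝ) (a : Fin n → Vec d) (i : Fin n) (x : Vec d) : ℝ :=
  loss i ⟪a i, x⟫

/-- The empirical risk `f(x) = (1/n) ∑ i, ℓ_i(a_iᵀ x)`. -/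
def empRisk {d n : ℕ} (loss : Fin n → ℝ → ℝ) (a : Fin n → Vec d) (x : Vec d) : ℝ :=
  (1 / (n : ℝ)) * ∑ i, linLoss loss a i x

/-- The momentum sequence `θ_0 = 1`, `θ_{t+1} = 2 / (1 + √(1 + 4 / θ_t²))`. -/
def theta : ℕ → ℝ
  | 0 => 1
  | t + 1 => 2 / (1 + √(1 + 4 / theta t ^ 2))

/-- The sampling factor `1 + √((d_eff(1) ln d + ln(1/δ)) / n)`. -/
def sampleFactor {d : ℕ} {S : Matrix (Fin d) (Fin d) ℝ} (hS : S.IsHermitian) (n : ℕ) (δ : ℝ) : ℝ :=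
  1 + √((effDim hS 1 * Real.log d + Real.log (1 / δ)) / n)

/-- The logarithmic factor `ln(e d / δ) = 1 + ln d + ln(1/δ)`. -/
def logFactor (d : ℕ) (δ : ℝ) : ℝ :=
  1 + Real.log d + Real.log (1 / δ)

/-- The smoothing radius `u = R √(d_eff(2) κ) / (√σ₁ d_eff(1)^(3/4))`, where `κ` is the sampling
factor. -/
def radius {d : ℕ} {S : Matrix (Fin d) (Fin d) ℝ} (hS : S.IsHermitian) (n : ℕ) (δ R : ℝ) : ℝ :=
  R * √(effDim hS 2 * sampleFactor hS n δ) / (√(sigmaOne hS) * effDim hS 1 ^ (3 / 4 : ℝ))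

/-- The smoothness parameter `L₁ = B L √σ₁ (d_eff(2) / d_eff(1)) κ`, where `κ` is the sampling
factor and `B` a numerical factor. -/
def modulus {d : ℕ} {S : Matrix (Fin d) (Fin d) ℝ} (hS : S.IsHermitian) (n : ℕ)
    (δ L B : ℝ) : ℝ :=
  B * L * √(sigmaOne hS) * (effDim hS 2 / effDim hS 1) * sampleFactor hS n δ

/-- A run, on the probability space `(Ω, P)`, of accelerated stochastic dual averaging with
randomized smoothing for the objective `(1/n) ∑ i, F i + ψ` over `D = Dom ψ`: the smoothing
distribution is `μ`, each iteration uses `m` stochastic subgradients, and the step-size sequences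
are `θ` (see `theta`), the smoothing radii `u`, and `L`, `η`. -/
structure Run {d n : ℕ} (μ : Measure (Vec d)) (F : Fin n → Vec d → ℝ) (D : Set (Vec d))
    (ψ : Vec d → ℝ) (m : ℕ) (u L η : ℕ → ℝ)
    {Ω : Type*} [MeasurableSpace Ω] (P : Measure Ω) where
  /-- the three sequences of iterates -/
  x : ℕ → Ω → Vec d
  y : ℕ → Ω → Vec d
  z : ℕ → Ω → Vec d
  /-- the smoothing perturbations -/
  Z : ℕ → Fin m → Ω → Vec d
  /-- the indices of the sampled individual losses -/
  idx : ℕ → Fin m → Ω → Fin n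
  /-- the stochastic subgradients -/
  g : ℕ → Fin m → Ω → Vec d
  Z_measurable : ∀ t i, Measurable (Z t i)
  idx_measurable : ∀ t i, Measurable (idx t i)
  g_measurable : ∀ t i, Measurable (g t i)
  /-- `Z t i` has law `μ`, `idx t i` is uniform, and the two are independent -/
  law : ∀ t i, P.map (fun ω => (Z t i ω, idx t i ω)) = μ.prod (uniformOn Set.univ)
  /-- all the draws are independent -/
  indep : iIndepFun (fun (p : ℕ × Fin m) ω => (Z p.1 p.2 ω, idx p.1 p.2 ω)) P
  x_zero : ∀ ω, x 0 ω = 0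
  z_zero : ∀ ω, z 0 ω = 0
  y_eq : ∀ t ω, y t ω = (1 - theta t) • x t ω + theta t • z t ω
  oracle : ∀ t i ω, IsSubgradient (F (idx t i ω)) (y t ω + u t • Z t i ω) (g t i ω)
  z_mem : ∀ t ω, z (t + 1) ω ∈ D
  /-- `z (t+1)` minimizes the dual-averaging objective over `D`, with the averaged subgradients
  `(1/m) ∑ i, g τ i` -/
  z_min : ∀ t ω, IsMinOn (fun v : Vec d =>
      ∑ τ ∈ Finset.range (t + 1), (1 / theta τ) * ⟪(1 / (m : ℝ)) • ∑ i, g τ i ω, v⟫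
        + (∑ τ ∈ Finset.range (t + 1), 1 / theta τ) * ψ v
        + (1 / 2) * (L (t + 1) + η (t + 1) / theta (t + 1)) * ‖v‖ ^ 2) D (z (t + 1) ω)
  x_eq : ∀ t ω, x (t + 1) ω = (1 - theta t) • x t ω + theta t • z (t + 1) ω

end NonIsoSmoothing

end

/-! Write `b j` for the eigenvectors of Σ and v_i = a_iᵀ√Σ a_i = ∑_j σ_j ⟪a_i, b_j⟫². For Z ~ N(0,
√Σ) the loss ℓ_i only sees the scalar Gaussian ⟪a_i, uZ⟫, whose standard deviation is u√v_i. The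
second difference of a convex L-Lipschitz function has total mass at most 2Lh², and the Gaussian
density is at most 1/(u√v_i), so smoothing at radius u costs curvature of order L/(u√v_i) in the
direction a_i (`integral_bregman_gaussianReal`) and bias at most uL√v_i. Two numbers of the data
therefore decide everything: a bound M for the quadratic form (1/n) ∑ ⟪a_i, h⟫²/√v_i on the unit
ball, and E = (1/n) ∑ √v_i.

A potential argument for accelerated dual averaging with radii θ_t u (`dual_averaging_inequality`)
bounds the gap, up to constants, by R²LM/(uT) + uLE/T plus the effect of the sampling noise. The
noise paired with the iterates has mean zero, and its squares contribute L₀R/√(Tm)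
(`Run.expected_gap_le`). The prescribed u balances the first two terms.

Jensen and coordinatewise second moments bound E by about √(σ₁³ d_eff(1)) (`avg_norm_le`). The bound
for M is the heart of the matter (`quadratic_le`). Split the coordinates into dyadic blocks of
comparable σ_j ≈ τ, and let p_i be the part of ⟪a_i, h⟫ on one block. There |p_i| is at most of
order √(v_i/τ)‖h‖, so p_i²/√v_i is at most of order |p_i|‖h‖/√τ: the quadratic form has become an ℓ¹
sum, that is, the pairing of h with one signed sum ∑ ±a_i. The norms of all 2^n signed sums are
controlled by a union bound (`measure_block_le`), from an exponential moment obtained by writing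
exp‖w‖² as a Gaussian average of exponentials of linear forms (`lintegral_exp_block_le`). The
smallest scales, at most d coordinates below σ₁/d, need only second moments (`tail_quadratic_le`).
There are logarithmically many blocks, so the price is a power of Λ, and M is of order √(σ₁ + σ₁
d_eff(2)/n), hence at most √σ₁ (d_eff(2)/d_eff(1)) κ, up to powers of Λ.

One probabilistic point needs care: subgradients are arbitrary measurable selections, while
independence is known only for the draws. Almost surely the sampled loss is differentiable at the
perturbed point (or a_i = 0), so the subgradient is determined there, and by induction the iterates
are almost everywhere functions of past draws (`Run.aestronglyMeasurable_iterates`). -/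

namespace NonIsoSmoothing

/-! ### The momentum sequence -/

lemma theta_pos (t : ℕ) : 0 < theta t := by
  cases t with
  | zero => simp [theta]
  | succ t => simp only [theta]; positivity

lemma one_div_theta_succ (t : ℕ) :
    1 / theta (t + 1) = (1 + √(1 + 4 * (1 / theta t) ^ 2)) / 2 := by
  simp only [theta]
  rw [one_div_div, one_div_pow, mul_one_div]

/-- The recursion picks 1/θ_{t+1} as the positive root of q² − q = 1/θ_t². This makes the weights
1/θ_τ sum to 1/θ_t² and lets the potential of accelerated dual averaging telescope. -/
lemma one_div_theta_sq_succ (t : ℕ) :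
    (1 / theta (t + 1)) ^ 2 = (1 / theta t) ^ 2 + 1 / theta (t + 1) := by
  rw [one_div_theta_succ]
  have h : (√(1 + 4 * (1 / theta t) ^ 2)) ^ 2 = 1 + 4 * (1 / theta t) ^ 2 :=
    Real.sq_sqrt (by positivity)
  linear_combination h / 4

lemma sum_one_div_theta (t : ℕ) :
    ∑ τ ∈ Finset.range (t + 1), 1 / theta τ = (1 / theta t) ^ 2 := by
  induction t with
  | zero => simp [theta]
  | succ t ih => rw [Finset.sum_range_succ, ih, one_div_theta_sq_succ]

lemma one_div_theta_le (t : ℕ) : 1 / theta t ≤ t + 1 := by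
  induction t with
  | zero => simp [theta]
  | succ t ih =>
    have h0 := one_div_pos.2 (theta_pos t)
    have h : √(1 + 4 * (1 / theta t) ^ 2) ≤ 1 + 2 * (1 / theta t) :=
      Real.sqrt_le_iff.2 ⟨by positivity, by nlinarith⟩
    rw [one_div_theta_succ]
    push_cast
    linarith

lemma le_one_div_theta (t : ℕ) : ((t : ℝ) + 2) / 2 ≤ 1 / theta t := by
  induction t with
  | zero => simp [theta]
  | succ t ih =>
    have h0 := one_div_pos.2 (theta_pos t)
    have h : 2 * (1 / theta t) ≤ √(1 + 4 * (1 / theta t) ^ 2) :=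
      Real.le_sqrt_of_sq_le (by nlinarith)
    rw [one_div_theta_succ]
    push_cast
    linarith

lemma one_div_theta_mono : Monotone fun t => 1 / theta t := by
  refine monotone_nat_of_le_succ fun t => ?_
  have h0 := one_div_pos.2 (theta_pos t)
  have h : 2 * (1 / theta t) ≤ √(1 + 4 * (1 / theta t) ^ 2) :=
    Real.le_sqrt_of_sq_le (by nlinarith)
  rw [one_div_theta_succ]
  linarith

lemma theta_anti : Antitone theta := fun _ t h =>
  (one_div_le_one_div (theta_pos _) (theta_pos t)).1 (one_div_theta_mono h)

lemma theta_le_one (t : ℕ) : theta t ≤ 1 := theta_anti (Nat.zero_le t)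

/-! ### Gaussian averages of convex Lipschitz functions on the line -/

lemma continuous_of_abs_sub_le {f : ℝ → ℝ} {L : ℝ}
    (hf : ∀ s t, |f s - f t| ≤ L * |s - t|) : Continuous f :=
  (LipschitzWith.of_dist_le_mul (K := L.toNNReal) fun s t => by
    simp only [Real.dist_eq]
    exact (hf s t).trans (mul_le_mul_of_nonneg_right (Real.le_coe_toNNReal L)
      (abs_nonneg _))).continuous

lemma ConvexOn.second_difference_nonneg {f : ℝ → ℝ} (hc : ConvexOn ℝ Set.univ f) (x h : ℝ) :
    0 ≤ f (x + h) + f (x - h) - 2 * f x := by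
  have := hc.2 (Set.mem_univ (x + h)) (Set.mem_univ (x - h))
    (by norm_num : (0 : ℝ) ≤ 1 / 2) (by norm_num : (0 : ℝ) ≤ 1 / 2) (by norm_num)
  simp only [smul_eq_mul] at this
  rw [show 1 / 2 * (x + h) + 1 / 2 * (x - h) = x by ring] at this
  linarith

/-- The second difference of a convex Lipschitz function has small total mass. -/
lemma lintegral_second_difference_le {f : ℝ → ℝ} {L : ℝ}
    (hf : ∀ s t, |f s - f t| ≤ L * |s - t|) (hc : ConvexOn ℝ Set.univ f) (h : ℝ) :
    ∫⁻ x, ENNReal.ofReal (f (x + h) + f (x - h) - 2 * f x) ≤ ENNReal.ofReal (2 * L * h ^ 2) := by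
  have hfc := continuous_of_abs_sub_le hf
  -- Global integrability is not yet known, so the mass is bounded on the intervals (−M, M],
  -- uniformly in M.
  have hcov : AECover (volume : Measure ℝ) Filter.atTop fun M : ℝ => Set.Ioc (-M) M :=
    aecover_Ioc Filter.tendsto_neg_atTop_atBot Filter.tendsto_id
  refine le_of_tendsto (hcov.lintegral_tendsto_of_countably_generated
    (ENNReal.continuous_ofReal.comp (by fun_prop :
      Continuous fun x => f (x + h) + f (x - h) - 2 * f x)).aemeasurable)
    (Filter.eventually_atTop.2 ⟨0, fun M hM => ?_⟩)
  have hMM : -M ≤ M := by linarith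
  have hcont : Continuous fun x => f (x + h) + f (x - h) - 2 * f x := by fun_prop
  rw [← ofReal_integral_eq_lintegral_ofReal (hcont.integrableOn_Ioc)
    (ae_of_all _ fun x => ConvexOn.second_difference_nonneg hc x h),
    ← intervalIntegral.integral_of_le hMM]
  refine ENNReal.ofReal_le_ofReal ?_
  set D : ℝ → ℝ := fun x => f (x + h) - f x with hD
  have hDc : Continuous D := by fun_prop
  have hi : ∀ a b, IntervalIntegrable D volume a b := fun a b => hDc.intervalIntegrable a b
  have hDb : ∀ x, ‖D x‖ ≤ L * |h| := fun x => by
    simpa [hD] using hf (x + h) x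
  have e1 : ∀ x, f (x + h) + f (x - h) - 2 * f x = D x - D (x - h) := fun x => by
    simp only [hD, sub_add_cancel]; ring
  simp_rw [e1]
  rw [intervalIntegral.integral_sub (hi _ _) ((by fun_prop : Continuous fun x => D (x - h)).intervalIntegrable _ _),
    intervalIntegral.integral_comp_sub_right]
  -- The integral of D(x) − D(x − h) telescopes to two end windows of length |h|, on which |D| ≤
  -- L|h|.
  have e2 : (∫ x in -M..M, D x) - ∫ x in (-M - h)..(M - h), D x
      = (∫ x in (M - h)..M, D x) - ∫ x in (-M - h)..(-M), D x := by
    rw [← intervalIntegral.integral_add_adjacent_intervals (hi (-M) (M - h)) (hi (M - h) M),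
      ← intervalIntegral.integral_add_adjacent_intervals (hi (-M - h) (-M)) (hi (-M) (M - h))]
    ring
  rw [e2]
  have b1 := intervalIntegral.norm_integral_le_of_norm_le_const (a := M - h) (b := M)
    fun x _ => hDb x
  have b2 := intervalIntegral.norm_integral_le_of_norm_le_const (a := -M - h) (b := -M)
    fun x _ => hDb x
  simp only [sub_sub_cancel, Real.norm_eq_abs] at b1 b2
  have := abs_le.1 b1
  have := abs_le.1 b2
  have : L * |h| * |h| = L * h ^ 2 := by rw [mul_assoc, abs_mul_abs_self, sq]
  linarith

lemma gaussianPDF_le {s : NNReal} (hs : s ≠ 0) (m x : ℝ) :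
    gaussianPDF m s x ≤ ENNReal.ofReal (1 / √s) := by
  refine ENNReal.ofReal_le_ofReal ?_
  have hs' : (0 : ℝ) < s := by positivity
  rw [gaussianPDFReal, one_div]
  refine (mul_le_of_le_one_right (by positivity) ?_).trans ?_
  rotate_left
  · refine inv_anti₀ (by positivity) (Real.sqrt_le_sqrt ?_)
    nlinarith [Real.pi_gt_three]
  · rw [Real.exp_le_one_iff, neg_div]
    exact neg_nonpos.2 (by positivity)

lemma lintegral_gaussianReal_le {s : NNReal} (hs : s ≠ 0) (m : ℝ) {f : ℝ → ENNReal}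
    (hf : Measurable f) :
    ∫⁻ x, f x ∂(gaussianReal m s) ≤ ENNReal.ofReal (1 / √s) * ∫⁻ x, f x := by
  rw [gaussianReal_of_var_ne_zero m hs, lintegral_withDensity_eq_lintegral_mul _
    (measurable_gaussianPDF m s) hf, ← lintegral_const_mul _ hf]
  exact lintegral_mono fun x => mul_le_mul_left (gaussianPDF_le hs m x) _

lemma ae_differentiableAt_of_abs_sub_le {f : ℝ → ℝ} {L : ℝ}
    (hf : ∀ s t, |f s - f t| ≤ L * |s - t|) {s : NNReal} (hs : s ≠ 0) (m : ℝ) :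
    ∀ᵐ x ∂(gaussianReal m s), DifferentiableAt ℝ f x := by
  refine (gaussianReal_absolutelyContinuous m hs).ae_le ?_
  exact (LipschitzWith.of_dist_le_mul (K := L.toNNReal) fun s t => by
    simp only [Real.dist_eq]
    exact (hf s t).trans (mul_le_mul_of_nonneg_right (Real.le_coe_toNNReal L)
      (abs_nonneg _))).ae_differentiableAt_real

lemma abs_deriv_le_of_abs_sub_le {f : ℝ → ℝ} {L : ℝ} (hL : 0 ≤ L)
    (hf : ∀ s t, |f s - f t| ≤ L * |s - t|) (x : ℝ) : |deriv f x| ≤ L := by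
  have : LipschitzWith L.toNNReal f := LipschitzWith.of_dist_le_mul fun s t => by
    simpa only [Real.dist_eq, Real.coe_toNNReal L hL] using hf s t
  simpa [Real.coe_toNNReal L hL] using norm_deriv_le_of_lipschitz (x₀ := x) this

lemma convex_deriv_ineq {f : ℝ → ℝ} (hc : ConvexOn ℝ Set.univ f) {x : ℝ}
    (hx : DifferentiableAt ℝ f x) (h : ℝ) : f x + h * deriv f x ≤ f (x + h) := by
  rcases lt_trichotomy h 0 with hh | rfl | hh
  · have := hc.slope_le_deriv (Set.mem_univ (x + h)) (Set.mem_univ x) (by linarith) hx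
    rw [slope_def_field, sub_add_cancel_left, div_neg, ← neg_div, neg_sub, div_le_iff_of_neg hh] at this
    linarith
  · simp
  · have := hc.deriv_le_slope (Set.mem_univ x) (Set.mem_univ (x + h)) (by linarith) hx
    rw [slope_def_field, add_sub_cancel_left, le_div_iff₀ hh] at this
    linarith

/-- A Lipschitz function of a Gaussian variable is integrable. -/
lemma integrable_gaussianReal_of_abs_sub_le {f : ℝ → ℝ} {L : ℝ} 
    (hf : ∀ s t, |f s - f t| ≤ L * |s - t|) (m : ℝ) (s : NNReal) (h : ℝ) :
    Integrable (fun x => f (x + h)) (gaussianReal m s) := by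
  have hfc := continuous_of_abs_sub_le hf
  have hid : Integrable (fun x : ℝ => x) (gaussianReal m s) :=
    (memLp_id_gaussianReal 1).integrable (by simp)
  refine ((hid.norm.const_mul L).add (integrable_const |f h|)).mono' (by fun_prop)
    (ae_of_all _ fun x => ?_)
  have := hf (x + h) h
  rw [add_sub_cancel_right] at this
  simp only [Real.norm_eq_abs, Pi.add_apply]
  have := abs_sub_abs_le_abs_sub (f (x + h)) (f h)
  linarith

/-- The Bregman divergence of a convex Lipschitz function, averaged over a Gaussian base point. -/
lemma integral_bregman_gaussianReal {f : ℝ → ℝ} {L : ℝ} (hL : 0 ≤ L)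
    (hf : ∀ s t, |f s - f t| ≤ L * |s - t|) (hc : ConvexOn ℝ Set.univ f)
    {s : NNReal} (hs : s ≠ 0) (m h : ℝ) :
    0 ≤ ∫ x, (f (x + h) - f x - h * deriv f x) ∂(gaussianReal m s) ∧
    ∫ x, (f (x + h) - f x - h * deriv f x) ∂(gaussianReal m s) ≤ 2 * L / √s * h ^ 2 := by
  have hfc := continuous_of_abs_sub_le hf
  have hd := ae_differentiableAt_of_abs_sub_le hf hs m
  have h0 : ∀ᵐ x ∂(gaussianReal m s), 0 ≤ f (x + h) - f x - h * deriv f x := by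
    filter_upwards [hd] with x hx
    linarith [convex_deriv_ineq hc hx h]
  refine ⟨integral_nonneg_of_ae h0, ?_⟩
  have hm : Measurable fun x => f (x + h) - f x - h * deriv f x :=
    ((hfc.comp (by fun_prop : Continuous fun x : ℝ => x + h)).measurable.sub hfc.measurable).sub
      ((measurable_deriv f).const_mul h)
  have hm2 : Measurable fun x => ENNReal.ofReal (f (x + h) + f (x - h) - 2 * f x) :=
    (ENNReal.continuous_ofReal.comp
      (by fun_prop : Continuous fun x => f (x + h) + f (x - h) - 2 * f x)).measurable
  rw [integral_eq_lintegral_of_nonneg_ae h0 hm.aestronglyMeasurable]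
  refine ENNReal.toReal_le_of_le_ofReal (by positivity) ?_
  -- The tangent inequality at x − h replaces −h f'(x) by f(x − h) − f(x), so the divergence is
  -- below the second difference. The latter has finite Lebesgue mass, and the density bound 1/√s
  -- finishes.
  calc _ ≤ ∫⁻ x, ENNReal.ofReal (f (x + h) + f (x - h) - 2 * f x) ∂(gaussianReal m s) := by
        refine lintegral_mono_ae ?_
        filter_upwards [hd] with x hx
        refine ENNReal.ofReal_le_ofReal ?_
        have := convex_deriv_ineq hc hx (-h)
        rw [← sub_eq_add_neg] at this
        linarith
    _ ≤ _ := lintegral_gaussianReal_le hs m hm2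
    _ ≤ ENNReal.ofReal (1 / √s) * ENNReal.ofReal (2 * L * h ^ 2) := by
        gcongr
        exact lintegral_second_difference_le hf hc h
    _ = _ := by
        rw [← ENNReal.ofReal_mul (by positivity)]
        congr 1
        ring

/-! ### The smoothed empirical risk -/

/-- The smoothed empirical risk `f_u(x) = E f(x + u Z)`, where `Z` has law `μ`. -/
noncomputable def smoothRisk {d n : ℕ} (μ : Measure (Vec d)) (loss : Fin n → ℝ → ℝ)
    (a : Fin n → Vec d) (u : ℝ) (x : Vec d) : ℝ :=
  (1 / (n : ℝ)) * ∑ i, ∫ Z, loss i ⟪a i, x + u • Z⟫ ∂μ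

/-- The gradient of the smoothed empirical risk. -/
noncomputable def smoothGrad {d n : ℕ} (μ : Measure (Vec d)) (loss : Fin n → ℝ → ℝ)
    (a : Fin n → Vec d) (u : ℝ) (x : Vec d) : Vec d :=
  (1 / (n : ℝ)) • ∑ i, (∫ Z, deriv (loss i) ⟪a i, x + u • Z⟫ ∂μ) • a i

section SmoothRisk

variable {d n : ℕ} {μ : Measure (Vec d)} {loss : Fin n → ℝ → ℝ}
  {a : Fin n → Vec d} {v : Fin n → NNReal} {L : ℝ}

lemma map_inner_add_smul {b : Vec d} {w : NNReal}
    (hμ : μ.map (fun Z => ⟪b, Z⟫) = gaussianReal 0 w) (u : ℝ) (x : Vec d) :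
    μ.map (fun Z => ⟪b, x + u • Z⟫) = gaussianReal ⟪b, x⟫ ((u ^ 2).toNNReal * w) := by
  have e : (fun Z : Vec d => ⟪b, x + u • Z⟫)
      = (fun t => ⟪b, x⟫ + t) ∘ (fun t => u * t) ∘ fun Z => ⟪b, Z⟫ := by
    ext Z
    simp [inner_add_right, inner_smul_right]
  rw [e, ← Measure.map_map (by fun_prop) (by fun_prop),
    ← Measure.map_map (by fun_prop) (by fun_prop), hμ, gaussianReal_map_const_mul,
    gaussianReal_map_const_add]
  simp only [mul_zero, zero_add]
  congr 2
  exact (Real.toNNReal_of_nonneg (sq_nonneg u)).symm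

lemma integrable_loss_inner {l : ℝ → ℝ} (hl : ∀ s t, |l s - l t| ≤ L * |s - t|)
    {b : Vec d} {w : NNReal} (hμ : μ.map (fun Z => ⟪b, Z⟫) = gaussianReal 0 w) (u : ℝ) (x : Vec d) :
    Integrable (fun Z => l ⟪b, x + u • Z⟫) μ := by
  have hm : AEMeasurable (fun Z : Vec d => ⟪b, x + u • Z⟫) μ := by fun_prop
  have := integrable_gaussianReal_of_abs_sub_le hl ⟪b, x⟫ ((u ^ 2).toNNReal * w) 0
  rw [← map_inner_add_smul hμ u x] at this
  simpa [Function.comp_def] using this.comp_aemeasurable hm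

variable [IsProbabilityMeasure μ]

/-- The scalar ⟪b, x + uZ⟫ is Gaussian with standard deviation u√w, so the one-dimensional estimate
applies with shift ⟪b, y − x⟫. If w = 0 then b = 0 and every term is constant. -/
lemma integral_bregman_inner {l : ℝ → ℝ} (hL : 0 ≤ L) (hl : ∀ s t, |l s - l t| ≤ L * |s - t|)
    (hc : ConvexOn ℝ Set.univ l) {b : Vec d} {w : NNReal}
    (hμ : μ.map (fun Z => ⟪b, Z⟫) = gaussianReal 0 w) (hw : w = 0 → b = 0)
    {u : ℝ} (hu : 0 < u) (x y : Vec d) :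
    (∫ Z, l ⟪b, x + u • Z⟫ ∂μ) + (∫ Z, deriv l ⟪b, x + u • Z⟫ ∂μ) * ⟪b, y - x⟫
      ≤ ∫ Z, l ⟪b, y + u • Z⟫ ∂μ ∧
    ∫ Z, l ⟪b, y + u • Z⟫ ∂μ ≤
      (∫ Z, l ⟪b, x + u • Z⟫ ∂μ) + (∫ Z, deriv l ⟪b, x + u • Z⟫ ∂μ) * ⟪b, y - x⟫
      + 2 * L / u * (⟪b, y - x⟫ ^ 2 / √w) := by
  rcases eq_or_ne w 0 with hw0 | hw0
  · simp [hw hw0]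
  have hm : AEMeasurable (fun Z : Vec d => ⟪b, x + u • Z⟫) μ := by fun_prop
  have hdm : Measurable (deriv l) := measurable_deriv l
  have hid : Integrable (fun Z => deriv l ⟪b, x + u • Z⟫) μ :=
    (integrable_const L).mono' (hdm.comp (by fun_prop : Measurable fun Z : Vec d =>
      ⟪b, x + u • Z⟫)).aestronglyMeasurable
      (ae_of_all _ fun Z => abs_deriv_le_of_abs_sub_le hL hl _)
  have hne : ((u ^ 2).toNNReal * w : NNReal) ≠ 0 :=
    mul_ne_zero (Real.toNNReal_pos.2 (by positivity)).ne' hw0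
  have key := integral_bregman_gaussianReal hL hl hc hne ⟪b, x⟫ ⟪b, y - x⟫
  have hlm : Measurable l := (continuous_of_abs_sub_le hl).measurable
  rw [← map_inner_add_smul hμ u x, integral_map hm (by
    exact (((hlm.comp (measurable_id.add_const _)).sub hlm).sub
      (hdm.const_mul _)).aestronglyMeasurable)] at key
  have e : ∀ Z : Vec d, ⟪b, x + u • Z⟫ + ⟪b, y - x⟫ = ⟪b, y + u • Z⟫ := fun Z => by
    rw [← inner_add_right]; congr 1; abel
  simp_rw [e] at key
  rw [integral_sub (f := fun Z => l ⟪b, y + u • Z⟫ - l ⟪b, x + u • Z⟫)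
    ((integrable_loss_inner hl hμ u y).sub (integrable_loss_inner hl hμ u x))
    (hid.const_mul _), integral_sub (integrable_loss_inner hl hμ u y)
    (integrable_loss_inner hl hμ u x), integral_const_mul] at key
  have e2 : 2 * L / √(((u ^ 2).toNNReal * w : NNReal) : ℝ) * ⟪b, y - x⟫ ^ 2
      = 2 * L / u * (⟪b, y - x⟫ ^ 2 / √w) := by
    rw [NNReal.coe_mul, Real.coe_toNNReal _ (sq_nonneg u), Real.sqrt_mul (sq_nonneg u), Real.sqrt_sq hu.le]
    field_simp
  rw [e2] at key
  constructor <;> linarith [key.1, key.2]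

lemma smoothRisk_add_inner_smoothGrad_le (hL : 0 ≤ L)
    (hl : ∀ i s t, |loss i s - loss i t| ≤ L * |s - t|) (hc : ∀ i, ConvexOn ℝ Set.univ (loss i))
    (hμ : ∀ i, μ.map (fun Z => ⟪a i, Z⟫) = gaussianReal 0 (v i)) (hv : ∀ i, v i = 0 → a i = 0)
    {u : ℝ} (hu : 0 < u) (x y : Vec d) :
    smoothRisk μ loss a u x + ⟪smoothGrad μ loss a u x, y - x⟫ ≤ smoothRisk μ loss a u y := by
  simp only [smoothRisk, smoothGrad, real_inner_smul_left, sum_inner]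
  rw [← mul_add, ← Finset.sum_add_distrib]
  refine mul_le_mul_of_nonneg_left (Finset.sum_le_sum fun i _ => ?_) (by positivity)
  exact (integral_bregman_inner hL (hl i) (hc i) (hμ i) (hv i) hu x y).1

/-- The curvature of the i-th smoothed loss is inversely proportional to √(v i). The data thus enter
the smoothness only through M, a bound for the normalized quadratic form. -/
lemma smoothRisk_le_quadratic (hL : 0 ≤ L)
    (hl : ∀ i s t, |loss i s - loss i t| ≤ L * |s - t|) (hc : ∀ i, ConvexOn ℝ Set.univ (loss i))
    (hμ : ∀ i, μ.map (fun Z => ⟪a i, Z⟫) = gaussianReal 0 (v i)) (hv : ∀ i, v i = 0 → a i = 0)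
    {M : ℝ} (hM : ∀ h : Vec d, (1 / (n : ℝ)) * ∑ i, ⟪a i, h⟫ ^ 2 / √(v i) ≤ M * ‖h‖ ^ 2)
    {u : ℝ} (hu : 0 < u) (x y : Vec d) :
    smoothRisk μ loss a u y ≤ smoothRisk μ loss a u x + ⟪smoothGrad μ loss a u x, y - x⟫
      + 2 * L * M / u * ‖y - x‖ ^ 2 := by
  have h1 : smoothRisk μ loss a u y ≤ smoothRisk μ loss a u x + ⟪smoothGrad μ loss a u x, y - x⟫
      + 2 * L / u * ((1 / (n : ℝ)) * ∑ i, ⟪a i, y - x⟫ ^ 2 / √(v i)) := by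
    simp only [smoothRisk, smoothGrad, real_inner_smul_left, sum_inner]
    rw [mul_left_comm, ← mul_add, ← mul_add, Finset.mul_sum Finset.univ _ (2 * L / u),
      ← Finset.sum_add_distrib, ← Finset.sum_add_distrib]
    refine mul_le_mul_of_nonneg_left (Finset.sum_le_sum fun i _ => ?_) (by positivity)
    exact (integral_bregman_inner hL (hl i) (hc i) (hμ i) (hv i) hu x y).2
  have h2 := mul_le_mul_of_nonneg_left (hM (y - x)) (by positivity : 0 ≤ 2 * L / u)
  calc _ ≤ _ := h1
    _ ≤ _ := by
      rw [show 2 * L * M / u * ‖y - x‖ ^ 2 = 2 * L / u * (M * ‖y - x‖ ^ 2) by ring]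
      linarith

omit [IsProbabilityMeasure μ] in
/-- Smoothing with a symmetric law increases a convex function monotonically in the radius. -/
lemma smoothRisk_mono (hl : ∀ i s t, |loss i s - loss i t| ≤ L * |s - t|)
    (hc : ∀ i, ConvexOn ℝ Set.univ (loss i))
    (hμ : ∀ i, μ.map (fun Z => ⟪a i, Z⟫) = gaussianReal 0 (v i))
    {u u' : ℝ} (hu : 0 ≤ u) (huu : u ≤ u') (x : Vec d) :
    smoothRisk μ loss a u x ≤ smoothRisk μ loss a u' x := by
  unfold smoothRisk
  refine mul_le_mul_of_nonneg_left (Finset.sum_le_sum fun i _ => ?_) (by positivity)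
  rcases (hu.trans huu).eq_or_lt with h0 | h0
  · rw [show u = u' by linarith]
  -- The weights satisfy p + q = 1 and p − q = u/u', so x + uZ is a convex combination of x + u'Z
  -- and x − u'Z, whose inner products with `a i` have the same law.
  set p := (1 + u / u') / 2 with hp
  set q := (1 - u / u') / 2 with hq
  have hle : u / u' ≤ 1 := (div_le_one h0).2 huu
  have hp0 : 0 ≤ p := by positivity
  have hq0 : 0 ≤ q := by rw [hq]; linarith
  have i1 := integrable_loss_inner (hl i) (hμ i) u' x
  have i2 := integrable_loss_inner (hl i) (hμ i) (-u') x
  have hsym : ∫ Z, loss i ⟪a i, x + (-u') • Z⟫ ∂μ = ∫ Z, loss i ⟪a i, x + u' • Z⟫ ∂μ := by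
    have hlm : Measurable (loss i) := (continuous_of_abs_sub_le (hl i)).measurable
    rw [← integral_map (f := loss i) (φ := fun Z => ⟪a i, x + (-u') • Z⟫) (by fun_prop)
      hlm.aestronglyMeasurable, ← integral_map (f := loss i) (φ := fun Z => ⟪a i, x + u' • Z⟫)
      (by fun_prop) hlm.aestronglyMeasurable, map_inner_add_smul (hμ i), map_inner_add_smul (hμ i)]
    simp only [neg_sq]
  calc ∫ Z, loss i ⟪a i, x + u • Z⟫ ∂μ
      ≤ ∫ Z, (p * loss i ⟪a i, x + u' • Z⟫ + q * loss i ⟪a i, x + (-u') • Z⟫) ∂μ := by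
        refine integral_mono (integrable_loss_inner (hl i) (hμ i) u x)
          ((i1.const_mul p).add (i2.const_mul q)) fun Z => ?_
        have := (hc i).2 (Set.mem_univ ⟪a i, x + u' • Z⟫) (Set.mem_univ ⟪a i, x + (-u') • Z⟫)
          hp0 hq0 (by rw [hp, hq]; ring)
        simp only [smul_eq_mul] at this
        convert this using 2
        simp only [inner_add_right, inner_smul_right, hp, hq]
        field_simp
        ring
    _ = ∫ Z, loss i ⟪a i, x + u' • Z⟫ ∂μ := by
        rw [integral_add (i1.const_mul p) (i2.const_mul q), integral_const_mul, integral_const_mul,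
          hsym, ← add_mul, hp, hq]
        ring

lemma smoothRisk_zero (x : Vec d) : smoothRisk μ loss a 0 x = empRisk loss a x := by
  simp [smoothRisk, empRisk, linLoss]

lemma integral_abs_gaussianReal_le (w : NNReal) : ∫ x, |x| ∂(gaussianReal 0 w) ≤ √w := by
  have h2 : MemLp (fun x : ℝ => |x|) 2 (gaussianReal 0 w) := (memLp_id_gaussianReal 2).norm
  have hv := variance_fun_id_gaussianReal (μ := 0) (v := w)
  have h3 : ∫ x, x ^ 2 ∂(gaussianReal 0 w) = w := by
    rw [variance_eq_integral (by fun_prop), integral_id_gaussianReal] at hv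
    simpa using hv
  have h4 := variance_nonneg (fun x : ℝ => |x|) (gaussianReal 0 w)
  rw [variance_eq_sub h2] at h4
  simp only [Pi.pow_apply, sq_abs, h3] at h4
  exact Real.le_sqrt_of_sq_le (by linarith)

lemma smoothRisk_le_empRisk_add (hL : 0 ≤ L)
    (hl : ∀ i s t, |loss i s - loss i t| ≤ L * |s - t|)
    (hμ : ∀ i, μ.map (fun Z => ⟪a i, Z⟫) = gaussianReal 0 (v i))
    {u : ℝ} (hu : 0 ≤ u) (x : Vec d) :
    smoothRisk μ loss a u x ≤ empRisk loss a x + u * (L * ((1 / (n : ℝ)) * ∑ i, √(v i))) := by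
  have e : u * (L * ((1 / (n : ℝ)) * ∑ i, √(v i))) = (1 / (n : ℝ)) * ∑ i, L * (u * √(v i)) := by
    rw [← Finset.mul_sum, ← Finset.mul_sum]; ring
  rw [e]
  unfold smoothRisk empRisk linLoss
  rw [← mul_add, ← Finset.sum_add_distrib]
  refine mul_le_mul_of_nonneg_left (Finset.sum_le_sum fun i _ => ?_) (by positivity)
  have hia : Integrable (fun Z : Vec d => |⟪a i, Z⟫|) μ := by
    have : Integrable (fun t : ℝ => |t|) (μ.map (fun Z => ⟪a i, Z⟫)) := by
      rw [hμ i]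
      exact ((memLp_id_gaussianReal 1).integrable (by simp)).abs
    exact this.comp_aemeasurable (by fun_prop)
  calc ∫ Z, loss i ⟪a i, x + u • Z⟫ ∂μ
      ≤ ∫ Z, (loss i ⟪a i, x⟫ + L * (u * |⟪a i, Z⟫|)) ∂μ := by
        refine integral_mono (integrable_loss_inner (hl i) (hμ i) u x)
          ((integrable_const _).add ((hia.const_mul u).const_mul L)) fun Z => ?_
        have := (abs_le.1 (hl i ⟪a i, x + u • Z⟫ ⟪a i, x⟫)).2
        rw [inner_add_right, add_sub_cancel_left, inner_smul_right, abs_mul, abs_of_nonneg hu] at this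
        simp only [inner_add_right, inner_smul_right]
        linarith
    _ = loss i ⟪a i, x⟫ + L * (u * ∫ Z, |⟪a i, Z⟫| ∂μ) := by
        rw [integral_add (integrable_const _) ((hia.const_mul u).const_mul L), integral_const_mul,
          integral_const_mul]
        simp
    _ ≤ _ := by
        gcongr
        have := integral_abs_gaussianReal_le (v i)
        rwa [← hμ i, integral_map (by fun_prop) (by fun_prop)] at this

end SmoothRisk

/-! ### Accelerated dual averaging: the deterministic inequality -/

section DualAveraging

variable {E : Type*} [NormedAddCommGroup E] [InnerProductSpace ℝ E]

/-- A minimizer of a convex function plus a quadratic is a strong minimizer. -/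
lemma add_sq_le_of_isMinOn {D : Set E} {φ : E → ℝ} (hφ : ConvexOn ℝ D φ) {A : ℝ} (hA : 0 ≤ A)
    {z : E} (hz : z ∈ D) (hmin : IsMinOn (fun v => φ v + (1 / 2) * A * ‖v‖ ^ 2) D z)
    {v : E} (hv : v ∈ D) :
    φ z + (1 / 2) * A * ‖z‖ ^ 2 + (1 / 2) * A * ‖v - z‖ ^ 2 ≤ φ v + (1 / 2) * A * ‖v‖ ^ 2 := by
  set W := (1 / 2) * A * ‖v - z‖ ^ 2 with hW
  have hW0 : 0 ≤ W := by positivity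
  have key : ∀ s : ℝ, 0 < s → s ≤ 1 →
      φ z + (1 / 2) * A * ‖z‖ ^ 2 + (1 - s) * W ≤ φ v + (1 / 2) * A * ‖v‖ ^ 2 := by
    intro s hs hs1
    have h1 : 0 ≤ 1 - s := by linarith
    have hm : (1 - s) • z + s • v ∈ D := hφ.1 hz hv h1 hs.le (by ring)
    have h2 := isMinOn_iff.1 hmin _ hm
    have h3 := hφ.2 hz hv h1 hs.le (by ring)
    simp only [smul_eq_mul] at h3
    have h4 : ‖(1 - s) • z + s • v‖ ^ 2
        = (1 - s) * ‖z‖ ^ 2 + s * ‖v‖ ^ 2 - s * (1 - s) * ‖v - z‖ ^ 2 := by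
      rw [norm_add_sq_real, norm_sub_sq_real, norm_smul, norm_smul, inner_smul_left,
        inner_smul_right, Real.norm_eq_abs, Real.norm_eq_abs, abs_of_nonneg h1, abs_of_pos hs,
        real_inner_comm v z]
      simp only [conj_trivial]
      ring
    rw [h4] at h2
    have h5 : s * (φ z + (1 / 2) * A * ‖z‖ ^ 2 + (1 - s) * W)
        ≤ s * (φ v + (1 / 2) * A * ‖v‖ ^ 2) := by
      rw [hW]; nlinarith
    exact le_of_mul_le_mul_left h5 hs
  refine le_of_forall_pos_le_add fun ε hε => ?_
  have hs := key (min 1 (ε / (W + 1))) (by positivity) (min_le_left _ _)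
  have : min 1 (ε / (W + 1)) * W ≤ ε := by
    calc min 1 (ε / (W + 1)) * W ≤ ε / (W + 1) * (W + 1) := by
          gcongr
          · exact min_le_right _ _
          · linarith
      _ = ε := by field_simp
  linarith

variable {D : Set E} {ψ : E → ℝ} {x y z g G : ℕ → E} {F : ℕ → E → ℝ} {L η : ℕ → ℝ}

/-- Since θ_0 = 1, the first step forgets x_0, which need not lie in D: x_1 = z_1. Later iterates
are convex combinations of points of D. -/
lemma iterate_mem (hD : Convex ℝ D) (hz : ∀ t, z (t + 1) ∈ D)
    (hxe : ∀ t, x (t + 1) = (1 - theta t) • x t + theta t • z (t + 1)) (t : ℕ) :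
    x (t + 1) ∈ D := by
  induction t with
  | zero => rw [hxe]; simpa [theta] using hz 0
  | succ t ih =>
    rw [hxe]
    exact hD ih (hz _) (by linarith [theta_le_one (t + 1)]) (theta_pos _).le (by ring)

lemma convex_iterate_le (hψ : ConvexOn ℝ D ψ) (hz : ∀ t, z (t + 1) ∈ D)
    (hxe : ∀ t, x (t + 1) = (1 - theta t) • x t + theta t • z (t + 1)) (t : ℕ) :
    ψ (x (t + 1)) ≤ (1 - theta t) * ψ (x t) + theta t * ψ (z (t + 1)) := by
  cases t with
  | zero => rw [hxe]; simp [theta]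
  | succ t =>
    rw [hxe (t + 1)]
    exact hψ.2 (iterate_mem hψ.1 hz hxe t) (hz _) (by linarith [theta_le_one (t + 1)])
      (theta_pos _).le (by ring)

/-- A potential argument. With `W t` the weighted value at x_t and `H t (z t)` the minimal value of
the regularized stochastic linear model, each step increases W by at most the increase of that
minimum plus a noise term. Comparing the last minimum with the value of the model at w gives the
bound. The functions F may vary with t because they decrease in t. The error θ_t c at w is met with
weight 1/θ_t, so each step pays exactly c. -/
theorem dual_averaging_inequality (hψ : ConvexOn ℝ D ψ)
    (hz0 : z 0 = 0) (hz : ∀ t, z (t + 1) ∈ D)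
    (hye : ∀ t, y t = (1 - theta t) • x t + theta t • z t)
    (hxe : ∀ t, x (t + 1) = (1 - theta t) • x t + theta t • z (t + 1))
    (hη : ∀ t, 0 < η t) (hL : ∀ t, 0 ≤ L t)
    (hA : ∀ t, L t + η t / theta t ≤ L (t + 1) + η (t + 1) / theta (t + 1))
    (hmin : ∀ t, IsMinOn (fun v => ∑ τ ∈ Finset.range (t + 1), (1 / theta τ) * ⟪g τ, v⟫
        + (∑ τ ∈ Finset.range (t + 1), 1 / theta τ) * ψ v
        + (1 / 2) * (L (t + 1) + η (t + 1) / theta (t + 1)) * ‖v‖ ^ 2) D (z (t + 1)))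
    (hFc : ∀ t v, F t (y t) + ⟪G t, v - y t⟫ ≤ F t v)
    (hFs : ∀ t, F t (x (t + 1)) ≤ F t (y t) + ⟪G t, x (t + 1) - y t⟫
      + L t / 2 * ‖x (t + 1) - y t‖ ^ 2)
    (hFm : ∀ t v, F (t + 1) v ≤ F t v)
    {w : E} (hw : w ∈ D) {b c : ℝ} (hb : ∀ t, F t w ≤ b + theta t * c) (t : ℕ) :
    (1 / theta t) ^ 2 * (F t (x (t + 1)) + ψ (x (t + 1)) - b - ψ w)
      ≤ (1 / 2) * (L (t + 1) + η (t + 1) / theta (t + 1)) * ‖w‖ ^ 2 + (t + 1) * c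
        + ∑ τ ∈ Finset.range (t + 1), ‖G τ - g τ‖ ^ 2 / (2 * η τ * theta τ)
        + ∑ τ ∈ Finset.range (t + 1), (1 / theta τ) * ⟪G τ - g τ, z τ - w⟫ := by
  set A : ℕ → ℝ := fun t => L t + η t / theta t with hAdef
  have hA0 : ∀ t, 0 ≤ A t := fun t => by
    have := hη t; have := hL t; have := theta_pos t
    simp only [hAdef]; positivity
  set q : ℕ → E → ℝ := fun τ v => (1 / theta τ) * (F τ (y τ) + ⟪g τ, v - y τ⟫ + ψ v) with hq
  set H : ℕ → E → ℝ := fun t v => ∑ τ ∈ Finset.range t, q τ v + (1 / 2) * A t * ‖v‖ ^ 2 with hH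
  -- `z t` is a strong minimizer of `H t`
  have hstrong : ∀ t, ∀ v ∈ D, H t (z t) + (1 / 2) * A t * ‖v - z t‖ ^ 2 ≤ H t v := by
    intro t v hv
    cases t with
    -- At time 0 the model is the bare quadratic, minimized over the whole space at z_0 = 0;
    -- membership of z_0 in D is not needed.
    | zero => simp [hH, hz0]
    | succ t =>
      have hconv : ConvexOn ℝ D (fun v => ∑ τ ∈ Finset.range (t + 1), (1 / theta τ) * ⟪g τ, v⟫
          + (∑ τ ∈ Finset.range (t + 1), 1 / theta τ) * ψ v) := by
        refine ConvexOn.add ?_ (hψ.smul (Finset.sum_nonneg fun τ _ =>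
          (one_div_pos.2 (theta_pos τ)).le))
        refine ⟨hψ.1, fun p _ r _ α β _ _ _ => le_of_eq ?_⟩
        simp only [inner_add_right, inner_smul_right, smul_eq_mul, Finset.mul_sum,
          ← Finset.sum_add_distrib]
        exact Finset.sum_congr rfl fun τ _ => by ring
      have h1 := add_sq_le_of_isMinOn hconv (hA0 (t + 1)) (hz t) (hmin t) hv
      have h2 : ∀ v, ∑ τ ∈ Finset.range (t + 1), q τ v
          = ∑ τ ∈ Finset.range (t + 1), (1 / theta τ) * ⟪g τ, v⟫
          + (∑ τ ∈ Finset.range (t + 1), 1 / theta τ) * ψ v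
          + ∑ τ ∈ Finset.range (t + 1), (1 / theta τ) * (F τ (y τ) - ⟪g τ, y τ⟫) := by
        intro v
        rw [Finset.sum_mul, ← Finset.sum_add_distrib, ← Finset.sum_add_distrib]
        refine Finset.sum_congr rfl fun τ _ => ?_
        simp only [hq, inner_sub_right]
        ring
      simp only [hH, h2]
      linarith
  set e : ℕ → E := fun τ => G τ - g τ with he
  -- The value W 0 = 0 is consistent because the weight (1 − θ_0)/θ_0² of x_0 vanishes.
  set W : ℕ → ℝ := fun t => Nat.casesOn t 0
    fun t => (1 / theta t) ^ 2 * (F t (x (t + 1)) + ψ (x (t + 1))) with hW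
  -- Telescoping uses (1 − θ_{t+1})/θ_{t+1}² = 1/θ_t², together with F_{t+1} ≤ F_t.
  have hWstep : ∀ t, (1 / theta t) ^ 2 * (1 - theta t) * (F t (x t) + ψ (x t)) ≤ W t := by
    intro t
    cases t with
    | zero => simp [hW, theta]
    | succ t =>
      have h1 := one_div_theta_sq_succ t
      have h2 := theta_pos (t + 1)
      have h3 : (1 / theta (t + 1)) ^ 2 * (1 - theta (t + 1)) = (1 / theta t) ^ 2 := by
        have : (1 / theta (t + 1)) ^ 2 * theta (t + 1) = 1 / theta (t + 1) := by field_simp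
        linear_combination h1 - this
      rw [h3]
      exact mul_le_mul_of_nonneg_left (by linarith [hFm t (x (t + 1))]) (sq_nonneg _)
  have hstep : ∀ t, W (t + 1) ≤ W t + (H (t + 1) (z (t + 1)) - H t (z t))
      + (‖e t‖ ^ 2 / (2 * η t * theta t) + (1 / theta t) * ⟪e t, z t - y t⟫) := by
    intro t
    have hθ := theta_pos t
    have hθ1 := theta_le_one t
    have hηt := hη t
    have hdx : x (t + 1) - y t = theta t • (z (t + 1) - z t) := by
      rw [hxe, hye, smul_sub]; abel
    have h1 := hFs t
    have h2 := hFc t (x t)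
    have h3 := convex_iterate_le hψ hz hxe t
    have h4 : ⟪G t, x (t + 1) - y t⟫
        = (1 - theta t) * ⟪G t, x t - y t⟫ + theta t * ⟪G t, z (t + 1) - y t⟫ := by
      rw [← inner_smul_right, ← inner_smul_right, ← inner_add_right]
      congr 1
      rw [hxe, smul_sub, smul_sub, sub_smul, sub_smul, one_smul, one_smul]
      abel
    have h5 : ‖x (t + 1) - y t‖ ^ 2 = theta t ^ 2 * ‖z (t + 1) - z t‖ ^ 2 := by
      rw [hdx, norm_smul, Real.norm_eq_abs, abs_of_pos hθ, mul_pow]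
    have h6 : F t (x (t + 1)) + ψ (x (t + 1)) ≤ (1 - theta t) * (F t (x t) + ψ (x t))
        + theta t * (F t (y t) + ⟪G t, z (t + 1) - y t⟫ + ψ (z (t + 1)))
        + L t / 2 * (theta t ^ 2 * ‖z (t + 1) - z t‖ ^ 2) := by
      rw [← h5]
      have := mul_le_mul_of_nonneg_left h2 (by linarith : 0 ≤ 1 - theta t)
      linarith
    have h7 := mul_le_mul_of_nonneg_left h6 (sq_nonneg (1 / theta t))
    have h8 : (1 / theta t) ^ 2 * ((1 - theta t) * (F t (x t) + ψ (x t))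
        + theta t * (F t (y t) + ⟪G t, z (t + 1) - y t⟫ + ψ (z (t + 1)))
        + L t / 2 * (theta t ^ 2 * ‖z (t + 1) - z t‖ ^ 2))
        = (1 / theta t) ^ 2 * (1 - theta t) * (F t (x t) + ψ (x t))
        + (1 / theta t) * (F t (y t) + ⟪G t, z (t + 1) - y t⟫ + ψ (z (t + 1)))
        + L t / 2 * ‖z (t + 1) - z t‖ ^ 2 := by field_simp
    rw [h8] at h7
    have h9 : H t (z (t + 1)) + q t (z (t + 1)) ≤ H (t + 1) (z (t + 1)) := by
      simp only [hH]
      rw [Finset.sum_range_succ]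
      have : A t * ‖z (t + 1)‖ ^ 2 ≤ A (t + 1) * ‖z (t + 1)‖ ^ 2 :=
        mul_le_mul_of_nonneg_right (hA t) (sq_nonneg _)
      linarith
    have h10 := hstrong t _ (hz t)
    have h11 : (1 / theta t) * (F t (y t) + ⟪G t, z (t + 1) - y t⟫ + ψ (z (t + 1)))
        = q t (z (t + 1)) + (1 / theta t) * ⟪e t, z (t + 1) - z t⟫
          + (1 / theta t) * ⟪e t, z t - y t⟫ := by
      simp only [hq, he, inner_sub_left, inner_sub_right]
      ring
    -- Young's inequality with weight η_t. The strong convexity of H at z_t has two parts: η_t/θ_t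
    -- absorbs this quadratic term and L_t absorbs the one from smoothness.
    have h12 : (1 / theta t) * ⟪e t, z (t + 1) - z t⟫
        ≤ ‖e t‖ ^ 2 / (2 * η t * theta t) + (η t / theta t) / 2 * ‖z (t + 1) - z t‖ ^ 2 := by
      have hi := real_inner_le_norm (e t) (z (t + 1) - z t)
      have hsq : ‖e t‖ * ‖z (t + 1) - z t‖ ≤ ‖e t‖ ^ 2 / (2 * η t)
          + η t / 2 * ‖z (t + 1) - z t‖ ^ 2 := by
        have : ‖e t‖ ^ 2 / (2 * η t) + η t / 2 * ‖z (t + 1) - z t‖ ^ 2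
            - ‖e t‖ * ‖z (t + 1) - z t‖
            = (‖e t‖ - η t * ‖z (t + 1) - z t‖) ^ 2 / (2 * η t) := by field_simp; ring
        have : 0 ≤ (‖e t‖ - η t * ‖z (t + 1) - z t‖) ^ 2 / (2 * η t) := by positivity
        linarith
      calc (1 / theta t) * ⟪e t, z (t + 1) - z t⟫
          ≤ (1 / theta t) * (‖e t‖ ^ 2 / (2 * η t) + η t / 2 * ‖z (t + 1) - z t‖ ^ 2) := by
            gcongr; linarith
        _ = _ := by field_simp
    have h13 : (1 / 2) * A t * ‖z (t + 1) - z t‖ ^ 2 = L t / 2 * ‖z (t + 1) - z t‖ ^ 2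
        + (η t / theta t) / 2 * ‖z (t + 1) - z t‖ ^ 2 := by
      simp only [hAdef]; ring
    have h14 := hWstep t
    have h15 : W (t + 1) = (1 / theta t) ^ 2 * (F t (x (t + 1)) + ψ (x (t + 1))) := rfl
    linarith
  have hsum : ∀ t, W t ≤ H t (z t) + ∑ τ ∈ Finset.range t,
      (‖e τ‖ ^ 2 / (2 * η τ * theta τ) + (1 / theta τ) * ⟪e τ, z τ - y τ⟫) := by
    intro t
    induction t with
    | zero => simp [hW, hH, hz0]
    | succ t ih =>
      rw [Finset.sum_range_succ]
      linarith [hstep t]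
  have hfin := hsum (t + 1)
  have hHw := hstrong (t + 1) w hw
  have hHw' : 0 ≤ (1 / 2) * A (t + 1) * ‖w - z (t + 1)‖ ^ 2 := by
    have := hA0 (t + 1); positivity
  have hqw : ∑ τ ∈ Finset.range (t + 1), q τ w ≤ (1 / theta t) ^ 2 * (b + ψ w) + (t + 1) * c
      - ∑ τ ∈ Finset.range (t + 1), (1 / theta τ) * ⟪e τ, w - y τ⟫ := by
    have hc : ((t : ℝ) + 1) * c = ∑ τ ∈ Finset.range (t + 1), c := by simp
    rw [← sum_one_div_theta, hc, Finset.sum_mul, ← Finset.sum_add_distrib,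
      ← Finset.sum_sub_distrib]
    refine Finset.sum_le_sum fun τ _ => ?_
    have hθ := theta_pos τ
    have h1 := mul_le_mul_of_nonneg_left ((hFc τ w).trans (hb τ)) (one_div_pos.2 hθ).le
    have h2 : (1 / theta τ) * (b + theta τ * c) = (1 / theta τ) * b + c := by field_simp
    simp only [hq, he, inner_sub_left]
    linarith
  have hW1 : W (t + 1) = (1 / theta t) ^ 2 * (F t (x (t + 1)) + ψ (x (t + 1))) := rfl
  -- The noise is paired with z − y along the steps and with w − y in the value of the model at w;
  -- the unobserved base point y cancels.
  have hsplit : ∑ τ ∈ Finset.range (t + 1), (1 / theta τ) * ⟪e τ, z τ - w⟫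
      = ∑ τ ∈ Finset.range (t + 1), (1 / theta τ) * ⟪e τ, z τ - y τ⟫
        - ∑ τ ∈ Finset.range (t + 1), (1 / theta τ) * ⟪e τ, w - y τ⟫ := by
    rw [← Finset.sum_sub_distrib]
    refine Finset.sum_congr rfl fun τ _ => ?_
    simp only [inner_sub_right]
    ring
  rw [hsplit]
  rw [Finset.sum_add_distrib] at hfin
  have hHdef : H (t + 1) w = ∑ τ ∈ Finset.range (t + 1), q τ w + (1 / 2) * A (t + 1) * ‖w‖ ^ 2 := rfl
  linarith

end DualAveraging

/-! ### Sampled gradients -/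

section Sampling

variable {d n : ℕ} {loss : Fin n → ℝ → ℝ} {a : Fin n → Vec d}

/-- Along any line, the loss minus the linear function given by g is minimal at p, so its derivative
vanishes there. If `a i = 0` the loss is constant, and testing at p + g forces g = 0. -/
lemma subgradient_eq_deriv_smul {i : Fin n} {p g : Vec d} (hg : IsSubgradient (linLoss loss a i) p g)
    (hd : a i = 0 ∨ DifferentiableAt ℝ (loss i) ⟪a i, p⟫) :
    g = deriv (loss i) ⟪a i, p⟫ • a i := by
  refine ext_inner_right ℝ fun w => ?_
  rcases hd with h0 | hd
  · have h1 := hg (p + g)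
    simp only [linLoss, h0, inner_zero_left, add_sub_cancel_left, real_inner_self_eq_norm_sq] at h1
    have : g = 0 := by
      rw [← norm_eq_zero]
      nlinarith [norm_nonneg g]
    simp [this, h0]
  · have hline : HasDerivAt (fun t : ℝ => loss i ⟪a i, p + t • w⟫ - t * ⟪g, w⟫)
        (deriv (loss i) ⟪a i, p⟫ * ⟪a i, w⟫ - ⟪g, w⟫) 0 := by
      have h1 : HasDerivAt (fun t : ℝ => ⟪a i, p + t • w⟫) ⟪a i, w⟫ 0 := by
        simp only [inner_add_right, inner_smul_right]
        simpa using ((hasDerivAt_id (0 : ℝ)).mul_const ⟪a i, w⟫).const_add ⟪a i, p⟫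
      have h2 : HasDerivAt (loss i) (deriv (loss i) ⟪a i, p⟫) ⟪a i, p + (0 : ℝ) • w⟫ := by
        simpa using hd.hasDerivAt
      have h3 := h2.comp (0 : ℝ) h1
      exact h3.sub (by simpa using (hasDerivAt_id (0 : ℝ)).mul_const ⟪g, w⟫)
    have hmin : IsLocalMin (fun t : ℝ => loss i ⟪a i, p + t • w⟫ - t * ⟪g, w⟫) 0 := by
      refine Filter.Eventually.of_forall fun t => ?_
      have := hg (p + t • w)
      simp only [linLoss, add_sub_cancel_left, inner_smul_right] at this
      simp only [zero_smul, add_zero, zero_mul, sub_zero]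
      linarith
    have := hmin.hasDerivAt_eq_zero hline
    rw [real_inner_smul_left]
    linarith

lemma norm_le_of_isSubgradient {F : Vec d → ℝ} {p g : Vec d} {K : ℝ} (hK : 0 ≤ K)
    (hF : ∀ v w, |F v - F w| ≤ K * ‖v - w‖) (hg : IsSubgradient F p g) : ‖g‖ ≤ K := by
  have h1 := hg (p + g)
  have h2 := (abs_le.1 (hF (p + g) p)).2
  rw [add_sub_cancel_left] at h1 h2
  rw [real_inner_self_eq_norm_sq] at h1
  by_contra hlt
  push Not at hlt
  nlinarith [norm_nonneg g]

/-- The gradient of the `i`-th loss at `p`, wherever it is differentiable. -/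
noncomputable def lossGrad (loss : Fin n → ℝ → ℝ) (a : Fin n → Vec d) (i : Fin n) (p : Vec d) :
    Vec d :=
  deriv (loss i) ⟪a i, p⟫ • a i

lemma measurable_lossGrad (u : ℝ) :
    Measurable fun q : Vec d × (Vec d × Fin n) => lossGrad loss a q.2.2 (q.1 + u • q.2.1) := by
  have h : Measurable fun r : (Vec d × Vec d) × Fin n => lossGrad loss a r.2 (r.1.1 + u • r.1.2) :=
    measurable_from_prod_countable_left fun i => by
      have hm : Measurable fun r : Vec d × Vec d => deriv (loss i) ⟪a i, r.1 + u • r.2⟫ :=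
        (measurable_deriv (loss i)).comp (by fun_prop)
      exact hm.smul_const (a i)
  exact h.comp (by fun_prop : Measurable fun q : Vec d × (Vec d × Fin n) => ((q.1, q.2.1), q.2.2))

lemma norm_lossGrad_le {L : ℝ} (hL : 0 ≤ L) (hl : ∀ i s t, |loss i s - loss i t| ≤ L * |s - t|)
    (i : Fin n) (p : Vec d) : ‖lossGrad loss a i p‖ ≤ L * ∑ k, ‖a k‖ := by
  rw [lossGrad, norm_smul]
  exact mul_le_mul (abs_deriv_le_of_abs_sub_le hL (hl i) _)
    (Finset.single_le_sum (f := fun k => ‖a k‖) (fun _ _ => norm_nonneg _) (Finset.mem_univ i))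
    (norm_nonneg _) hL

variable {Ω : Type*} {m' : MeasurableSpace Ω} [mΩ : MeasurableSpace Ω] {Q : Measure Ω} [IsProbabilityMeasure Q]

/-- The iterates will be measurable for the past draws only up to null sets, so independence is
applied to a measurable modification, which has the same law. -/
lemma map_prodMk_of_indep {α β : Type*} [MeasurableSpace α]
    [TopologicalSpace α] [TopologicalSpace.PseudoMetrizableSpace α] [BorelSpace α]
    [MeasurableSpace β] (hm' : m' ≤ mΩ) {X : Ω → α} {ξ : Ω → β}
    (hX : AEStronglyMeasurable[m'] X Q)
    (hξ : Measurable ξ) (hind : Indep m' (MeasurableSpace.comap ξ inferInstance) Q) :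
    Q.map (fun ω => (X ω, ξ ω)) = (Q.map X).prod (Q.map ξ) := by
  have hmk : Measurable[m'] (hX.mk X) := hX.measurable_mk
  have hi : IndepFun (hX.mk X) ξ Q := by
    rw [IndepFun_iff_Indep]
    exact indep_of_indep_of_le_left hind hmk.comap_le
  have e1 : (fun ω => (X ω, ξ ω)) =ᵐ[Q] fun ω => (hX.mk X ω, ξ ω) := by
    filter_upwards [hX.ae_eq_mk] with ω h
    rw [h]
  rw [Measure.map_congr e1, Measure.map_congr hX.ae_eq_mk]
  exact (indepFun_iff_map_prod_eq_prod_map_map (hmk.mono hm' le_rfl).aemeasurable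
    hξ.aemeasurable).1 hi

variable {μ : Measure (Vec d)} {v : Fin n → NNReal}

lemma ae_differentiableAt_inner {L : ℝ} (hl : ∀ i s t, |loss i s - loss i t| ≤ L * |s - t|)
    (hμ : ∀ i, μ.map (fun Z => ⟪a i, Z⟫) = gaussianReal 0 (v i)) (hv : ∀ i, v i = 0 → a i = 0)
    {u : ℝ} (hu : 0 < u) (i : Fin n) (p : Vec d) :
    ∀ᵐ Z ∂μ, a i = 0 ∨ DifferentiableAt ℝ (loss i) ⟪a i, p + u • Z⟫ := by
  by_cases hv0 : v i = 0
  · exact ae_of_all _ fun Z => Or.inl (hv i hv0)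
  · have hne : (u ^ 2).toNNReal * v i ≠ 0 :=
      mul_ne_zero (Real.toNNReal_pos.2 (by positivity)).ne' hv0
    have h1 := ae_differentiableAt_of_abs_sub_le (hl i) hne ⟪a i, p⟫
    rw [← map_inner_add_smul (hμ i) u p] at h1
    have h2 := ae_of_ae_map (by fun_prop) h1
    filter_upwards [h2] with Z hZ
    exact Or.inr hZ

variable [IsProbabilityMeasure μ]

/-- Almost surely, the sampled loss is differentiable at the perturbed query point. -/
lemma ae_eq_lossGrad [NeZero n] {L : ℝ} (hl : ∀ i s t, |loss i s - loss i t| ≤ L * |s - t|)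
    (hμ : ∀ i, μ.map (fun Z => ⟪a i, Z⟫) = gaussianReal 0 (v i)) (hv : ∀ i, v i = 0 → a i = 0)
    {u : ℝ} (hu : 0 < u) (hm' : m' ≤ mΩ) {Y g : Ω → Vec d}
    {ξ : Ω → Vec d × Fin n} (hY : AEStronglyMeasurable[m'] Y Q) (hξ : Measurable ξ)
    (hlaw : Q.map ξ = μ.prod (uniformOn Set.univ))
    (hind : Indep m' (MeasurableSpace.comap ξ inferInstance) Q)
    (hg : ∀ ω, IsSubgradient (linLoss loss a (ξ ω).2) (Y ω + u • (ξ ω).1) (g ω)) :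
    g =ᵐ[Q] fun ω => lossGrad loss a (ξ ω).2 (Y ω + u • (ξ ω).1) := by
  set B : Set (Vec d × (Vec d × Fin n)) :=
    {q | a q.2.2 = 0 ∨ DifferentiableAt ℝ (loss q.2.2) ⟪a q.2.2, q.1 + u • q.2.1⟫} with hB
  have hBm : MeasurableSet B := by
    have h : MeasurableSet {r : (Vec d × Vec d) × Fin n |
        a r.2 = 0 ∨ DifferentiableAt ℝ (loss r.2) ⟪a r.2, r.1.1 + u • r.1.2⟫} := by
      refine measurableSet_setOfPred.2 (measurable_from_prod_countable_left fun i => ?_)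
      refine measurableSet_setOfPred.1 ?_
      exact (MeasurableSet.const (a i = 0)).union ((measurableSet_of_differentiableAt ℝ (loss i)).preimage
        (by fun_prop : Measurable fun r : Vec d × Vec d => ⟪a i, r.1 + u • r.2⟫))
    exact h.preimage
      (by fun_prop : Measurable fun q : Vec d × (Vec d × Fin n) => ((q.1, q.2.1), q.2.2))
  have hYm : AEMeasurable Y Q := (hY.mono hm').aemeasurable
  -- The query point is independent of the draw, so Fubini allows it to be frozen. For a fixed point
  -- and index, a nondegenerate Gaussian does not charge the points where a Lipschitz function fails
  -- to be differentiable.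
  have hae : ∀ᵐ q ∂(Q.map fun ω => (Y ω, ξ ω)), q ∈ B := by
    rw [map_prodMk_of_indep hm' hY hξ hind, hlaw]
    refine (Measure.ae_prod_mem_iff_ae_ae_mem hBm).2 (ae_of_all _ fun y => ?_)
    have hBm' : MeasurableSet {p : Vec d × Fin n | (y, p) ∈ B} :=
      hBm.preimage measurable_prodMk_left
    have h2 : ∀ᵐ Z ∂μ, ∀ᵐ i ∂(uniformOn (Set.univ : Set (Fin n))), (y, (Z, i)) ∈ B := by
      filter_upwards [ae_all_iff.2 fun i => ae_differentiableAt_inner hl hμ hv hu i y] with Z hZ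
      exact ae_of_all _ hZ
    exact (Measure.ae_prod_mem_iff_ae_ae_mem hBm').2 h2
  filter_upwards [ae_of_ae_map (hYm.prodMk hξ.aemeasurable) hae] with ω hω
  exact subgradient_eq_deriv_smul (hg ω) hω

lemma integral_uniformOn_univ [NeZero n] (h : Fin n → ℝ) :
    ∫ i, h i ∂(uniformOn (Set.univ : Set (Fin n))) = (1 / (n : ℝ)) * ∑ i, h i := by
  rw [integral_fintype (by simp [Integrable.of_finite]), Finset.mul_sum]
  refine Finset.sum_congr rfl fun i _ => ?_
  rw [measureReal_def, uniformOn_univ]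
  simp

lemma integral_inner_lossGrad [NeZero n] {L : ℝ} (hL : 0 ≤ L)
    (hl : ∀ i s t, |loss i s - loss i t| ≤ L * |s - t|) (u : ℝ) (y w : Vec d) :
    ∫ p, ⟪lossGrad loss a p.2 (y + u • p.1), w⟫ ∂(μ.prod (uniformOn (Set.univ : Set (Fin n))))
      = ⟪smoothGrad μ loss a u y, w⟫ := by
  have hm : Measurable fun p : Vec d × Fin n => ⟪lossGrad loss a p.2 (y + u • p.1), w⟫ :=
    ((measurable_lossGrad u).comp (measurable_prodMk_left (x := y))).inner_const
  have hint : Integrable (fun p : Vec d × Fin n => ⟪lossGrad loss a p.2 (y + u • p.1), w⟫)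
      (μ.prod (uniformOn (Set.univ : Set (Fin n)))) := by
    refine Integrable.of_bound hm.aestronglyMeasurable (L * (∑ k, ‖a k‖) * ‖w‖)
      (ae_of_all _ fun p => ?_)
    exact (norm_inner_le_norm _ _).trans
      (mul_le_mul_of_nonneg_right (norm_lossGrad_le hL hl _ _) (norm_nonneg _))
  rw [integral_prod _ hint]
  simp_rw [integral_uniformOn_univ]
  rw [integral_const_mul, integral_finsetSum]
  · simp only [smoothGrad, lossGrad, real_inner_smul_left, sum_inner, integral_mul_const]
  · intro i _
    refine Integrable.of_bound ?_ (L * (∑ k, ‖a k‖) * ‖w‖) (ae_of_all _ fun p => ?_)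
    · exact (hm.comp (measurable_prodMk_right (y := i))).aestronglyMeasurable
    · exact (norm_inner_le_norm _ _).trans
        (mul_le_mul_of_nonneg_right (norm_lossGrad_le hL hl _ _) (norm_nonneg _))

lemma measurable_smoothGrad (u : ℝ) : Measurable (smoothGrad μ loss a u) := by
  have h : ∀ i, Measurable fun y => ∫ Z, deriv (loss i) ⟪a i, y + u • Z⟫ ∂μ := fun i => by
    have hm : StronglyMeasurable fun q : Vec d × Vec d => deriv (loss i) ⟪a i, q.1 + u • q.2⟫ :=
      ((measurable_deriv (loss i)).comp (by fun_prop :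
        Measurable fun q : Vec d × Vec d => ⟪a i, q.1 + u • q.2⟫)).stronglyMeasurable
    exact hm.integral_prod_right.measurable
  exact (Finset.measurable_sum Finset.univ fun i _ => (h i).smul_const (a i)).const_smul (1 / (n : ℝ))

/-- Unbiasedness in weak form, tested against any bounded W known before the draw: the pair (Y, W)
is independent of the draw, and for frozen (Y, W) the average over the draw is the smoothed
gradient. -/
lemma integral_inner_sample [NeZero n] {L : ℝ} (hL : 0 ≤ L)
    (hl : ∀ i s t, |loss i s - loss i t| ≤ L * |s - t|) (u : ℝ)
    (hm' : m' ≤ mΩ) {Y W : Ω → Vec d}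
    {ξ : Ω → Vec d × Fin n} (hY : AEStronglyMeasurable[m'] Y Q)
    (hW : AEStronglyMeasurable[m'] W Q) {K : ℝ} (hWK : ∀ᵐ ω ∂Q, ‖W ω‖ ≤ K) (hξ : Measurable ξ)
    (hlaw : Q.map ξ = μ.prod (uniformOn Set.univ))
    (hind : Indep m' (MeasurableSpace.comap ξ inferInstance) Q) :
    ∫ ω, ⟪lossGrad loss a (ξ ω).2 (Y ω + u • (ξ ω).1), W ω⟫ ∂Q
      = ∫ ω, ⟪smoothGrad μ loss a u (Y ω), W ω⟫ ∂Q := by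
  have hYW : AEStronglyMeasurable[m'] (fun ω => (Y ω, W ω)) Q := hY.prodMk hW
  have hYWm : AEMeasurable (fun ω => (Y ω, W ω)) Q := (hYW.mono hm').aemeasurable
  have hmap := map_prodMk_of_indep hm' hYW hξ hind
  set f : (Vec d × Vec d) × (Vec d × Fin n) → ℝ :=
    fun q => ⟪lossGrad loss a q.2.2 (q.1.1 + u • q.2.1), q.1.2⟫ with hf
  have hfm : Measurable f :=
    ((measurable_lossGrad u).comp (by fun_prop : Measurable fun q : (Vec d × Vec d) ×
      (Vec d × Fin n) => (q.1.1, q.2))).inner (by fun_prop)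
  have hint : Integrable f (Q.map fun ω => ((Y ω, W ω), ξ ω)) := by
    rw [integrable_map_measure hfm.aestronglyMeasurable (hYWm.prodMk hξ.aemeasurable)]
    refine Integrable.of_bound (hfm.comp_aemeasurable
      (hYWm.prodMk hξ.aemeasurable)).aestronglyMeasurable (L * (∑ k, ‖a k‖) * K) ?_
    filter_upwards [hWK] with ω hω
    refine (norm_inner_le_norm _ _).trans ?_
    exact mul_le_mul (norm_lossGrad_le hL hl _ _) hω (norm_nonneg _)
      (mul_nonneg hL (Finset.sum_nonneg fun _ _ => norm_nonneg _))
  calc ∫ ω, ⟪lossGrad loss a (ξ ω).2 (Y ω + u • (ξ ω).1), W ω⟫ ∂Q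
      = ∫ q, f q ∂(Q.map fun ω => ((Y ω, W ω), ξ ω)) := by
        rw [integral_map (hYWm.prodMk hξ.aemeasurable) hfm.aestronglyMeasurable]
    _ = ∫ r, ∫ p, f (r, p) ∂(μ.prod (uniformOn Set.univ)) ∂(Q.map fun ω => (Y ω, W ω)) := by
        rw [hmap, hlaw] at *
        have : IsProbabilityMeasure (Q.map fun ω => (Y ω, W ω)) :=
          Measure.isProbabilityMeasure_map hYWm
        exact integral_prod _ hint
    _ = ∫ r, ⟪smoothGrad μ loss a u r.1, r.2⟫ ∂(Q.map fun ω => (Y ω, W ω)) := by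
        simp only [hf, integral_inner_lossGrad hL hl]
    _ = _ := by
        have hm : Measurable fun r : Vec d × Vec d => ⟪smoothGrad μ loss a u r.1, r.2⟫ :=
          ((measurable_smoothGrad u).comp measurable_fst).inner measurable_snd
        rw [integral_map hYWm hm.aestronglyMeasurable]

end Sampling

/-! ### Measurability of the iterates -/

/-- A map which is Lipschitz in the value of `G` factors continuously through `G`. -/
lemma exists_continuous_factor {Ω : Type*} {d : ℕ} {z G : Ω → Vec d} {K : ℝ} (hK : 0 ≤ K)
    (h : ∀ ω ω', ‖z ω - z ω'‖ ≤ K * ‖G ω - G ω'‖) :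
    ∃ φ : Vec d → Vec d, Continuous φ ∧ ∀ ω, z ω = φ (G ω) := by
  classical
  rcases isEmpty_or_nonempty Ω with hΩ | hΩ
  · exact ⟨id, continuous_id, fun ω => hΩ.elim ω⟩
  have hinv : ∀ p ∈ Set.range G, G (Function.invFun G p) = p := fun p hp =>
    Function.invFun_eq hp
  have hl : LipschitzOnWith K.toNNReal (fun p => z (Function.invFun G p)) (Set.range G) := by
    refine LipschitzOnWith.of_dist_le_mul fun p hp q hq => ?_
    rw [dist_eq_norm, dist_eq_norm, Real.coe_toNNReal K hK]
    have := h (Function.invFun G p) (Function.invFun G q)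
    rwa [hinv p hp, hinv q hq] at this
  -- The range of G may be an awkward set; a Lipschitz extension gives a continuous factor on the
  -- whole space.
  obtain ⟨φ, hφ, heq⟩ := hl.extend_finite_dimension
  refine ⟨φ, hφ.continuous, fun ω => ?_⟩
  rw [← heq (Set.mem_range_self ω)]
  have := h ω (Function.invFun G (G ω))
  rw [hinv _ (Set.mem_range_self ω), sub_self, norm_zero, mul_zero] at this
  exact sub_eq_zero.1 (norm_le_zero_iff.1 this)

/-- Minimizers of `⟨G, v⟩ + a ψ(v) + (β/2) ‖v‖²` depend on `G` in a Lipschitz way. -/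
lemma norm_sub_le_of_isMinOn {E : Type*} [NormedAddCommGroup E] [InnerProductSpace ℝ E]
    {D : Set E} {ψ : E → ℝ} (hψ : ConvexOn ℝ D ψ) {b A : ℝ} (hb : 0 ≤ b) (hA : 0 < A)
    {G G' z z' : E} (hz : z ∈ D) (hz' : z' ∈ D)
    (hmin : IsMinOn (fun v => ⟪G, v⟫ + b * ψ v + (1 / 2) * A * ‖v‖ ^ 2) D z)
    (hmin' : IsMinOn (fun v => ⟪G', v⟫ + b * ψ v + (1 / 2) * A * ‖v‖ ^ 2) D z') :
    ‖z - z'‖ ≤ 1 / A * ‖G - G'‖ := by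
  have hconv : ∀ G : E, ConvexOn ℝ D (fun v => ⟪G, v⟫ + b * ψ v) := fun G => by
    refine ConvexOn.add ⟨hψ.1, fun p _ r _ α β _ _ _ => le_of_eq ?_⟩ (hψ.smul hb)
    simp only [inner_add_right, inner_smul_right, smul_eq_mul]
  have h1 := add_sq_le_of_isMinOn (hconv G) hA.le hz hmin hz'
  have h2 := add_sq_le_of_isMinOn (hconv G') hA.le hz' hmin' hz
  have h3 : ⟪G - G', z' - z⟫ ≤ ‖G - G'‖ * ‖z - z'‖ := by
    rw [norm_sub_rev z z']; exact real_inner_le_norm _ _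
  simp only [inner_sub_left, inner_sub_right] at h3
  rw [norm_sub_rev z' z] at h1
  have h4 : A * ‖z - z'‖ ^ 2 ≤ ‖G - G'‖ * ‖z - z'‖ := by linarith
  rcases (norm_nonneg (z - z')).eq_or_lt with h0 | h0
  · rw [← h0]; positivity
  · have h5 : A * ‖z - z'‖ ≤ ‖G - G'‖ := le_of_mul_le_mul_right (by linarith) h0
    rw [one_div, inv_mul_eq_div, le_div_iff₀ hA]
    linarith

namespace Run

variable {d n : ℕ} {μ : Measure (Vec d)} {loss : Fin n → ℝ → ℝ} {a : Fin n → Vec d}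
  {D : Set (Vec d)} {ψ : Vec d → ℝ} {m : ℕ} {u Ls η : ℕ → ℝ}
  {Ω : Type*} [mΩ : MeasurableSpace Ω] {Q : Measure Ω}
  (run : Run μ (linLoss loss a) D ψ m u Ls η Q)

/-- The averaged stochastic subgradient. -/
noncomputable def gbar (t : ℕ) (ω : Ω) : Vec d := (1 / (m : ℝ)) • ∑ i, run.g t i ω

/-- The accumulated stochastic subgradients. -/
noncomputable def gsum (t : ℕ) (ω : Ω) : Vec d :=
  ∑ τ ∈ Finset.range t, (1 / theta τ) • run.gbar τ ω

/-- A single draw. -/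
def draw (p : ℕ × Fin m) (ω : Ω) : Vec d × Fin n := (run.Z p.1 p.2 ω, run.idx p.1 p.2 ω)

lemma measurable_draw (p : ℕ × Fin m) : Measurable (run.draw p) :=
  (run.Z_measurable _ _).prodMk (run.idx_measurable _ _)

/-- The `σ`-algebra generated by the draws in `A`. -/
abbrev drawAlg (A : Set (ℕ × Fin m)) : MeasurableSpace Ω :=
  ⨆ p ∈ A, MeasurableSpace.comap (run.draw p) inferInstance

lemma drawAlg_le (A : Set (ℕ × Fin m)) : run.drawAlg A ≤ mΩ :=
  iSup₂_le fun p _ => (run.measurable_draw p).comap_le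

lemma drawAlg_mono {A B : Set (ℕ × Fin m)} (h : A ⊆ B) : run.drawAlg A ≤ run.drawAlg B :=
  biSup_mono h

lemma measurable_draw_drawAlg {A : Set (ℕ × Fin m)} {p : ℕ × Fin m} (hp : p ∈ A) :
    Measurable[run.drawAlg A] (run.draw p) :=
  (comap_measurable (run.draw p)).mono
    (le_iSup₂ (f := fun p (_ : p ∈ A) => MeasurableSpace.comap (run.draw p) inferInstance) p hp) le_rfl

lemma indep_drawAlg {A : Set (ℕ × Fin m)} {p : ℕ × Fin m} (hp : p ∉ A) :
    Indep (run.drawAlg A) (MeasurableSpace.comap (run.draw p) inferInstance) Q := by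
  have h := indep_iSup_of_disjoint (fun p => (run.measurable_draw p).comap_le)
    run.indep.iIndep (S := A) (T := {p}) (Set.disjoint_singleton_right.2 hp)
  simp only [Set.mem_singleton_iff, iSup_iSup_eq_left] at h
  exact h

variable (hψ : ConvexOn ℝ D ψ) (hA : ∀ t, 0 < Ls (t + 1) + η (t + 1) / theta (t + 1))

include hψ hA

/-- The dual-averaging objective depends on the past only through the linear form `gsum`, and its
strong convexity makes the minimizer Lipschitz in that form. Measurability of z follows from this.
-/
lemma exists_continuous_z_eq (t : ℕ) :
    ∃ φ : Vec d → Vec d, Continuous φ ∧ ∀ ω, run.z (t + 1) ω = φ (run.gsum (t + 1) ω) := by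
  refine exists_continuous_factor (K := 1 / (Ls (t + 1) + η (t + 1) / theta (t + 1)))
    (one_div_pos.2 (hA t)).le fun ω ω' => ?_
  have hm : ∀ ω, IsMinOn (fun v => ⟪run.gsum (t + 1) ω, v⟫
      + (∑ τ ∈ Finset.range (t + 1), 1 / theta τ) * ψ v
      + (1 / 2) * (Ls (t + 1) + η (t + 1) / theta (t + 1)) * ‖v‖ ^ 2) D (run.z (t + 1) ω) := by
    intro ω
    have := run.z_min t ω
    simpa only [gsum, gbar, sum_inner, real_inner_smul_left] using this
  exact norm_sub_le_of_isMinOn hψ (Finset.sum_nonneg fun τ _ => (one_div_pos.2 (theta_pos τ)).le)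
    (hA t) (run.z_mem t ω) (run.z_mem t ω') (hm ω) (hm ω')

lemma measurable_z_x (t : ℕ) : Measurable (run.z t) ∧ Measurable (run.x t) := by
  have hg : ∀ t, Measurable (run.gsum t) := fun t =>
    Finset.measurable_sum _ fun τ _ =>
      ((Finset.measurable_sum Finset.univ fun i _ => run.g_measurable τ i).const_smul
        (1 / (m : ℝ))).const_smul (1 / theta τ)
  induction t with
  | zero =>
    rw [show run.z 0 = fun _ => 0 from funext run.z_zero,
      show run.x 0 = fun _ => 0 from funext run.x_zero]
    exact ⟨measurable_const, measurable_const⟩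
  | succ t ih =>
    obtain ⟨φ, hφ, hz⟩ := run.exists_continuous_z_eq hψ hA t
    have h1 : Measurable (run.z (t + 1)) := by
      rw [show run.z (t + 1) = φ ∘ run.gsum (t + 1) from funext hz]
      exact hφ.measurable.comp (hg _)
    refine ⟨h1, ?_⟩
    rw [show run.x (t + 1) = fun ω => (1 - theta t) • run.x t ω + theta t • run.z (t + 1) ω from
      funext (run.x_eq t)]
    exact (ih.2.const_smul (1 - theta t)).add (h1.const_smul (theta t))

variable [NeZero n] [IsProbabilityMeasure μ] [IsProbabilityMeasure Q] {L : ℝ} {v : Fin n → NNReal}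
  (hl : ∀ i s t, |loss i s - loss i t| ≤ L * |s - t|)
  (hμ : ∀ i, μ.map (fun Z => ⟪a i, Z⟫) = gaussianReal 0 (v i)) (hv : ∀ i, v i = 0 → a i = 0)
  (hu : ∀ t, 0 < u t)

include hl hμ hv hu

omit hψ hA in
lemma g_ae_eq {A : Set (ℕ × Fin m)} {t : ℕ} {j : Fin m} (hp : (t, j) ∉ A)
    (hy : AEStronglyMeasurable[run.drawAlg A] (run.y t) Q) :
    run.g t j =ᵐ[Q] fun ω => lossGrad loss a (run.idx t j ω) (run.y t ω + u t • run.Z t j ω) :=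
  ae_eq_lossGrad (ξ := run.draw (t, j)) hl hμ hv (hu t) (run.drawAlg_le A) hy
    (run.measurable_draw _) (run.law t j) (run.indep_drawAlg hp) (run.oracle t j)

omit hψ hA in
-- The selection of a subgradient may use randomness outside the draws, but almost surely there is
-- nothing to select: it is the gradient, a function of the query point and of the current draw.
lemma aestronglyMeasurable_g {A B : Set (ℕ × Fin m)} {t : ℕ} {j : Fin m} (hp : (t, j) ∉ A)
    (hAB : A ⊆ B) (hpB : (t, j) ∈ B)
    (hy : AEStronglyMeasurable[run.drawAlg A] (run.y t) Q) :
    AEStronglyMeasurable[run.drawAlg B] (run.g t j) Q := by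
  have h1 : Measurable[run.drawAlg B] (hy.mk (run.y t)) :=
    hy.measurable_mk.mono (run.drawAlg_mono hAB) le_rfl
  have h2 := (measurable_lossGrad (loss := loss) (a := a) (u t)).comp
    (h1.prodMk (run.measurable_draw_drawAlg hpB))
  refine ⟨_, h2.stronglyMeasurable, ?_⟩
  filter_upwards [run.g_ae_eq hl hμ hv hu hp hy, hy.ae_eq_mk] with ω h3 h4
  rw [h3, h4]
  rfl

/-- Measurability and differentiability have to be proved together. Knowing y_t from past draws
gives independence from the current draw, hence differentiability, hence g_t as a function of the
draws up to t, and then z_{t+1} and x_{t+1}. -/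
lemma aestronglyMeasurable_iterates (t : ℕ) :
    AEStronglyMeasurable[run.drawAlg {p | p.1 < t}] (run.x t) Q ∧
    AEStronglyMeasurable[run.drawAlg {p | p.1 < t}] (run.z t) Q ∧
    AEStronglyMeasurable[run.drawAlg {p | p.1 < t}] (run.y t) Q ∧
    AEStronglyMeasurable[run.drawAlg {p | p.1 < t}] (run.gsum t) Q := by
  have hy : ∀ t, AEStronglyMeasurable[run.drawAlg {p | p.1 < t}] (run.x t) Q →
      AEStronglyMeasurable[run.drawAlg {p | p.1 < t}] (run.z t) Q →
      AEStronglyMeasurable[run.drawAlg {p | p.1 < t}] (run.y t) Q := fun t hx hz => by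
    rw [show run.y t = fun ω => (1 - theta t) • run.x t ω + theta t • run.z t ω from
      funext (run.y_eq t)]
    exact (hx.const_smul (1 - theta t)).add (hz.const_smul (theta t))
  induction t with
  | zero =>
    have hx : AEStronglyMeasurable[run.drawAlg {p | p.1 < 0}] (run.x 0) Q := by
      rw [show run.x 0 = fun _ => 0 from funext run.x_zero]
      exact aestronglyMeasurable_const
    have hz : AEStronglyMeasurable[run.drawAlg {p | p.1 < 0}] (run.z 0) Q := by
      rw [show run.z 0 = fun _ => 0 from funext run.z_zero]
      exact aestronglyMeasurable_const
    refine ⟨hx, hz, hy 0 hx hz, ?_⟩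
    rw [show run.gsum 0 = fun _ => 0 from funext fun ω => by simp [gsum]]
    exact aestronglyMeasurable_const
  | succ t ih =>
    have hsub : {p : ℕ × Fin m | p.1 < t} ⊆ {p | p.1 < t + 1} :=
      fun p hp => Nat.lt_succ_of_lt hp
    have hle := run.drawAlg_mono hsub
    have hg : ∀ j, AEStronglyMeasurable[run.drawAlg {p | p.1 < t + 1}] (run.g t j) Q := fun j =>
      run.aestronglyMeasurable_g hl hμ hv hu (by simp) hsub (by simp) ih.2.2.1
    have hs : AEStronglyMeasurable[run.drawAlg {p | p.1 < t + 1}] (run.gsum (t + 1)) Q := by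
      have hb0 : ∀ s : Finset (Fin m), AEStronglyMeasurable[run.drawAlg {p | p.1 < t + 1}]
          (fun ω => ∑ j ∈ s, run.g t j ω) Q := fun s => by
        induction s using Finset.induction_on with
        | empty => simpa using aestronglyMeasurable_const
        | insert j s hj ih' =>
          simp only [Finset.sum_insert hj]
          exact (hg j).add ih'
      have hb : AEStronglyMeasurable[run.drawAlg {p | p.1 < t + 1}] (run.gbar t) Q :=
        (hb0 Finset.univ).const_smul (1 / (m : ℝ))
      have : run.gsum (t + 1) = fun ω => run.gsum t ω + (1 / theta t) • run.gbar t ω := by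
        funext ω; simp only [gsum, Finset.sum_range_succ]
      rw [this]
      exact (ih.2.2.2.mono hle).add (hb.const_smul (1 / theta t))
    obtain ⟨φ, hφ, hz⟩ := run.exists_continuous_z_eq hψ hA t
    have hz' : AEStronglyMeasurable[run.drawAlg {p | p.1 < t + 1}] (run.z (t + 1)) Q := by
      rw [show run.z (t + 1) = fun ω => φ (run.gsum (t + 1) ω) from funext hz]
      exact hφ.comp_aestronglyMeasurable hs
    have hx' : AEStronglyMeasurable[run.drawAlg {p | p.1 < t + 1}] (run.x (t + 1)) Q := by
      rw [show run.x (t + 1) = fun ω => (1 - theta t) • run.x t ω + theta t • run.z (t + 1) ω from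
        funext (run.x_eq t)]
      exact ((ih.1.mono hle).const_smul (1 - theta t)).add (hz'.const_smul (theta t))
    exact ⟨hx', hz', hy _ hx' hz', hs⟩

/-- The stochastic subgradients are conditionally unbiased. -/
lemma integral_inner_g (hL : 0 ≤ L) {A : Set (ℕ × Fin m)} {t : ℕ} {j : Fin m} (hp : (t, j) ∉ A)
    (hsub : {p | p.1 < t} ⊆ A) {W : Ω → Vec d} (hW : AEStronglyMeasurable[run.drawAlg A] W Q)
    {K : ℝ} (hWK : ∀ ω, ‖W ω‖ ≤ K) :
    ∫ ω, ⟪run.g t j ω, W ω⟫ ∂Q = ∫ ω, ⟪smoothGrad μ loss a (u t) (run.y t ω), W ω⟫ ∂Q := by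
  have hy := (run.aestronglyMeasurable_iterates hψ hA hl hμ hv hu t).2.2.1.mono
    (run.drawAlg_mono hsub)
  rw [← integral_inner_sample hL hl (u t) (run.drawAlg_le A) hy hW (ae_of_all _ hWK)
    (run.measurable_draw (t, j)) (run.law t j) (run.indep_drawAlg hp)]
  refine integral_congr_ae ?_
  filter_upwards [run.g_ae_eq hl hμ hv hu hp hy] with ω h
  rw [h]
  rfl

end Run

/-! ### The expected optimality gap -/

/-- This crude bound serves integrability only and does not enter the rate. -/
lemma norm_smoothGrad_le {d n : ℕ} {μ : Measure (Vec d)} [IsProbabilityMeasure μ]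
    {loss : Fin n → ℝ → ℝ} {a : Fin n → Vec d} {L : ℝ} (hL : 0 ≤ L)
    (hl : ∀ i s t, |loss i s - loss i t| ≤ L * |s - t|) (u : ℝ) (y : Vec d) :
    ‖smoothGrad μ loss a u y‖ ≤ (1 / (n : ℝ)) * ∑ i, L * ‖a i‖ := by
  rw [smoothGrad, norm_smul, Real.norm_of_nonneg (by positivity)]
  refine mul_le_mul_of_nonneg_left ((norm_sum_le _ _).trans (Finset.sum_le_sum fun i _ => ?_))
    (by positivity)
  rw [norm_smul]
  refine mul_le_mul_of_nonneg_right ?_ (norm_nonneg _)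
  have h : ∀ᵐ Z ∂μ, ‖deriv (loss i) ⟪a i, y + u • Z⟫‖ ≤ L :=
    ae_of_all _ fun Z => abs_deriv_le_of_abs_sub_le hL (hl i) ⟪a i, y + u • Z⟫
  simpa using norm_integral_le_of_norm_le_const h

namespace Run

variable {d n : ℕ} {μ : Measure (Vec d)} {loss : Fin n → ℝ → ℝ} {a : Fin n → Vec d}
  {D : Set (Vec d)} {ψ : Vec d → ℝ} {m : ℕ} {u Ls η : ℕ → ℝ}
  {Ω : Type*} [mΩ : MeasurableSpace Ω] {Q : Measure Ω}
  (run : Run μ (linLoss loss a) D ψ m u Ls η Q)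
  (hψ : ConvexOn ℝ D ψ) (hA : ∀ t, 0 < Ls (t + 1) + η (t + 1) / theta (t + 1))
  [NeZero n] [IsProbabilityMeasure μ] [IsProbabilityMeasure Q] {L : ℝ} {v : Fin n → NNReal}
  (hL : 0 ≤ L)
  (hl : ∀ i s t, |loss i s - loss i t| ≤ L * |s - t|)
  (hμ : ∀ i, μ.map (fun Z => ⟪a i, Z⟫) = gaussianReal 0 (v i)) (hv : ∀ i, v i = 0 → a i = 0)
  (hu : ∀ t, 0 < u t)
  {L₀ : ℝ} (hL₀ : 0 ≤ L₀)
  (hl₀ : ∀ i v w, |linLoss loss a i v - linLoss loss a i w| ≤ L₀ * ‖v - w‖)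

/-- The gradient noise of a single sample. -/
noncomputable def noise (t : ℕ) (j : Fin m) (ω : Ω) : Vec d :=
  smoothGrad μ loss a (u t) (run.y t ω) - run.g t j ω

include hψ hA

omit [NeZero n] [IsProbabilityMeasure μ] [IsProbabilityMeasure Q] in
lemma measurable_y (t : ℕ) : Measurable (run.y t) := by
  rw [show run.y t = fun ω => (1 - theta t) • run.x t ω + theta t • run.z t ω from
    funext (run.y_eq t)]
  exact ((run.measurable_z_x hψ hA t).2.const_smul (1 - theta t)).add
    ((run.measurable_z_x hψ hA t).1.const_smul (theta t))

omit [NeZero n] [IsProbabilityMeasure Q] in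
lemma measurable_noise (t : ℕ) (j : Fin m) : Measurable (run.noise t j) :=
  ((measurable_smoothGrad (u t)).comp (run.measurable_y hψ hA t)).sub (run.g_measurable t j)

omit hψ hA [NeZero n] [IsProbabilityMeasure μ] [IsProbabilityMeasure Q] in
include hL₀ hl₀ in
lemma norm_g_le (t : ℕ) (j : Fin m) (ω : Ω) : ‖run.g t j ω‖ ≤ L₀ :=
  norm_le_of_isSubgradient hL₀ (hl₀ _) (run.oracle t j ω)

include hL hl hL₀ hl₀

omit hψ hA [NeZero n] [IsProbabilityMeasure Q] in
lemma norm_noise_le (t : ℕ) (j : Fin m) (ω : Ω) :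
    ‖run.noise t j ω‖ ≤ (1 / (n : ℝ)) * ∑ i, L * ‖a i‖ + L₀ :=
  (norm_sub_le _ _).trans (add_le_add (norm_smoothGrad_le hL hl _ _)
    (run.norm_g_le hL₀ hl₀ t j ω))

omit [NeZero n] in
lemma integrable_inner_noise (t : ℕ) (j : Fin m) {W : Ω → Vec d} (hW : AEStronglyMeasurable W Q)
    {K : ℝ} (hWK : ∀ ω, ‖W ω‖ ≤ K) : Integrable (fun ω => ⟪run.noise t j ω, W ω⟫) Q :=
  Integrable.of_bound ((run.measurable_noise hψ hA t j).aestronglyMeasurable.inner hW)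
    (((1 / (n : ℝ)) * ∑ i, L * ‖a i‖ + L₀) * K) (ae_of_all _ fun ω =>
      (norm_inner_le_norm _ _).trans (mul_le_mul (run.norm_noise_le hL hl hL₀ hl₀ t j ω) (hWK ω)
        (norm_nonneg _) ((norm_nonneg _).trans (run.norm_noise_le hL hl hL₀ hl₀ t j ω))))

include hμ hv hu

lemma integral_inner_noise {A : Set (ℕ × Fin m)} {t : ℕ} {j : Fin m}
    (hp : (t, j) ∉ A) (hsub : {p | p.1 < t} ⊆ A) {W : Ω → Vec d}
    (hW : AEStronglyMeasurable[run.drawAlg A] W Q) {K : ℝ} (hWK : ∀ ω, ‖W ω‖ ≤ K) :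
    ∫ ω, ⟪run.noise t j ω, W ω⟫ ∂Q = 0 := by
  have hWm : AEStronglyMeasurable W Q := hW.mono (run.drawAlg_le A)
  have i1 : Integrable (fun ω => ⟪smoothGrad μ loss a (u t) (run.y t ω), W ω⟫) Q :=
    Integrable.of_bound (((measurable_smoothGrad (u t)).comp
      (run.measurable_y hψ hA t)).aestronglyMeasurable.inner hWm)
      (((1 / (n : ℝ)) * ∑ i, L * ‖a i‖) * K) (ae_of_all _ fun ω =>
      (norm_inner_le_norm _ _).trans (mul_le_mul (norm_smoothGrad_le hL hl _ _) (hWK ω)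
        (norm_nonneg _) ((norm_nonneg _).trans (norm_smoothGrad_le (μ := μ) hL hl 0 0))))
  have i2 : Integrable (fun ω => ⟪run.g t j ω, W ω⟫) Q :=
    Integrable.of_bound ((run.g_measurable t j).aestronglyMeasurable.inner hWm)
      (L₀ * K) (ae_of_all _ fun ω => (norm_inner_le_norm _ _).trans
        (mul_le_mul (run.norm_g_le hL₀ hl₀ t j ω) (hWK ω) (norm_nonneg _) hL₀))
  simp only [noise, inner_sub_left]
  rw [integral_sub i1 i2, run.integral_inner_g hψ hA hl hμ hv hu hL hp hsub hW hWK, sub_self]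

/-- With G the mean and g the sample, ‖G − g‖² − 2⟪G − g, G⟫ = ‖g‖² − ‖G‖² ≤ L₀², and the subtracted
term has mean zero. -/
lemma integral_norm_sq_noise_le (t : ℕ) (j : Fin m) :
    ∫ ω, ⟪run.noise t j ω, run.noise t j ω⟫ ∂Q ≤ L₀ ^ 2 := by
  have hG : AEStronglyMeasurable[run.drawAlg {p | p.1 < t}]
      (fun ω => smoothGrad μ loss a (u t) (run.y t ω)) Q := by
    have hy := (run.aestronglyMeasurable_iterates hψ hA hl hμ hv hu t).2.2.1
    exact ⟨_, ((measurable_smoothGrad (μ := μ) (loss := loss) (a := a) (u t)).comp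
      hy.measurable_mk).stronglyMeasurable, hy.ae_eq_mk.fun_comp (smoothGrad μ loss a (u t))⟩
  have hGm := hG.mono (run.drawAlg_le _)
  have hGb : ∀ ω, ‖smoothGrad μ loss a (u t) (run.y t ω)‖ ≤ (1 / (n : ℝ)) * ∑ i, L * ‖a i‖ :=
    fun ω => norm_smoothGrad_le hL hl _ _
  have h0 := run.integral_inner_noise hψ hA hL hl hμ hv hu hL₀ hl₀ (j := j) (by simp) subset_rfl
    hG hGb
  have i0 := run.integrable_inner_noise hψ hA hL hl hL₀ hl₀ t j hGm hGb
  have i1 : Integrable (fun ω => ⟪run.noise t j ω, run.noise t j ω⟫) Q :=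
    run.integrable_inner_noise hψ hA hL hl hL₀ hl₀ t j
      (run.measurable_noise hψ hA t j).aestronglyMeasurable
      (run.norm_noise_le hL hl hL₀ hl₀ t j)
  calc ∫ ω, ⟪run.noise t j ω, run.noise t j ω⟫ ∂Q
      = ∫ ω, (⟪run.noise t j ω, run.noise t j ω⟫
          - 2 * ⟪run.noise t j ω, smoothGrad μ loss a (u t) (run.y t ω)⟫) ∂Q := by
        rw [integral_sub i1 (i0.const_mul 2), integral_const_mul, h0]
        simp
    _ ≤ ∫ _, L₀ ^ 2 ∂Q := by
        refine integral_mono (i1.sub (i0.const_mul 2)) (integrable_const _) fun ω => ?_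
        have hg := run.norm_g_le hL₀ hl₀ t j ω
        have hg2 : ‖run.g t j ω‖ ^ 2 ≤ L₀ ^ 2 := pow_le_pow_left₀ (norm_nonneg _) hg 2
        have hG2 := real_inner_self_nonneg (x := smoothGrad μ loss a (u t) (run.y t ω))
        rw [← real_inner_self_eq_norm_sq] at hg2
        simp only [noise, inner_sub_left, inner_sub_right]
        rw [real_inner_comm (smoothGrad μ loss a (u t) (run.y t ω)) (run.g t j ω)]
        linarith
    _ = L₀ ^ 2 := by simp

omit hψ hA hL hl hμ hv hu hL₀ hl₀ [NeZero n] [IsProbabilityMeasure μ] [IsProbabilityMeasure Q] in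
lemma smoothGrad_sub_gbar (hm : 1 ≤ m) (t : ℕ) (ω : Ω) :
    smoothGrad μ loss a (u t) (run.y t ω) - run.gbar t ω
      = (1 / (m : ℝ)) • ∑ j, run.noise t j ω := by
  have hm' : (m : ℝ) ≠ 0 := by positivity
  simp only [noise, gbar, Finset.sum_sub_distrib, Finset.sum_const, Finset.card_univ,
    Fintype.card_fin, smul_sub]
  rw [← Nat.cast_smul_eq_nsmul ℝ, smul_smul, one_div_mul_cancel hm', one_smul]

lemma integral_noise_sq_le (hm : 1 ≤ m) (t : ℕ) :
    Integrable (fun ω => ‖smoothGrad μ loss a (u t) (run.y t ω) - run.gbar t ω‖ ^ 2) Q ∧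
    ∫ ω, ‖smoothGrad μ loss a (u t) (run.y t ω) - run.gbar t ω‖ ^ 2 ∂Q ≤ L₀ ^ 2 / m := by
  have hm0 : (0 : ℝ) < m := by positivity
  have i1 : ∀ j k, Integrable (fun ω => ⟪run.noise t j ω, run.noise t k ω⟫) Q := fun j k =>
    run.integrable_inner_noise hψ hA hL hl hL₀ hl₀ t j
      (run.measurable_noise hψ hA t k).aestronglyMeasurable
      (run.norm_noise_le hL hl hL₀ hl₀ t k)
  have e : ∀ ω, ‖smoothGrad μ loss a (u t) (run.y t ω) - run.gbar t ω‖ ^ 2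
      = (1 / (m : ℝ)) ^ 2 * ∑ j, ∑ k, ⟪run.noise t j ω, run.noise t k ω⟫ := fun ω => by
    rw [run.smoothGrad_sub_gbar hm, norm_smul, mul_pow, Real.norm_of_nonneg (by positivity),
      ← real_inner_self_eq_norm_sq, sum_inner]
    simp only [inner_sum]
  simp_rw [e]
  have i2 : Integrable (fun ω => ∑ j, ∑ k, ⟪run.noise t j ω, run.noise t k ω⟫) Q :=
    integrable_finsetSum _ fun j _ => integrable_finsetSum _ fun k _ => i1 j k
  refine ⟨i2.const_mul _, ?_⟩
  rw [integral_const_mul, integral_finsetSum _ fun j _ => integrable_finsetSum _ fun k _ => i1 j k]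
  have h1 : ∀ j : Fin m, ∫ ω, ∑ k, ⟪run.noise t j ω, run.noise t k ω⟫ ∂Q ≤ L₀ ^ 2 := by
    intro j
    rw [integral_finsetSum _ fun k _ => i1 j k, Finset.sum_eq_single j]
    · exact run.integral_norm_sq_noise_le hψ hA hL hl hμ hv hu hL₀ hl₀ t j
    -- The noise of sample k is determined by the past and by draw (t, k), all independent of draw
    -- (t, j). Cross terms therefore vanish, which yields the factor 1/m.
    · intro k _ hkj
      have hsub : {p : ℕ × Fin m | p.1 < t} ⊆ {p | p.1 < t} ∪ {(t, k)} := Set.subset_union_left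
      have hy := (run.aestronglyMeasurable_iterates hψ hA hl hμ hv hu t).2.2.1
      have hg := run.aestronglyMeasurable_g hl hμ hv hu (A := {p | p.1 < t}) (t := t) (j := k)
        (by simp) hsub (by simp) hy
      have hG : AEStronglyMeasurable[run.drawAlg ({p | p.1 < t} ∪ {(t, k)})]
          (fun ω => smoothGrad μ loss a (u t) (run.y t ω)) Q := by
        have hy' := hy.mono (run.drawAlg_mono hsub)
        exact ⟨_, ((measurable_smoothGrad (μ := μ) (loss := loss) (a := a) (u t)).comp
          hy'.measurable_mk).stronglyMeasurable, hy'.ae_eq_mk.fun_comp (smoothGrad μ loss a (u t))⟩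
      exact run.integral_inner_noise hψ hA hL hl hμ hv hu hL₀ hl₀ (by simp [hkj.symm]) hsub
        (hG.sub hg) (run.norm_noise_le hL hl hL₀ hl₀ t k)
    · simp
  calc (1 / (m : ℝ)) ^ 2 * ∑ j, ∫ ω, ∑ k, ⟪run.noise t j ω, run.noise t k ω⟫ ∂Q
      ≤ (1 / (m : ℝ)) ^ 2 * ∑ _j : Fin m, L₀ ^ 2 := by
        gcongr with j; exact h1 j
    _ = L₀ ^ 2 / m := by
        simp only [Finset.sum_const, Finset.card_univ, Fintype.card_fin, nsmul_eq_mul]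
        field_simp

/-- The iterate z_t depends on earlier draws only and stays bounded because D is, so the linear
noise term is a sum of martingale increments. -/
lemma integral_inner_noise_z (hm : 1 ≤ m) {R : ℝ} (hR : 0 ≤ R) (hD : D ⊆ Metric.closedBall 0 R)
    (w : Vec d) (t : ℕ) :
    Integrable (fun ω => ⟪smoothGrad μ loss a (u t) (run.y t ω) - run.gbar t ω,
      run.z t ω - w⟫) Q ∧
    ∫ ω, ⟪smoothGrad μ loss a (u t) (run.y t ω) - run.gbar t ω, run.z t ω - w⟫ ∂Q = 0 := by
  have hz : ∀ ω, ‖run.z t ω - w‖ ≤ R + ‖w‖ := fun ω => by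
    refine (norm_sub_le _ _).trans (add_le_add_left ?_ _)
    cases t with
    | zero => rw [run.z_zero]; simpa using hR
    | succ t => simpa using hD (run.z_mem t ω)
  have hzm : AEStronglyMeasurable[run.drawAlg {p | p.1 < t}] (fun ω => run.z t ω - w) Q :=
    (run.aestronglyMeasurable_iterates hψ hA hl hμ hv hu t).2.1.sub aestronglyMeasurable_const
  have i1 : ∀ j, Integrable (fun ω => ⟪run.noise t j ω, run.z t ω - w⟫) Q := fun j =>
    run.integrable_inner_noise hψ hA hL hl hL₀ hl₀ t j (hzm.mono (run.drawAlg_le _)) hz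
  simp_rw [run.smoothGrad_sub_gbar hm, real_inner_smul_left, sum_inner]
  refine ⟨(integrable_finsetSum _ fun j _ => i1 j).const_mul _, ?_⟩
  rw [integral_const_mul, integral_finsetSum _ fun j _ => i1 j]
  simp only [run.integral_inner_noise hψ hA hL hl hμ hv hu hL₀ hl₀
    (A := {p | p.1 < t}) (t := t) (by simp) subset_rfl hzm hz, Finset.sum_const_zero, mul_zero]

end Run

/-- The step sizes of accelerated dual averaging, balanced. -/
lemma step_size_balance {T : ℕ} (hT : 1 ≤ T) {q X r B R L₀ m E A N₀ : ℝ} (hr : 0 < r) (hB : 0 ≤ B)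
    (hR : 0 < R) (hL₀ : 0 < L₀) (hm : 0 < m) (hE : 0 ≤ E)
    (hq : ((T : ℝ) + 1) / 2 ≤ q) (hA : A ≤ (T + 1) * (B / r + L₀ * √(T + 1) / (R * √m)))
    (hN : N₀ ≤ T * √T * (L₀ * R / (2 * √m)))
    (hX : q ^ 2 * X ≤ (1 / 2) * A * R ^ 2 + T * (r * E) + N₀) :
    X ≤ 2 * R ^ 2 * B / (r * T) + 4 * (r * E) / T + 5 * L₀ * R / √(T * m) := by
  have hT0 : (1 : ℝ) ≤ T := by exact_mod_cast hT
  have hTp : (0 : ℝ) < T := by linarith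
  have hsm : 0 < √m := Real.sqrt_pos.2 hm
  set s := √(T : ℝ) with hs
  have hsp : 0 < s := Real.sqrt_pos.2 hTp
  have hs2 : s ^ 2 = T := Real.sq_sqrt hTp.le
  set s' := √((T : ℝ) + 1) with hs'
  have hsp' : 0 < s' := Real.sqrt_pos.2 (by linarith)
  have hs2' : s' ^ 2 = T + 1 := Real.sq_sqrt (by linarith)
  have hss : s ≤ s' := Real.sqrt_le_sqrt (by linarith)
  rw [Real.sqrt_mul hTp.le]
  set Y := 2 * R ^ 2 * B / (r * T) + 4 * (r * E) / T + 5 * L₀ * R / (s * √m) with hY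
  have hY0 : 0 ≤ Y := by positivity
  set K := L₀ * R / √m with hK
  have hK0 : 0 < K := by positivity
  have hq2 : ((T : ℝ) + 1) ^ 2 / 4 ≤ q ^ 2 := by nlinarith
  have key : (1 / 2) * A * R ^ 2 + T * (r * E) + N₀ ≤ ((T : ℝ) + 1) ^ 2 / 4 * Y := by
    have e1 : (1 / 2) * A * R ^ 2 ≤ (T + 1) / 2 * (R ^ 2 * B / r) + (T + 1) / 2 * (K * s') := by
      have := mul_le_mul_of_nonneg_left hA (by positivity : 0 ≤ (1 / 2) * R ^ 2)
      have e : (1 / 2) * R ^ 2 * ((T + 1) * (B / r + L₀ * s' / (R * √m)))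
          = (T + 1) / 2 * (R ^ 2 * B / r) + (T + 1) / 2 * (K * s') := by
        rw [hK]; field_simp
      linarith
    have e2 : N₀ ≤ T * s * K / 2 := by
      refine hN.trans (le_of_eq ?_)
      rw [hK]; field_simp
    have e3 : ((T : ℝ) + 1) ^ 2 / 4 * Y = ((T : ℝ) + 1) ^ 2 / (2 * T) * (R ^ 2 * B / r)
        + ((T : ℝ) + 1) ^ 2 / T * (r * E) + 5 / 4 * (((T : ℝ) + 1) ^ 2 / s) * K := by
      rw [hY, hK]; field_simp; ring
    have f1 : ((T : ℝ) + 1) / 2 ≤ ((T : ℝ) + 1) ^ 2 / (2 * T) := by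
      rw [div_le_div_iff₀ (by norm_num) (by positivity)]; nlinarith
    have f2 : (T : ℝ) ≤ ((T : ℝ) + 1) ^ 2 / T := by
      rw [le_div_iff₀ hTp]; nlinarith
    -- The two terms on the left are each at most (T + 1)²/(2s). The excess of 5/4 over 1 is slack,
    -- giving 5 in the final bound.
    have f3 : ((T : ℝ) + 1) / 2 * s' + T * s / 2 ≤ 5 / 4 * (((T : ℝ) + 1) ^ 2 / s) := by
      have g1 : ((T : ℝ) + 1) / 2 * s' ≤ ((T : ℝ) + 1) ^ 2 / s / 2 := by
        have h1 : s' * s ≤ T + 1 := by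
          rw [← hs2', sq]; exact mul_le_mul_of_nonneg_left hss hsp'.le
        have h2 := mul_le_mul_of_nonneg_left h1 (by linarith : (0 : ℝ) ≤ T + 1)
        rw [div_div, le_div_iff₀ (by positivity)]
        linarith
      have g2 : T * s / 2 ≤ ((T : ℝ) + 1) ^ 2 / s / 2 := by
        have : (T : ℝ) * s * s = T ^ 2 := by rw [mul_assoc, ← sq, hs2, sq]
        rw [div_le_div_iff_of_pos_right (by norm_num), le_div_iff₀ hsp, this]
        linarith [sq_nonneg (T : ℝ), add_sq (T : ℝ) 1]
      have g3 : 0 ≤ ((T : ℝ) + 1) ^ 2 / s := by positivity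
      linarith
    have p1 := mul_le_mul_of_nonneg_right f1 (by positivity : 0 ≤ R ^ 2 * B / r)
    have p2 := mul_le_mul_of_nonneg_right f2 (by positivity : 0 ≤ r * E)
    have p3 := mul_le_mul_of_nonneg_right f3 hK0.le
    rw [e3]
    linarith
  -- Only a lower bound on q is known, so q² may be replaced only when X ≥ 0; the negated claim X >
  -- Y ≥ 0 supplies this sign.
  by_contra hlt
  push Not at hlt
  have h1 : ((T : ℝ) + 1) ^ 2 / 4 * Y < ((T : ℝ) + 1) ^ 2 / 4 * X :=
    mul_lt_mul_of_pos_left hlt (by positivity)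
  have h2 : ((T : ℝ) + 1) ^ 2 / 4 * X ≤ q ^ 2 * X :=
    mul_le_mul_of_nonneg_right hq2 (hY0.trans hlt.le)
  linarith

/-! ### Expected gap of a run, in terms of the curvature and bias constants of the data -/

namespace Run

variable {d n : ℕ} {μ : Measure (Vec d)} {loss : Fin n → ℝ → ℝ} {a : Fin n → Vec d}
  {D : Set (Vec d)} {ψ : Vec d → ℝ} {m : ℕ} {u Ls η : ℕ → ℝ}
  {Ω : Type*} [mΩ : MeasurableSpace Ω] {Q : Measure Ω}
  (run : Run μ (linLoss loss a) D ψ m u Ls η Q)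
  [NeZero n] [IsProbabilityMeasure μ] [IsProbabilityMeasure Q] {L : ℝ} {v : Fin n → NNReal}

/-- The deterministic inequality is applied to the risk smoothed at radius θ_t r. The shrinking
radius makes the bias at w equal to θ_t times a constant, the form that inequality requires, while
the smoothness B/u_t grows only linearly in t. Integrating removes the linear noise and leaves the
variance. -/
theorem expected_gap_le (hψ : ConvexOn ℝ D ψ) (hψm : Measurable fun v : D => ψ v) (hL : 0 ≤ L)
    (hl : ∀ i s t, |loss i s - loss i t| ≤ L * |s - t|)
    (hc : ∀ i, ConvexOn ℝ Set.univ (loss i))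
    (hμ : ∀ i, μ.map (fun Z => ⟪a i, Z⟫) = gaussianReal 0 (v i)) (hv : ∀ i, v i = 0 → a i = 0)
    {M : ℝ} (hM : ∀ h : Vec d, (1 / (n : ℝ)) * ∑ i, ⟪a i, h⟫ ^ 2 / √(v i) ≤ M * ‖h‖ ^ 2)
    {L₀ : ℝ} (hL₀ : 0 < L₀)
    (hl₀ : ∀ i v w, |linLoss loss a i v - linLoss loss a i w| ≤ L₀ * ‖v - w‖)
    {R : ℝ} (hR : 0 < R) (hD : D ⊆ Metric.closedBall 0 R) (hm : 1 ≤ m)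
    {r B : ℝ} (hr : 0 < r) (hB : 0 ≤ B) (hBM : 4 * L * M ≤ B)
    (hu : ∀ t, u t = theta t * r) (hLs : ∀ t, Ls t = B / u t)
    (hη : ∀ t : ℕ, η t = L₀ * √((t : ℝ) + 1) / (R * √(m : ℝ)))
    {w : Vec d} (hw : w ∈ D) (hmin : IsMinOn (fun v => empRisk loss a v + ψ v) D w)
    {T : ℕ} (hT : 1 ≤ T) :
    Integrable (fun ω => empRisk loss a (run.x T ω) + ψ (run.x T ω) - empRisk loss a w - ψ w) Q ∧
    ∫ ω, (empRisk loss a (run.x T ω) + ψ (run.x T ω) - empRisk loss a w - ψ w) ∂Q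
      ≤ 2 * R ^ 2 * B / (r * T) + 4 * (r * (L * ((1 / (n : ℝ)) * ∑ i, √(v i)))) / T
        + 5 * L₀ * R / √((T : ℝ) * m) := by
  obtain ⟨t, rfl⟩ : ∃ t, T = t + 1 := ⟨T - 1, by omega⟩
  have hm0 : (0 : ℝ) < m := by positivity
  have hu0 : ∀ t, 0 < u t := fun t => by rw [hu]; exact mul_pos (theta_pos t) hr
  have hη0 : ∀ t, 0 < η t := fun t => by rw [hη]; positivity
  have hLs0 : ∀ t, 0 ≤ Ls t := fun t => by rw [hLs]; exact div_nonneg hB (hu0 t).le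
  have hA : ∀ t, 0 < Ls t + η t / theta t := fun t =>
    add_pos_of_nonneg_of_pos (hLs0 t) (div_pos (hη0 t) (theta_pos t))
  have hA' : ∀ t, 0 < Ls (t + 1) + η (t + 1) / theta (t + 1) := fun t => hA (t + 1)
  have huu : ∀ t, u (t + 1) ≤ u t := fun t => by
    rw [hu, hu]; exact mul_le_mul_of_nonneg_right (theta_anti t.le_succ) hr.le
  have hAm : ∀ t, Ls t + η t / theta t ≤ Ls (t + 1) + η (t + 1) / theta (t + 1) := fun t => by
    have h1 : Ls t ≤ Ls (t + 1) := by
      rw [hLs, hLs]; exact div_le_div_of_nonneg_left hB (hu0 _) (huu t)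
    have h2 : η t ≤ η (t + 1) := by
      rw [hη, hη]
      gcongr
      simp
    exact add_le_add h1 (div_le_div₀ (hη0 _).le h2 (theta_pos _) (theta_anti t.le_succ))
  set c := r * (L * ((1 / (n : ℝ)) * ∑ i, √(v i : ℝ))) with hcdef
  set e : ℕ → Ω → Vec d := fun τ ω => smoothGrad μ loss a (u τ) (run.y τ ω) - run.gbar τ ω with he
  -- the deterministic inequality along each trajectory
  have hdet : ∀ ω, (1 / theta t) ^ 2 * (empRisk loss a (run.x (t + 1) ω) + ψ (run.x (t + 1) ω)
      - empRisk loss a w - ψ w)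
      ≤ (1 / 2) * (Ls (t + 1) + η (t + 1) / theta (t + 1)) * ‖w‖ ^ 2 + (t + 1) * c
        + ∑ τ ∈ Finset.range (t + 1), ‖e τ ω‖ ^ 2 / (2 * η τ * theta τ)
        + ∑ τ ∈ Finset.range (t + 1), (1 / theta τ) * ⟪e τ ω, run.z τ ω - w⟫ := by
    intro ω
    have key := dual_averaging_inequality (x := fun t => run.x t ω) (y := fun t => run.y t ω)
      (z := fun t => run.z t ω) (g := fun t => run.gbar t ω)
      (G := fun t => smoothGrad μ loss a (u t) (run.y t ω)) (F := fun t => smoothRisk μ loss a (u t))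
      (L := Ls) (η := η) hψ (run.z_zero ω) (fun t => run.z_mem t ω)
      (fun t => run.y_eq t ω) (fun t => run.x_eq t ω) hη0 hLs0 hAm
      (fun t => run.z_min t ω)
      (fun t v => smoothRisk_add_inner_smoothGrad_le hL hl hc hμ hv (hu0 t) _ v)
      (fun t => by
        refine (smoothRisk_le_quadratic hL hl hc hμ hv hM (hu0 t) (run.y t ω) _).trans ?_
        refine add_le_add_right (mul_le_mul_of_nonneg_right ?_ (sq_nonneg _)) _
        rw [hLs, div_div, div_le_div_iff₀ (hu0 t) (mul_pos (hu0 t) two_pos)]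
        nlinarith [hu0 t])
      (fun t v => smoothRisk_mono hl hc hμ (hu0 _).le (huu t) v)
      hw (b := empRisk loss a w) (c := c) (fun t => by
        have := smoothRisk_le_empRisk_add hL hl hμ (hu0 t).le w
        refine this.trans (le_of_eq ?_)
        rw [hu, hcdef]; ring) t
    refine le_trans (mul_le_mul_of_nonneg_left ?_ (sq_nonneg _)) key
    -- Smoothing never lowers a convex function (radius 0 against radius u_t), so the bias is paid
    -- at w only and not at the iterate.
    have h0 := smoothRisk_mono hl hc hμ le_rfl (hu0 t).le (run.x (t + 1) ω)
    rw [smoothRisk_zero] at h0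
    linarith
  have hN := fun τ => run.integral_noise_sq_le hψ hA' hL hl hμ hv hu0 hL₀.le hl₀ hm τ
  have hZ := fun τ => run.integral_inner_noise_z hψ hA' hL hl hμ hv hu0 hL₀.le hl₀ hm hR.le hD w τ
  have hxD : ∀ ω, run.x (t + 1) ω ∈ D := fun ω =>
    iterate_mem (x := fun t => run.x t ω) (z := fun t => run.z t ω) hψ.1
      (fun t => run.z_mem t ω) (fun t => run.x_eq t ω) t
  have hx := (run.measurable_z_x hψ hA' (t + 1)).2
  have hmeas : AEStronglyMeasurable (fun ω => empRisk loss a (run.x (t + 1) ω)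
      + ψ (run.x (t + 1) ω) - empRisk loss a w - ψ w) Q := by
    have h1 : Measurable fun ω => ψ (run.x (t + 1) ω) :=
      hψm.comp (hx.subtype_mk (h := hxD))
    have h2 : Measurable fun ω => empRisk loss a (run.x (t + 1) ω) := by
      unfold empRisk linLoss
      refine (Finset.measurable_sum _ fun i _ => ?_).const_mul _
      exact (continuous_of_abs_sub_le (hl i)).measurable.comp (hx.const_inner)
    exact (((h2.add h1).sub_const _).sub_const _).aestronglyMeasurable
  -- Minimality of w places the gap between 0 and an integrable upper bound, which gives its
  -- integrability.
  have hnn : ∀ ω, 0 ≤ empRisk loss a (run.x (t + 1) ω) + ψ (run.x (t + 1) ω)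
      - empRisk loss a w - ψ w := fun ω => by
    have := isMinOn_iff.1 hmin _ (hxD ω)
    linarith
  have iN : ∀ τ ∈ Finset.range (t + 1), Integrable (fun ω => ‖e τ ω‖ ^ 2 / (2 * η τ * theta τ)) Q :=
    fun τ _ => (hN τ).1.div_const _
  have iZ : ∀ τ ∈ Finset.range (t + 1),
      Integrable (fun ω => (1 / theta τ) * ⟪e τ ω, run.z τ ω - w⟫) Q :=
    fun τ _ => (hZ τ).1.const_mul _
  have i1 : Integrable (fun ω => (1 / 2) * (Ls (t + 1) + η (t + 1) / theta (t + 1)) * ‖w‖ ^ 2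
      + (t + 1) * c + ∑ τ ∈ Finset.range (t + 1), ‖e τ ω‖ ^ 2 / (2 * η τ * theta τ)) Q :=
    (integrable_const _).add (integrable_finsetSum _ iN)
  have i2 : Integrable (fun ω => ∑ τ ∈ Finset.range (t + 1),
      (1 / theta τ) * ⟪e τ ω, run.z τ ω - w⟫) Q := integrable_finsetSum _ iZ
  have hq := one_div_pos.2 (theta_pos t)
  have hint : Integrable (fun ω => empRisk loss a (run.x (t + 1) ω) + ψ (run.x (t + 1) ω)
      - empRisk loss a w - ψ w) Q := by
    have h1 : Integrable (fun ω => (1 / theta t) ^ 2 * (empRisk loss a (run.x (t + 1) ω)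
        + ψ (run.x (t + 1) ω) - empRisk loss a w - ψ w)) Q := by
      refine (i1.add i2).mono' (hmeas.const_mul _) (ae_of_all _ fun ω => ?_)
      rw [Real.norm_of_nonneg (mul_nonneg (sq_nonneg _) (hnn ω))]
      exact hdet ω
    exact (integrable_const_mul_iff (IsUnit.mk0 _ (by positivity)) _).1 h1
  refine ⟨hint, ?_⟩
  have hE : (1 / theta t) ^ 2 * ∫ ω, (empRisk loss a (run.x (t + 1) ω) + ψ (run.x (t + 1) ω)
      - empRisk loss a w - ψ w) ∂Q
      ≤ (1 / 2) * (Ls (t + 1) + η (t + 1) / theta (t + 1)) * ‖w‖ ^ 2 + (t + 1) * c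
        + ∑ τ ∈ Finset.range (t + 1), (L₀ ^ 2 / m) / (2 * η τ * theta τ) := by
    rw [← integral_const_mul]
    refine (integral_mono (hint.const_mul _) (i1.add i2) hdet).trans ?_
    simp only [Pi.add_apply]
    rw [integral_add i1 i2, integral_add (integrable_const _) (integrable_finsetSum _ iN),
      integral_finsetSum _ iN, integral_finsetSum _ iZ]
    have h0 : ∑ τ ∈ Finset.range (t + 1), ∫ ω, (1 / theta τ) * ⟪e τ ω, run.z τ ω - w⟫ ∂Q = 0 :=
      Finset.sum_eq_zero fun τ _ => by
        rw [integral_const_mul, (hZ τ).2, mul_zero]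
    rw [h0, add_zero, integral_const, probReal_univ, one_smul]
    refine add_le_add_right (Finset.sum_le_sum fun τ _ => ?_) _
    rw [integral_div]
    have := hη0 τ
    have := theta_pos τ
    gcongr
    exact (hN τ).2
  have hwR : ‖w‖ ^ 2 ≤ R ^ 2 := by
    have := hD hw
    rw [mem_closedBall_zero_iff] at this
    exact pow_le_pow_left₀ (norm_nonneg _) this 2
  have hE' := hE.trans (add_le_add_left (add_le_add_left (mul_le_mul_of_nonneg_left hwR
    (mul_nonneg (by norm_num) (hA (t + 1)).le)) _) _)
  have hLE : 0 ≤ L * ((1 / (n : ℝ)) * ∑ i, √(v i : ℝ)) := by positivity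
  have hth := one_div_theta_le (t + 1)
  refine step_size_balance hT hr hB hR hL₀ hm0 hLE (q := 1 / theta t)
    (A := Ls (t + 1) + η (t + 1) / theta (t + 1))
    (N₀ := ∑ τ ∈ Finset.range (t + 1), (L₀ ^ 2 / m) / (2 * η τ * theta τ)) ?_ ?_ ?_ ?_
  · refine le_trans (le_of_eq ?_) (le_one_div_theta t)
    push_cast; ring
  · have h1 : Ls (t + 1) + η (t + 1) / theta (t + 1)
        = (1 / theta (t + 1)) * (B / r + L₀ * √(((t + 1 : ℕ) : ℝ) + 1) / (R * √m)) := by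
      have := theta_pos (t + 1)
      rw [hLs, hu, hη]; field_simp
    rw [h1]
    exact mul_le_mul_of_nonneg_right hth (by positivity)
  · have h1 : ∀ τ ∈ Finset.range (t + 1), (L₀ ^ 2 / m) / (2 * η τ * theta τ)
        ≤ √((t + 1 : ℕ) : ℝ) * (L₀ * R / (2 * √m)) := by
      intro τ hτ
      have hθ := theta_pos τ
      have h2 := one_div_theta_le τ
      have hs : 0 < √((τ : ℝ) + 1) := by positivity
      have hsq : √((τ : ℝ) + 1) ^ 2 = τ + 1 := Real.sq_sqrt (by positivity)
      have hsm : √(m : ℝ) ^ 2 = m := Real.sq_sqrt hm0.le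
      have e1 : (L₀ ^ 2 / m) / (2 * η τ * theta τ)
          = (1 / theta τ) / √((τ : ℝ) + 1) * (L₀ * R / (2 * √m)) := by
        rw [hη]; nth_rewrite 1 [← hsm]; field_simp
      rw [e1]
      refine mul_le_mul_of_nonneg_right ?_ (by positivity)
      calc (1 / theta τ) / √((τ : ℝ) + 1) ≤ √((τ : ℝ) + 1) := by
            rw [div_le_iff₀ hs, ← sq, hsq]; exact h2
        _ ≤ _ := by
            refine Real.sqrt_le_sqrt ?_
            have := Finset.mem_range.1 hτ
            exact_mod_cast this
    refine (Finset.sum_le_sum h1).trans (le_of_eq ?_)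
    rw [Finset.sum_const, Finset.card_range, nsmul_eq_mul, mul_assoc]
  · rw [hcdef] at hE'
    push_cast
    exact hE'

end Run

/-! ### Exponential moments of subgaussian variables -/

section ExpMoments

variable {Ω : Type*} [MeasurableSpace Ω] {P : Measure Ω} [IsProbabilityMeasure P]

/-- A variable with subgaussian tails of variance proxy `s` has a bounded exponential square
moment. -/
lemma lintegral_exp_sq_le {X : Ω → ℝ} (hX : Measurable X) {s : ℝ} (hs : 0 < s)
    (htail : ∀ t, 0 < t → P.real {ω | t < |X ω|} ≤ 2 * Real.exp (-(1 / 2) * (t ^ 2 / s))) :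
    ∫⁻ ω, ENNReal.ofReal (Real.exp (X ω ^ 2 / (4 * s))) ∂P ≤ 3 := by
  set g : ℝ → ℝ := fun t => t / (2 * s) * Real.exp (t ^ 2 / (4 * s)) with hg
  have hgc : Continuous g := by fun_prop
  have hderiv : ∀ t, HasDerivAt (fun t : ℝ => Real.exp (t ^ 2 / (4 * s))) (g t) t := fun t => by
    have h := ((hasDerivAt_pow 2 t).div_const (4 * s)).exp
    refine h.congr_deriv ?_
    simp only [hg]
    field_simp
    norm_num
    ring
  have hint : ∀ x, ∫ t in 0..x, g t = Real.exp (x ^ 2 / (4 * s)) - 1 := fun x => by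
    rw [intervalIntegral.integral_eq_sub_of_hasDerivAt (fun t _ => hderiv t)
      (hgc.intervalIntegrable _ _)]
    simp
  have hlayer := lintegral_comp_eq_lintegral_meas_lt_mul P (f := fun ω => |X ω|) (g := g)
    (ae_of_all _ fun ω => abs_nonneg _) hX.abs.aemeasurable
    (fun t _ => hgc.intervalIntegrable _ _)
    ((ae_restrict_mem measurableSet_Ioi).mono fun t ht => by
      have : 0 < t := ht
      simp only [hg]; positivity)
  simp only [hint, sq_abs] at hlayer
  -- The function k is g times the tail bound 2exp(−t²/(2s)). It has an explicit primitive and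
  -- integral 2; the remaining 1 of the bound 3 is exp 0.
  set k : ℝ → ℝ := fun t => t / s * Real.exp (-(t ^ 2 / (4 * s))) with hk
  have hkd : ∀ t ∈ Set.Ici (0 : ℝ),
      HasDerivAt (fun t : ℝ => -(2 * Real.exp (-(t ^ 2 / (4 * s))))) (k t) t := fun t _ => by
    have h := ((((hasDerivAt_pow 2 t).div_const (4 * s)).fun_neg.exp).const_mul 2).fun_neg
    refine h.congr_deriv ?_
    simp only [hk]
    field_simp
    norm_num
    ring
  have hk0 : ∀ t ∈ Set.Ioi (0 : ℝ), 0 ≤ k t := fun t ht => by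
    have : 0 < t := ht
    simp only [hk]; positivity
  have hlim : Filter.Tendsto (fun t : ℝ => -(2 * Real.exp (-(t ^ 2 / (4 * s))))) Filter.atTop
      (nhds 0) := by
    have h1 : Filter.Tendsto (fun t : ℝ => t ^ 2 / (4 * s)) Filter.atTop Filter.atTop :=
      (Filter.tendsto_pow_atTop two_ne_zero).atTop_div_const (by positivity)
    have h2 := ((Real.tendsto_exp_neg_atTop_nhds_zero.comp h1).const_mul 2).neg
    simpa using h2
  have hkint := integral_Ioi_of_hasDerivAt_of_nonneg' hkd hk0 hlim
  have hkI := integrableOn_Ioi_deriv_of_nonneg' hkd hk0 hlim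
  have hbound : ∫⁻ t in Set.Ioi 0, P {ω | t < |X ω|} * ENNReal.ofReal (g t) ≤ 2 := by
    calc ∫⁻ t in Set.Ioi 0, P {ω | t < |X ω|} * ENNReal.ofReal (g t)
        ≤ ∫⁻ t in Set.Ioi 0, ENNReal.ofReal (k t) := by
          refine setLIntegral_mono' measurableSet_Ioi fun t ht => ?_
          have ht0 : 0 < t := ht
          have h1 := ENNReal.ofReal_le_ofReal (htail t ht0)
          rw [ofReal_measureReal] at h1
          refine (mul_le_mul_left h1 _).trans ?_
          rw [← ENNReal.ofReal_mul (by positivity)]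
          refine ENNReal.ofReal_le_ofReal (le_of_eq ?_)
          simp only [hg, hk]
          have e : -(t ^ 2 / (4 * s)) = -(1 / 2) * (t ^ 2 / s) + t ^ 2 / (4 * s) := by
            field_simp; norm_num
          rw [e, Real.exp_add]
          field_simp
      _ = ENNReal.ofReal (∫ t in Set.Ioi 0, k t) :=
          (ofReal_integral_eq_lintegral_ofReal hkI
            ((ae_restrict_mem measurableSet_Ioi).mono fun t ht => hk0 t ht)).symm
      _ = 2 := by rw [hkint]; simp
  have hsplit : ∀ ω, ENNReal.ofReal (Real.exp (X ω ^ 2 / (4 * s)))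
      = ENNReal.ofReal (Real.exp (X ω ^ 2 / (4 * s)) - 1) + 1 := fun ω => by
    rw [← ENNReal.ofReal_one, ← ENNReal.ofReal_add _ zero_le_one, sub_add_cancel]
    rw [sub_nonneg]
    exact Real.one_le_exp (by positivity)
  simp_rw [hsplit]
  rw [lintegral_add_right _ measurable_const, hlayer, lintegral_const, measure_univ, one_mul]
  calc _ ≤ (2 : ENNReal) + 1 := by gcongr
    _ = 3 := by norm_num

/-- Uses |x| ≤ s + x²/(4s). The variable is not assumed centred, so a prefactor is accepted; over n
vectors it becomes 3^n, which the union bound over signs can afford. -/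
lemma lintegral_exp_abs_le {X : Ω → ℝ} (hX : Measurable X) {s : ℝ} (hs : 0 < s)
    (htail : ∀ t, 0 < t → P.real {ω | t < |X ω|} ≤ 2 * Real.exp (-(1 / 2) * (t ^ 2 / s))) :
    ∫⁻ ω, ENNReal.ofReal (Real.exp |X ω|) ∂P ≤ ENNReal.ofReal (3 * Real.exp s) := by
  calc ∫⁻ ω, ENNReal.ofReal (Real.exp |X ω|) ∂P
      ≤ ∫⁻ ω, ENNReal.ofReal (Real.exp s) * ENNReal.ofReal (Real.exp (X ω ^ 2 / (4 * s))) ∂P := by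
        refine lintegral_mono fun ω => ?_
        rw [← ENNReal.ofReal_mul (Real.exp_pos _).le, ← Real.exp_add]
        refine ENNReal.ofReal_le_ofReal (Real.exp_le_exp.2 ?_)
        have h : 0 ≤ (|X ω| - 2 * s) ^ 2 / (4 * s) := by positivity
        have e : s + X ω ^ 2 / (4 * s) - |X ω| = (|X ω| - 2 * s) ^ 2 / (4 * s) := by
          rw [← sq_abs (X ω)]; field_simp; ring
        linarith
    _ ≤ ENNReal.ofReal (Real.exp s) * 3 := by
        rw [lintegral_const_mul _ (by fun_prop)]
        gcongr
        exact lintegral_exp_sq_le hX hs htail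
    _ = _ := by
        rw [mul_comm, ENNReal.ofReal_mul (by norm_num)]
        norm_num

omit [IsProbabilityMeasure P] in
/-- The exponential Markov inequality. -/
lemma measure_lt_le_of_lintegral_exp {X : Ω → ℝ} (hX : Measurable X) {C : ENNReal}
    (h : ∫⁻ ω, ENNReal.ofReal (Real.exp (X ω)) ∂P ≤ C) (t : ℝ) :
    P {ω | t < X ω} ≤ C * ENNReal.ofReal (Real.exp (-t)) := by
  have h1 : P {ω | t < X ω} ≤ P {ω | ENNReal.ofReal (Real.exp t)
      ≤ ENNReal.ofReal (Real.exp (X ω))} :=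
    measure_mono fun ω hω => ENNReal.ofReal_le_ofReal (Real.exp_le_exp.2 (le_of_lt hω))
  have h2 := mul_meas_ge_le_lintegral₀ (μ := P)
    (f := fun ω => ENNReal.ofReal (Real.exp (X ω))) (by fun_prop) (ENNReal.ofReal (Real.exp t))
  have h3 : ENNReal.ofReal (Real.exp t) * ENNReal.ofReal (Real.exp (-t)) = 1 := by
    rw [← ENNReal.ofReal_mul (Real.exp_pos _).le, ← Real.exp_add]
    simp
  calc P {ω | t < X ω}
      ≤ ENNReal.ofReal (Real.exp t) * P {ω | ENNReal.ofReal (Real.exp t)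
        ≤ ENNReal.ofReal (Real.exp (X ω))} * ENNReal.ofReal (Real.exp (-t)) := by
        rw [mul_right_comm, h3, one_mul]; exact h1
    _ ≤ _ := by gcongr; exact h2.trans h

lemma lintegral_exp_mul_gaussianReal (c : ℝ) :
    ∫⁻ x, ENNReal.ofReal (Real.exp (c * x)) ∂(gaussianReal 0 1)
      = ENNReal.ofReal (Real.exp (c ^ 2 / 2)) := by
  rw [← ofReal_integral_eq_lintegral_ofReal (integrable_exp_mul_gaussianReal c)
    (ae_of_all _ fun x => (Real.exp_pos _).le)]
  have h := congr_fun (mgf_fun_id_gaussianReal (μ := 0) (v := 1)) c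
  rw [mgf] at h
  rw [h]
  simp

lemma lintegral_exp_sq_gaussianReal_le :
    ∫⁻ x, ENNReal.ofReal (Real.exp (x ^ 2 / 4)) ∂(gaussianReal 0 1) ≤ 2 := by
  have hI : Integrable fun x : ℝ => (√(2 * Real.pi))⁻¹ * Real.exp (-(1 / 4) * x ^ 2) :=
    (integrable_exp_neg_mul_sq (by norm_num)).const_mul _
  rw [gaussianReal_of_var_ne_zero 0 one_ne_zero, lintegral_withDensity_eq_lintegral_mul _
    (measurable_gaussianPDF 0 1) (by fun_prop)]
  calc ∫⁻ x, (gaussianPDF 0 1 * fun x => ENNReal.ofReal (Real.exp (x ^ 2 / 4))) x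
      = ∫⁻ x, ENNReal.ofReal ((√(2 * Real.pi))⁻¹ * Real.exp (-(1 / 4) * x ^ 2)) := by
        refine lintegral_congr fun x => ?_
        rw [Pi.mul_apply, gaussianPDF, ← ENNReal.ofReal_mul (gaussianPDFReal_nonneg _ _ _)]
        congr 1
        rw [gaussianPDFReal, mul_assoc, ← Real.exp_add]
        congr 2
        · simp
        · simp; ring
    _ = ENNReal.ofReal ((√(2 * Real.pi))⁻¹ * √(Real.pi / (1 / 4))) := by
        rw [← ofReal_integral_eq_lintegral_ofReal hI (ae_of_all _ fun x => by positivity),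
          integral_const_mul, integral_gaussian]
    _ ≤ 2 := by
        have hp := Real.pi_pos
        refine ENNReal.ofReal_le_of_le_toReal ?_
        rw [← Real.sqrt_inv, ← Real.sqrt_mul (by positivity), ENNReal.toReal_ofNat]
        refine Real.sqrt_le_iff.2 ⟨by norm_num, ?_⟩
        field_simp
        norm_num

lemma lintegral_pi_prod {ι : Type*} [Fintype ι] (ν : Measure ℝ) [IsProbabilityMeasure ν]
    (B : Finset ι) {f : ι → ℝ → ENNReal} (hf : ∀ j, Measurable (f j)) :
    ∫⁻ γ, ∏ j ∈ B, f j (γ j) ∂(Measure.pi fun _ : ι => ν) = ∏ j ∈ B, ∫⁻ x, f j x ∂ν := by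
  have hind : iIndepFun (fun (j : ι) (γ : ι → ℝ) => f j (γ j)) (Measure.pi fun _ : ι => ν) :=
    iIndepFun_pi (X := f) fun j => (hf j).aemeasurable
  rw [lintegral_prod_eq_prod_lintegral_of_indepFun B _ hind fun j =>
    (hf j).comp (measurable_pi_apply j)]
  refine Finset.prod_congr rfl fun j _ => ?_
  exact (measurePreserving_eval (fun _ : ι => ν) j).lintegral_comp (hf j)

end ExpMoments

/-! ### The data event -/

section Data

variable {Ω : Type*} [MeasurableSpace Ω] {P : Measure Ω} [IsProbabilityMeasure P] {d n : ℕ}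
  {a : Fin n → Ω → Vec d} {b : OrthonormalBasis (Fin d) ℝ (Vec d)} {σ : Fin d → ℝ}

/-- The sign attached to a Boolean. -/
def boolSign (s : Bool) : ℝ := if s then 1 else -1

lemma abs_boolSign (s : Bool) : |boolSign s| = 1 := by cases s <;> simp [boolSign]

lemma sum_sq_inner_pos (hσ : ∀ j, 0 < σ j) {g : Vec d} (hg : g ≠ 0) :
    0 < ∑ j, σ j ^ 2 * ⟪b j, g⟫ ^ 2 := by
  refine lt_of_le_of_ne (Finset.sum_nonneg fun j _ => by positivity) fun h => hg ?_
  have h1 := (Finset.sum_eq_zero_iff_of_nonneg fun j _ => by positivity).1 h.symm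
  rw [← norm_eq_zero, ← sq_eq_zero_iff, ← b.sum_sq_inner_right g]
  refine Finset.sum_eq_zero fun j _ => ?_
  exact (mul_eq_zero.1 (h1 j (Finset.mem_univ j))).resolve_left (pow_pos (hσ j) 2).ne'

lemma lintegral_exp_signed_sum_le (ha : ∀ i, Measurable (a i)) (hind : iIndepFun a P)
    (hσ : ∀ j, 0 < σ j)
    (hsub : ∀ i, ∀ g : Vec d, ∀ t, 0 < t → P.real {ω | t < |⟪a i ω, g⟫|}
      ≤ 2 * Real.exp (-(1 / 2) * (t ^ 2 / ∑ j, σ j ^ 2 * ⟪b j, g⟫ ^ 2)))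
    (ε : Fin n → Bool) (g : Vec d) :
    ∫⁻ ω, ENNReal.ofReal (Real.exp ⟪∑ i, boolSign (ε i) • a i ω, g⟫) ∂P
      ≤ ENNReal.ofReal ((3 * Real.exp (∑ j, σ j ^ 2 * ⟪b j, g⟫ ^ 2)) ^ n) := by
  have h1 : ∀ ω, ENNReal.ofReal (Real.exp ⟪∑ i, boolSign (ε i) • a i ω, g⟫)
      = ∏ i, ENNReal.ofReal (Real.exp (boolSign (ε i) * ⟪a i ω, g⟫)) := fun ω => by
    rw [sum_inner, Real.exp_sum, ENNReal.ofReal_prod_of_nonneg fun i _ => (Real.exp_pos _).le]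
    simp only [real_inner_smul_left]
  have hm : ∀ i, Measurable fun x : Vec d => ENNReal.ofReal (Real.exp (boolSign (ε i) * ⟪x, g⟫)) :=
    fun i => by fun_prop
  have hind' := hind.comp _ hm
  simp_rw [h1]
  rw [lintegral_prod_eq_prod_lintegral_of_indepFun Finset.univ
    (fun i ω => ENNReal.ofReal (Real.exp (boolSign (ε i) * ⟪a i ω, g⟫))) hind'
    fun i => (hm i).comp (ha i)]
  calc ∏ i, ∫⁻ ω, ENNReal.ofReal (Real.exp (boolSign (ε i) * ⟪a i ω, g⟫)) ∂P
      ≤ ∏ _i : Fin n, ENNReal.ofReal (3 * Real.exp (∑ j, σ j ^ 2 * ⟪b j, g⟫ ^ 2)) := by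
        refine Finset.prod_le_prod' fun i _ => ?_
        rcases eq_or_ne g 0 with rfl | hg
        · simp
        · refine le_trans (lintegral_mono fun ω => ENNReal.ofReal_le_ofReal
            (Real.exp_le_exp.2 ?_)) (lintegral_exp_abs_le ((ha i).inner_const (c := g))
              (sum_sq_inner_pos hσ hg) (hsub i g))
          refine (le_abs_self _).trans ?_
          rw [abs_mul, abs_boolSign, one_mul]
    _ = _ := by
        rw [Finset.prod_const, Finset.card_univ, Fintype.card_fin, ENNReal.ofReal_pow (by positivity)]

/-- The exponential moment of the squared norm of a signed sum, restricted to a block of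
coordinates. -/
lemma lintegral_exp_block_le (ha : ∀ i, Measurable (a i)) (hind : iIndepFun a P)
    (hσ : ∀ j, 0 < σ j) (hn : 1 ≤ n)
    (hsub : ∀ i, ∀ g : Vec d, ∀ t, 0 < t → P.real {ω | t < |⟪a i ω, g⟫|}
      ≤ 2 * Real.exp (-(1 / 2) * (t ^ 2 / ∑ j, σ j ^ 2 * ⟪b j, g⟫ ^ 2)))
    (ε : Fin n → Bool) {B : Finset (Fin d)} {τ : ℝ} (hτ : 0 < τ) (hB : ∀ j ∈ B, σ j ≤ τ) :
    ∫⁻ ω, ENNReal.ofReal (Real.exp ((∑ j ∈ B, ⟪∑ i, boolSign (ε i) • a i ω, b j⟫ ^ 2)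
      / (8 * n * τ ^ 2))) ∂P ≤ 3 ^ n * 2 ^ B.card := by
  have hn0 : (0 : ℝ) < n := by exact_mod_cast hn
  -- Chosen so that n c² τ² = 1/4, which leaves the integrable weight exp(γ²/4), while c²/2 =
  -- 1/(8nτ²) is the wanted exponent.
  set c : ℝ := 1 / (2 * √n * τ) with hc
  have hsn : √(n : ℝ) ^ 2 = n := Real.sq_sqrt hn0.le
  have hsn0 : 0 < √(n : ℝ) := Real.sqrt_pos.2 hn0
  have hc2 : c ^ 2 = 1 / (4 * n * τ ^ 2) := by
    rw [hc, div_pow, mul_pow, mul_pow, hsn]; norm_num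
  set w : Ω → Vec d := fun ω => ∑ i, boolSign (ε i) • a i ω with hw
  have hwm : Measurable w := Finset.measurable_sum Finset.univ fun i _ => (ha i).const_smul (boolSign (ε i))
  set ν := Measure.pi fun _ : Fin d => gaussianReal 0 1 with hν
  -- Gaussian linearization: the exponential of a square is a Gaussian average of exponentials of
  -- linear forms, which factor over the independent vectors.
  have e1 : ∀ ω, ENNReal.ofReal (Real.exp ((∑ j ∈ B, ⟪w ω, b j⟫ ^ 2) / (8 * n * τ ^ 2)))
      = ∫⁻ γ, ENNReal.ofReal (Real.exp ⟪w ω, ∑ j ∈ B, (c * γ j) • b j⟫) ∂ν := by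
    intro ω
    have h1 : ∀ γ : Fin d → ℝ, ENNReal.ofReal (Real.exp ⟪w ω, ∑ j ∈ B, (c * γ j) • b j⟫)
        = ∏ j ∈ B, ENNReal.ofReal (Real.exp ((c * ⟪w ω, b j⟫) * γ j)) := fun γ => by
      rw [inner_sum, Real.exp_sum, ENNReal.ofReal_prod_of_nonneg fun i _ => (Real.exp_pos _).le]
      refine Finset.prod_congr rfl fun j _ => ?_
      rw [inner_smul_right]
      congr 2; ring
    simp_rw [h1]
    rw [lintegral_pi_prod (gaussianReal 0 1) B
      (f := fun j x => ENNReal.ofReal (Real.exp ((c * ⟪w ω, b j⟫) * x))) fun j => by fun_prop]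
    simp_rw [lintegral_exp_mul_gaussianReal]
    rw [← ENNReal.ofReal_prod_of_nonneg fun i _ => (Real.exp_pos _).le, ← Real.exp_sum,
      Finset.sum_div]
    congr 3 with j
    rw [mul_pow, hc2]
    field_simp
    ring
  refine (lintegral_congr e1).trans_le ?_
  have hjoint : Measurable fun q : Ω × (Fin d → ℝ) =>
      ENNReal.ofReal (Real.exp ⟪w q.1, ∑ j ∈ B, (c * q.2 j) • b j⟫) := by
    have h2 : Measurable fun q : Ω × (Fin d → ℝ) => ∑ j ∈ B, (c * q.2 j) • b j :=
      Finset.measurable_sum B fun j _ => by fun_prop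
    exact ((hwm.comp measurable_fst).inner h2).exp.ennreal_ofReal
  rw [lintegral_lintegral_swap hjoint.aemeasurable]
  calc ∫⁻ γ, ∫⁻ ω, ENNReal.ofReal (Real.exp ⟪w ω, ∑ j ∈ B, (c * γ j) • b j⟫) ∂P ∂ν
      ≤ ∫⁻ γ, 3 ^ n * ∏ j ∈ B, ENNReal.ofReal (Real.exp (γ j ^ 2 / 4)) ∂ν := by
        refine lintegral_mono fun γ => ?_
        refine (lintegral_exp_signed_sum_le ha hind hσ hsub ε _).trans ?_
        have h3 : ∑ j, σ j ^ 2 * ⟪b j, ∑ k ∈ B, (c * γ k) • b k⟫ ^ 2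
            = ∑ j ∈ B, σ j ^ 2 * (c * γ j) ^ 2 := by
          rw [← Finset.sum_subset (Finset.subset_univ B)]
          · refine Finset.sum_congr rfl fun j hj => ?_
            rw [b.orthonormal.inner_right_sum _ hj]
          · intro j _ hj
            have h4 : ⟪b j, ∑ k ∈ B, (c * γ k) • b k⟫ = 0 := by
              rw [inner_sum]
              refine Finset.sum_eq_zero fun k hk => ?_
              rw [inner_smul_right, b.orthonormal.inner_eq_zero (show j ≠ k from fun h => hj (h ▸ hk)), mul_zero]
            rw [h4]
            ring
        rw [h3, mul_pow, ENNReal.ofReal_mul (by positivity), ENNReal.ofReal_pow (by norm_num),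
          ← Real.exp_nat_mul, ← ENNReal.ofReal_prod_of_nonneg fun i _ => (Real.exp_pos _).le,
          ← Real.exp_sum, Finset.mul_sum]
        rw [show ENNReal.ofReal 3 = 3 by norm_num]
        gcongr with j hj
        have h4 : σ j ^ 2 ≤ τ ^ 2 := pow_le_pow_left₀ (hσ j).le (hB j hj) 2
        calc (n : ℝ) * (σ j ^ 2 * (c * γ j) ^ 2) = n * c ^ 2 * γ j ^ 2 * σ j ^ 2 := by ring
          _ ≤ n * c ^ 2 * γ j ^ 2 * τ ^ 2 := by gcongr
          _ = γ j ^ 2 / 4 := by rw [hc2]; field_simp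
    _ = 3 ^ n * ∏ j ∈ B, ∫⁻ x, ENNReal.ofReal (Real.exp (x ^ 2 / 4)) ∂(gaussianReal 0 1) := by
        rw [lintegral_const_mul _ (Finset.measurable_prod B fun j _ => by fun_prop),
          lintegral_pi_prod (gaussianReal 0 1) B
            (f := fun _ x => ENNReal.ofReal (Real.exp (x ^ 2 / 4))) fun j => by fun_prop]
    _ ≤ _ := by
        rw [Finset.prod_const]
        gcongr
        exact lintegral_exp_sq_gaussianReal_le

end Data

/-! ### Tail bounds and the union bound over signs, blocks and coordinates -/

section DataEvent

variable {Ω : Type*} [MeasurableSpace Ω] {P : Measure Ω} [IsProbabilityMeasure P] {d n : ℕ}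
  {a : Fin n → Ω → Vec d} {b : OrthonormalBasis (Fin d) ℝ (Vec d)} {σ : Fin d → ℝ}

/-- Jensen moves the exponential inside the average over i, so the moment of one vector suffices and
independence plays no role. The price is a threshold l that becomes logarithmic. -/
lemma measure_coordinate_le (ha : ∀ i, Measurable (a i)) (hσ : ∀ j, 0 < σ j) (hn : 1 ≤ n)
    (hsub : ∀ i, ∀ g : Vec d, ∀ t, 0 < t → P.real {ω | t < |⟪a i ω, g⟫|}
      ≤ 2 * Real.exp (-(1 / 2) * (t ^ 2 / ∑ j, σ j ^ 2 * ⟪b j, g⟫ ^ 2))) (j : Fin d) (l : ℝ) :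
    P {ω | l < ∑ i, (1 / (n : ℝ)) * (⟪a i ω, b j⟫ ^ 2 / (4 * σ j ^ 2))}
      ≤ 3 * ENNReal.ofReal (Real.exp (-l)) := by
  have hn0 : (0 : ℝ) < n := by exact_mod_cast hn
  have hs : ∑ k, σ k ^ 2 * ⟪b k, b j⟫ ^ 2 = σ j ^ 2 := by
    rw [Finset.sum_eq_single j]
    · simp
    · intro k _ hk
      rw [b.orthonormal.inner_eq_zero hk]; ring
    · simp
  have hm : ∀ i, Measurable fun ω => ⟪a i ω, b j⟫ := fun i => (ha i).inner_const
  refine measure_lt_le_of_lintegral_exp (Finset.measurable_sum _ fun i _ => by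
    have := hm i; fun_prop) ?_ l
  have hw : ∑ _i : Fin n, (1 / (n : ℝ)) = 1 := by
    rw [Finset.sum_const, Finset.card_univ, Fintype.card_fin, nsmul_eq_mul]; field_simp
  calc ∫⁻ ω, ENNReal.ofReal (Real.exp (∑ i, (1 / (n : ℝ)) * (⟪a i ω, b j⟫ ^ 2 / (4 * σ j ^ 2)))) ∂P
      ≤ ∫⁻ ω, ∑ i, ENNReal.ofReal (1 / (n : ℝ))
          * ENNReal.ofReal (Real.exp (⟪a i ω, b j⟫ ^ 2 / (4 * σ j ^ 2))) ∂P := by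
        refine lintegral_mono fun ω => ?_
        simp_rw [← ENNReal.ofReal_mul (by positivity : (0 : ℝ) ≤ 1 / (n : ℝ))]
        rw [← ENNReal.ofReal_sum_of_nonneg fun i _ => by positivity]
        refine ENNReal.ofReal_le_ofReal ?_
        have := convexOn_exp.map_sum_le (t := Finset.univ) (w := fun _ : Fin n => 1 / (n : ℝ))
          (p := fun i => ⟪a i ω, b j⟫ ^ 2 / (4 * σ j ^ 2)) (fun i _ => by positivity) hw
          (fun i _ => Set.mem_univ _)
        simpa only [smul_eq_mul] using this
    _ = ∑ i, ENNReal.ofReal (1 / (n : ℝ))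
          * ∫⁻ ω, ENNReal.ofReal (Real.exp (⟪a i ω, b j⟫ ^ 2 / (4 * σ j ^ 2))) ∂P := by
        rw [lintegral_finsetSum _ fun i _ => by have := hm i; fun_prop]
        refine Finset.sum_congr rfl fun i _ => ?_
        rw [lintegral_const_mul _ (by have := hm i; fun_prop)]
    _ ≤ ∑ _i : Fin n, ENNReal.ofReal (1 / (n : ℝ)) * 3 := by
        gcongr with i
        refine lintegral_exp_sq_le (hm i) (by have := hσ j; positivity) fun t ht => ?_
        rw [← hs]
        exact hsub i (b j) t ht
    _ = 3 := by
        rw [← Finset.sum_mul, ← ENNReal.ofReal_sum_of_nonneg fun i _ => by positivity, hw]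
        simp

/-- The 2^n sign patterns and the moment 3^n 2^|B| cost 6^n 2^|B| ≤ exp(2n + |B|), which is exactly
what the threshold sets aside. -/
lemma measure_block_le (ha : ∀ i, Measurable (a i)) (hind : iIndepFun a P)
    (hσ : ∀ j, 0 < σ j) (hn : 1 ≤ n)
    (hsub : ∀ i, ∀ g : Vec d, ∀ t, 0 < t → P.real {ω | t < |⟪a i ω, g⟫|}
      ≤ 2 * Real.exp (-(1 / 2) * (t ^ 2 / ∑ j, σ j ^ 2 * ⟪b j, g⟫ ^ 2)))
    {B : Finset (Fin d)} {τ : ℝ} (hτ : 0 < τ) (hB : ∀ j ∈ B, σ j ≤ τ) (l : ℝ) :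
    P (⋃ ε : Fin n → Bool, {ω | 2 * n + B.card + l
      < (∑ j ∈ B, ⟪∑ i, boolSign (ε i) • a i ω, b j⟫ ^ 2) / (8 * n * τ ^ 2)})
      ≤ ENNReal.ofReal (Real.exp (-l)) := by
  have h1 : ∀ ε : Fin n → Bool, P {ω | 2 * n + B.card + l
      < (∑ j ∈ B, ⟪∑ i, boolSign (ε i) • a i ω, b j⟫ ^ 2) / (8 * n * τ ^ 2)}
      ≤ 3 ^ n * 2 ^ B.card * ENNReal.ofReal (Real.exp (-(2 * n + B.card + l))) := fun ε => by
    refine measure_lt_le_of_lintegral_exp ?_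
      (lintegral_exp_block_le ha hind hσ hn hsub ε hτ hB) _
    have hw : Measurable fun ω => ∑ i, boolSign (ε i) • a i ω :=
      Finset.measurable_sum Finset.univ fun i _ => (ha i).const_smul (boolSign (ε i))
    exact (Finset.measurable_sum B fun j _ => (hw.inner_const (c := b j)).pow_const 2).div_const _
  refine (measure_iUnion_fintype_le _ _).trans ((Finset.sum_le_sum fun ε _ => h1 ε).trans ?_)
  rw [Finset.sum_const, Finset.card_univ, Fintype.card_fun, Fintype.card_fin, Fintype.card_bool,
    nsmul_eq_mul]
  have e1 : (2 : ENNReal) = ENNReal.ofReal 2 := by simp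
  have e2 : (3 : ENNReal) = ENNReal.ofReal 3 := by simp
  push_cast
  rw [e1, e2, ← ENNReal.ofReal_pow (by norm_num), ← ENNReal.ofReal_pow (by norm_num),
    ← ENNReal.ofReal_pow (by norm_num), ← ENNReal.ofReal_mul (by positivity),
    ← ENNReal.ofReal_mul (by positivity), ← ENNReal.ofReal_mul (by positivity)]
  refine ENNReal.ofReal_le_ofReal ?_
  have h2 : (2 : ℝ) ≤ Real.exp 1 := by
    have := Real.add_one_le_exp (1 : ℝ); linarith
  have h6 : (6 : ℝ) ≤ Real.exp 2 := by
    have h := Real.exp_one_gt_d9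
    have : Real.exp 2 = Real.exp 1 * Real.exp 1 := by rw [← Real.exp_add]; norm_num
    rw [this]; nlinarith
  have h3 : (6 : ℝ) ^ n * 2 ^ B.card ≤ Real.exp (2 * n + B.card) := by
    rw [Real.exp_add, mul_comm (2 : ℝ) (n : ℝ), Real.exp_nat_mul]
    have : Real.exp (B.card : ℝ) = Real.exp 1 ^ B.card := by
      rw [← Real.exp_nat_mul, mul_one]
    rw [this]
    gcongr
  calc (2 : ℝ) ^ n * (3 ^ n * 2 ^ B.card * Real.exp (-(2 * n + B.card + l)))
      = (6 ^ n * 2 ^ B.card) * Real.exp (-(2 * n + B.card + l)) := by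
        rw [show (6 : ℝ) = 2 * 3 by norm_num, mul_pow]; ring
    _ ≤ Real.exp (2 * n + B.card) * Real.exp (-(2 * n + B.card + l)) := by gcongr
    _ = Real.exp (-l) := by rw [← Real.exp_add]; ring_nf

/-- With high probability, the empirical second moments and the norms of all signed sums over
the blocks `B k` are under control. -/
lemma exists_data_event (ha : ∀ i, Measurable (a i)) (hind : iIndepFun a P)
    (hσ : ∀ j, 0 < σ j) (hn : 1 ≤ n)
    (hsub : ∀ i, ∀ g : Vec d, ∀ t, 0 < t → P.real {ω | t < |⟪a i ω, g⟫|}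
      ≤ 2 * Real.exp (-(1 / 2) * (t ^ 2 / ∑ j, σ j ^ 2 * ⟪b j, g⟫ ^ 2)))
    (K : ℕ) {B : ℕ → Finset (Fin d)} {τ : ℕ → ℝ} (hτ : ∀ k, 0 < τ k)
    (hB : ∀ k, ∀ j ∈ B k, σ j ≤ τ k) (l : ℝ) :
    ∃ G : Set Ω, MeasurableSet G ∧ 1 - (K + 3 * d) * Real.exp (-l) ≤ P.real G ∧ ∀ ω ∈ G,
      (∀ j, (1 / (n : ℝ)) * ∑ i, ⟪a i ω, b j⟫ ^ 2 ≤ 4 * l * σ j ^ 2) ∧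
      ∀ k < K, ∀ ε : Fin n → Bool, ∑ j ∈ B k, ⟪∑ i, boolSign (ε i) • a i ω, b j⟫ ^ 2
        ≤ 8 * n * τ k ^ 2 * (2 * n + (B k).card + l) := by
  have hn0 : (0 : ℝ) < n := by exact_mod_cast hn
  set E : Fin d → Set Ω := fun j =>
    {ω | l < ∑ i, (1 / (n : ℝ)) * (⟪a i ω, b j⟫ ^ 2 / (4 * σ j ^ 2))} with hE
  set F : ℕ → Set Ω := fun k => ⋃ ε : Fin n → Bool, {ω | 2 * n + (B k).card + l
      < (∑ j ∈ B k, ⟪∑ i, boolSign (ε i) • a i ω, b j⟫ ^ 2) / (8 * n * τ k ^ 2)} with hF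
  have hm : ∀ i j, Measurable fun ω => ⟪a i ω, b j⟫ := fun i j => (ha i).inner_const
  have hEm : ∀ j, MeasurableSet (E j) := fun j =>
    measurableSet_lt measurable_const (Finset.measurable_sum _ fun i _ => by
      have := hm i j; fun_prop)
  have hFm : ∀ k, MeasurableSet (F k) := fun k => MeasurableSet.iUnion fun ε => by
    have hw : Measurable fun ω => ∑ i, boolSign (ε i) • a i ω :=
      Finset.measurable_sum Finset.univ fun i _ => (ha i).const_smul (boolSign (ε i))
    exact measurableSet_lt measurable_const
      ((Finset.measurable_sum (B k) fun j _ => (hw.inner_const (c := b j)).pow_const 2).div_const _)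
  set N : Set Ω := (⋃ j, E j) ∪ ⋃ k ∈ Finset.range K, F k with hN
  have hNm : MeasurableSet N :=
    (MeasurableSet.iUnion hEm).union (Finset.measurableSet_biUnion _ fun k _ => hFm k)
  have hNP : P.real N ≤ (K + 3 * d) * Real.exp (-l) := by
    rw [measureReal_def]
    refine ENNReal.toReal_le_of_le_ofReal (by positivity) ?_
    calc P N ≤ P (⋃ j, E j) + P (⋃ k ∈ Finset.range K, F k) := measure_union_le _ _
      _ ≤ (∑ _j : Fin d, 3 * ENNReal.ofReal (Real.exp (-l)))
          + ∑ _k ∈ Finset.range K, ENNReal.ofReal (Real.exp (-l)) := by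
          refine add_le_add ((measure_iUnion_fintype_le _ _).trans (Finset.sum_le_sum fun j _ =>
            measure_coordinate_le ha hσ hn hsub j l)) ((measure_biUnion_finset_le _ _).trans
            (Finset.sum_le_sum fun k _ => measure_block_le ha hind hσ hn hsub (hτ k) (hB k) l))
      _ = _ := by
          rw [Finset.sum_const, Finset.sum_const, Finset.card_univ, Fintype.card_fin,
            Finset.card_range, nsmul_eq_mul, nsmul_eq_mul, ENNReal.ofReal_mul (by positivity),
            ENNReal.ofReal_add (by positivity) (by positivity), ENNReal.ofReal_mul (by norm_num),
            ENNReal.ofReal_natCast, ENNReal.ofReal_natCast, ENNReal.ofReal_ofNat]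
          ring
  refine ⟨Nᶜ, hNm.compl, ?_, fun ω hω => ?_⟩
  · rw [probReal_compl_eq_one_sub hNm]
    linarith
  · simp only [hN, Set.mem_compl_iff, Set.mem_union, Set.mem_iUnion, not_or, not_exists, hE, hF,
      Set.mem_ofPred_eq, not_lt, Finset.mem_range] at hω
    refine ⟨fun j => ?_, fun k hk ε => ?_⟩
    · have h := hω.1 j
      have hs : 0 < 4 * σ j ^ 2 := by have := hσ j; positivity
      rw [← Finset.mul_sum, ← Finset.sum_div, ← mul_div_assoc, div_le_iff₀ hs] at h
      linarith
    · have h := hω.2 k hk ε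
      have hs : 0 < 8 * n * τ k ^ 2 := by have := hτ k; positivity
      rw [div_le_iff₀ hs] at h
      linarith

end DataEvent

/-! ### Deterministic bounds on the data event -/

lemma avg_sqrt_le {n : ℕ} (hn : 1 ≤ n) {q : Fin n → ℝ} (hq : ∀ i, 0 ≤ q i) :
    (1 / (n : ℝ)) * ∑ i, √(q i) ≤ √((1 / (n : ℝ)) * ∑ i, q i) := by
  have hn0 : (0 : ℝ) < n := by exact_mod_cast hn
  refine Real.le_sqrt_of_sq_le ?_
  have h := sq_sum_le_card_mul_sum_sq (s := Finset.univ) (f := fun i => √(q i))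
  simp only [Real.sq_sqrt (hq _), Finset.card_univ, Fintype.card_fin] at h
  calc ((1 / (n : ℝ)) * ∑ i, √(q i)) ^ 2 = (1 / (n : ℝ)) ^ 2 * (∑ i, √(q i)) ^ 2 := mul_pow _ _ _
    _ ≤ (1 / (n : ℝ)) ^ 2 * (n * ∑ i, q i) := by gcongr
    _ = _ := by field_simp

section Blocks

variable {d n : ℕ} {a : Fin n → Vec d} {b : OrthonormalBasis (Fin d) ℝ (Vec d)} {σ : Fin d → ℝ}

lemma sum_block_sq_le (B : Finset (Fin d)) (c : Fin d → ℝ) (h : Vec d) :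
    (∑ j ∈ B, c j * ⟪b j, h⟫) ^ 2 ≤ (∑ j ∈ B, c j ^ 2) * ‖h‖ ^ 2 := by
  refine (Finset.sum_mul_sq_le_sq_mul_sq B c fun j => ⟪b j, h⟫).trans ?_
  refine mul_le_mul_of_nonneg_left ?_ (Finset.sum_nonneg fun _ _ => sq_nonneg _)
  rw [← b.sum_sq_inner_right h]
  exact Finset.sum_le_sum_of_subset_of_nonneg (Finset.subset_univ B) fun _ _ _ => sq_nonneg _

/-- On a block of comparable scales, the normalized quadratic form is controlled by the norms of
the signed sums. -/
lemma block_quadratic_le (hn : 1 ≤ n) (hσ : ∀ j, 0 < σ j) {B : Finset (Fin d)} {τ l : ℝ}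
    (hτ : 0 < τ) (hB : ∀ j ∈ B, τ ≤ 2 * σ j)
    (hw : ∀ ε : Fin n → Bool, ∑ j ∈ B, ⟪∑ i, boolSign (ε i) • a i, b j⟫ ^ 2
      ≤ 8 * n * τ ^ 2 * (2 * n + B.card + l)) (h : Vec d) :
    (1 / (n : ℝ)) * ∑ i, (∑ j ∈ B, ⟪a i, b j⟫ * ⟪b j, h⟫) ^ 2 / √(∑ j, σ j * ⟪a i, b j⟫ ^ 2)
      ≤ 4 * √(τ * (2 * n + B.card + l) / n) * ‖h‖ ^ 2 := by
  have hn0 : (0 : ℝ) < n := by exact_mod_cast hn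
  set p : Fin n → ℝ := fun i => ∑ j ∈ B, ⟪a i, b j⟫ * ⟪b j, h⟫ with hp
  set v : Fin n → ℝ := fun i => ∑ j, σ j * ⟪a i, b j⟫ ^ 2 with hv
  have hv0 : ∀ i, 0 ≤ v i := fun i => Finset.sum_nonneg fun j _ => by
    have := hσ j; positivity
  -- On the block σ_j ≥ τ/2, so v_i is at least τ/2 times the squared norm of the block of a_i.
  -- Using this for one of the two factors p_i leaves a sum linear in |p_i|.
  have hpv : ∀ i, |p i| ≤ √(2 / τ) * √(v i) * ‖h‖ := fun i => by
    refine abs_le_of_sq_le_sq ?_ (by positivity)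
    rw [mul_pow, mul_pow, Real.sq_sqrt (by positivity), Real.sq_sqrt (hv0 i)]
    refine (sum_block_sq_le B (fun j => ⟪a i, b j⟫) h).trans ?_
    refine mul_le_mul_of_nonneg_right ?_ (sq_nonneg _)
    rw [div_mul_eq_mul_div, le_div_iff₀ hτ, hv, Finset.sum_mul, Finset.mul_sum]
    calc ∑ j ∈ B, ⟪a i, b j⟫ ^ 2 * τ ≤ ∑ j ∈ B, 2 * (σ j * ⟪a i, b j⟫ ^ 2) :=
          Finset.sum_le_sum fun j hj => by
            have := mul_le_mul_of_nonneg_left (hB j hj) (sq_nonneg ⟪a i, b j⟫)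
            linarith
      _ ≤ _ := Finset.sum_le_sum_of_subset_of_nonneg (Finset.subset_univ B) fun j _ _ => by
          have := hσ j; positivity
  have h1 : ∀ i, p i ^ 2 / √(v i) ≤ √(2 / τ) * ‖h‖ * |p i| := fun i => by
    refine div_le_of_le_mul₀ (Real.sqrt_nonneg _) (by positivity) ?_
    rw [← sq_abs, sq]
    have := mul_le_mul_of_nonneg_right (hpv i) (abs_nonneg (p i))
    linarith
  have h2 : ∑ i, |p i| ≤ √(8 * n * τ ^ 2 * (2 * n + B.card + l)) * ‖h‖ := by
    -- The signs depend on h and on the data, which is why all sign patterns had to be controlled at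
    -- once.
    set ε : Fin n → Bool := fun i => decide (0 ≤ p i) with hε
    have e : ∑ i, |p i| = ∑ j ∈ B, ⟪∑ i, boolSign (ε i) • a i, b j⟫ * ⟪b j, h⟫ := by
      simp only [sum_inner, real_inner_smul_left, Finset.sum_mul]
      rw [Finset.sum_comm]
      refine Finset.sum_congr rfl fun i _ => ?_
      have : |p i| = boolSign (ε i) * p i := by
        by_cases h0 : 0 ≤ p i
        · simp [hε, h0, boolSign, abs_of_nonneg h0]
        · simp [hε, h0, boolSign, abs_of_neg (not_le.1 h0)]
      rw [this, hp, Finset.mul_sum]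
      exact Finset.sum_congr rfl fun j _ => by ring
    rw [e]
    have h3 := sum_block_sq_le (b := b) B (fun j => ⟪∑ i, boolSign (ε i) • a i, b j⟫) h
    have h4 := h3.trans (mul_le_mul_of_nonneg_right (hw ε) (sq_nonneg ‖h‖))
    refine (Real.le_sqrt_of_sq_le h4).trans (le_of_eq ?_)
    rw [Real.sqrt_mul' _ (sq_nonneg _), Real.sqrt_sq (norm_nonneg _)]
  have h0 : 0 ≤ 8 * n * τ ^ 2 * (2 * n + B.card + l) :=
    (Finset.sum_nonneg fun _ _ => sq_nonneg _).trans (hw fun _ => true)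
  have hX0 : 0 ≤ 2 * n + B.card + l := nonneg_of_mul_nonneg_right h0 (by positivity)
  calc (1 / (n : ℝ)) * ∑ i, p i ^ 2 / √(v i)
      ≤ (1 / (n : ℝ)) * ∑ i, √(2 / τ) * ‖h‖ * |p i| := by gcongr with i; exact h1 i
    _ ≤ (1 / (n : ℝ)) * (√(2 / τ) * ‖h‖ * (√(8 * n * τ ^ 2 * (2 * n + B.card + l)) * ‖h‖)) := by
        rw [← Finset.mul_sum]; gcongr
    _ = (√(2 / τ) * √(8 * n * τ ^ 2 * (2 * n + B.card + l)) / n) * ‖h‖ ^ 2 := by ring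
    _ = _ := by
        congr 1
        rw [← Real.sqrt_mul (by positivity)]
        rw [show 2 / τ * (8 * n * τ ^ 2 * (2 * n + B.card + l))
          = (4 * n) ^ 2 * (τ * (2 * n + B.card + l) / n) by field_simp; ring,
          Real.sqrt_mul (by positivity), Real.sqrt_sq (by positivity)]
        field_simp

/-- On the block of the smallest scales, second moments suffice. -/
lemma tail_quadratic_le (hn : 1 ≤ n) (hσ : ∀ j, 0 < σ j) {l : ℝ}
    (hm : ∀ j, (1 / (n : ℝ)) * ∑ i, ⟪a i, b j⟫ ^ 2 ≤ 4 * l * σ j ^ 2) (J : Finset (Fin d))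
    (h : Vec d) :
    (1 / (n : ℝ)) * ∑ i, (∑ j ∈ J, ⟪a i, b j⟫ * ⟪b j, h⟫) ^ 2 / √(∑ j, σ j * ⟪a i, b j⟫ ^ 2)
      ≤ √(4 * l * ∑ j ∈ J, σ j) * ‖h‖ ^ 2 := by
  have hn0 : (0 : ℝ) < n := by exact_mod_cast hn
  set v : Fin n → ℝ := fun i => ∑ j, σ j * ⟪a i, b j⟫ ^ 2 with hv
  set q : Fin n → ℝ := fun i => ∑ j ∈ J, ⟪a i, b j⟫ ^ 2 / σ j with hq
  have hv0 : ∀ i, 0 ≤ v i := fun i => Finset.sum_nonneg fun j _ => by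
    have := hσ j; positivity
  have hq0 : ∀ i, 0 ≤ q i := fun i => Finset.sum_nonneg fun j _ => by
    have := hσ j; positivity
  have h1 : ∀ i, (∑ j ∈ J, ⟪a i, b j⟫ * ⟪b j, h⟫) ^ 2 / √(v i) ≤ √(q i) * ‖h‖ ^ 2 := fun i => by
    refine div_le_of_le_mul₀ (Real.sqrt_nonneg _) (by positivity) ?_
    refine (sum_block_sq_le J (fun j => ⟪a i, b j⟫) h).trans ?_
    -- Cauchy–Schwarz with weights √σ_j and 1/√σ_j: the first factor cancels the denominator √v_i,
    -- and the average of the second is summable against second moments.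
    have h2 : ∑ j ∈ J, ⟪a i, b j⟫ ^ 2 ≤ √(v i) * √(q i) := by
      rw [← Real.sqrt_mul (hv0 i)]
      refine Real.le_sqrt_of_sq_le ?_
      have h3 := Finset.sum_mul_sq_le_sq_mul_sq J (fun j => √(σ j) * ⟪a i, b j⟫)
        (fun j => ⟪a i, b j⟫ / √(σ j))
      have e1 : ∀ j, √(σ j) * ⟪a i, b j⟫ * (⟪a i, b j⟫ / √(σ j)) = ⟪a i, b j⟫ ^ 2 := fun j => by
        have := Real.sqrt_pos.2 (hσ j); field_simp
      simp only [e1, mul_pow, div_pow, Real.sq_sqrt (hσ _).le] at h3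
      refine h3.trans (mul_le_mul_of_nonneg_right ?_ (hq0 i))
      exact Finset.sum_le_sum_of_subset_of_nonneg (Finset.subset_univ J) fun j _ _ => by
        have := hσ j; positivity
    have := mul_le_mul_of_nonneg_right h2 (sq_nonneg ‖h‖)
    linarith
  calc (1 / (n : ℝ)) * ∑ i, (∑ j ∈ J, ⟪a i, b j⟫ * ⟪b j, h⟫) ^ 2 / √(v i)
      ≤ (1 / (n : ℝ)) * ∑ i, √(q i) * ‖h‖ ^ 2 := by gcongr with i; exact h1 i
    _ = ((1 / (n : ℝ)) * ∑ i, √(q i)) * ‖h‖ ^ 2 := by rw [← Finset.sum_mul]; ring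
    _ ≤ _ := by
        refine mul_le_mul_of_nonneg_right ((avg_sqrt_le hn hq0).trans (Real.sqrt_le_sqrt ?_))
          (sq_nonneg _)
        simp only [hq]
        rw [Finset.sum_comm, Finset.mul_sum, Finset.mul_sum]
        refine Finset.sum_le_sum fun j _ => ?_
        have hj := hσ j
        rw [← Finset.sum_div, ← mul_div_assoc, div_le_iff₀ hj]
        refine (hm j).trans (le_of_eq (by ring))

lemma avg_norm_le (hn : 1 ≤ n) (hσ : ∀ j, 0 < σ j) {l : ℝ}
    (hm : ∀ j, (1 / (n : ℝ)) * ∑ i, ⟪a i, b j⟫ ^ 2 ≤ 4 * l * σ j ^ 2) :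
    (1 / (n : ℝ)) * ∑ i, √(∑ j, σ j * ⟪a i, b j⟫ ^ 2) ≤ √(4 * l * ∑ j, σ j ^ 3) := by
  refine (avg_sqrt_le hn fun i => Finset.sum_nonneg fun j _ => by
    have := hσ j; positivity).trans (Real.sqrt_le_sqrt ?_)
  rw [Finset.sum_comm, Finset.mul_sum, Finset.mul_sum]
  refine Finset.sum_le_sum fun j _ => ?_
  have := mul_le_mul_of_nonneg_left (hm j) (hσ j).le
  rw [← Finset.mul_sum]
  linarith

/-- The index of the dyadic block of scales to which `σ j` belongs. -/
noncomputable def scaleIndex (σ : Fin d → ℝ) (s : ℝ) (j : Fin d) : ℕ := Nat.log 2 ⌊s / σ j⌋₊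

lemma scaleIndex_spec (hσ : ∀ j, 0 < σ j) {s : ℝ} (hs : ∀ j, σ j ≤ s) (j : Fin d) :
    σ j ≤ s / 2 ^ scaleIndex σ s j ∧ s / 2 ^ scaleIndex σ s j ≤ 2 * σ j := by
  have hj := hσ j
  have h1 : 1 ≤ s / σ j := (one_le_div hj).2 (hs j)
  have hf : ⌊s / σ j⌋₊ ≠ 0 := (Nat.floor_pos.2 h1).ne'
  have h2 : ((2 ^ scaleIndex σ s j : ℕ) : ℝ) ≤ s / σ j :=
    (Nat.cast_le.2 (Nat.pow_log_le_self 2 hf)).trans (Nat.floor_le (by linarith))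
  have h3 : s / σ j < ((2 ^ (scaleIndex σ s j + 1) : ℕ) : ℝ) :=
    (Nat.floor_lt (by linarith)).1 (Nat.lt_pow_succ_log_self one_lt_two _)
  push_cast at h2 h3
  constructor
  · rw [le_div_iff₀ (by positivity)]
    rw [le_div_iff₀ hj] at h2
    linarith
  · rw [div_le_iff₀ (by positivity)]
    rw [div_lt_iff₀ hj, pow_succ] at h3
    linarith

/-- The dyadic block of scales of index `k`. -/
noncomputable def scaleBlock (σ : Fin d → ℝ) (s : ℝ) (k : ℕ) : Finset (Fin d) :=
  Finset.univ.filter fun j => scaleIndex σ s j = k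

/-- The normalized quadratic form of the data is bounded on the data event. -/
lemma quadratic_le (hn : 1 ≤ n) (hσ : ∀ j, 0 < σ j) {s l : ℝ} (hs : ∀ j, σ j ≤ s) (hs0 : 0 < s)
    (hl : 0 ≤ l) {K : ℕ} (hK : d ≤ 2 ^ K)
    (hm : ∀ j, (1 / (n : ℝ)) * ∑ i, ⟪a i, b j⟫ ^ 2 ≤ 4 * l * σ j ^ 2)
    (hw : ∀ k < K, ∀ ε : Fin n → Bool,
      ∑ j ∈ scaleBlock σ s k, ⟪∑ i, boolSign (ε i) • a i, b j⟫ ^ 2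
        ≤ 8 * n * (s / 2 ^ k) ^ 2 * (2 * n + (scaleBlock σ s k).card + l)) (h : Vec d) :
    (1 / (n : ℝ)) * ∑ i, ⟪a i, h⟫ ^ 2 / √(∑ j, σ j * ⟪a i, b j⟫ ^ 2)
      ≤ 4 * ((K : ℝ) + 1) ^ 2 * √(s * (2 + l) + 2 * (∑ j, σ j) / n) * ‖h‖ ^ 2 := by
  have hn0 : (0 : ℝ) < n := by exact_mod_cast hn
  have hn1 : (1 : ℝ) ≤ n := by exact_mod_cast hn
  -- Capping the index at K gathers all scales of index at least K into one last block.
  set C : ℕ → Finset (Fin d) := fun k => Finset.univ.filter fun j => min K (scaleIndex σ s j) = k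
    with hC
  set v : Fin n → ℝ := fun i => ∑ j, σ j * ⟪a i, b j⟫ ^ 2 with hv
  set X := √(s * (2 + l) + 2 * (∑ j, σ j) / n) with hX
  have hS0 : 0 ≤ ∑ j, σ j := Finset.sum_nonneg fun j _ => (hσ j).le
  have hblock : ∀ k ∈ Finset.range (K + 1),
      (1 / (n : ℝ)) * ∑ i, (∑ j ∈ C k, ⟪a i, b j⟫ * ⟪b j, h⟫) ^ 2 / √(v i) ≤ 4 * X * ‖h‖ ^ 2 := by
    intro k hk
    rcases (Nat.lt_succ_iff.1 (Finset.mem_range.1 hk)).eq_or_lt with rfl | hk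
    · refine (tail_quadratic_le hn hσ hm (C k) h).trans
        (mul_le_mul_of_nonneg_right ?_ (sq_nonneg _))
      -- At most d ≤ 2^K coordinates remain, each of scale at most s/2^K.
      have h1 : ∑ j ∈ C k, σ j ≤ s := by
        have h2 : ∀ j ∈ C k, σ j ≤ s / 2 ^ k := fun j hj => by
          have hj' : k ≤ scaleIndex σ s j := by
            simpa [hC] using hj
          refine (scaleIndex_spec hσ hs j).1.trans ?_
          gcongr
          norm_num
        have h3 := Finset.sum_le_card_nsmul _ _ _ h2
        rw [nsmul_eq_mul] at h3
        have h4 : ((C k).card : ℝ) ≤ 2 ^ k := by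
          have : (C k).card ≤ d := by simpa using Finset.card_le_univ (C k)
          exact_mod_cast this.trans hK
        calc _ ≤ _ := h3
          _ ≤ 2 ^ k * (s / 2 ^ k) := by gcongr
          _ = s := by field_simp
      have h5 : √(4 * l * ∑ j ∈ C k, σ j) ≤ √(2 ^ 2 * (s * (2 + l) + 2 * (∑ j, σ j) / n)) := by
        refine Real.sqrt_le_sqrt ?_
        have := mul_le_mul_of_nonneg_left h1 hl
        have : 0 ≤ 2 * (∑ j, σ j) / n := by positivity
        linarith
      rw [Real.sqrt_mul (by norm_num : (0 : ℝ) ≤ 2 ^ 2) (s * (2 + l) + 2 * (∑ j, σ j) / n),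
        Real.sqrt_sq (by norm_num : (0 : ℝ) ≤ 2)] at h5
      have : 0 ≤ X := Real.sqrt_nonneg _
      linarith
    · have hCB : C k = scaleBlock σ s k := by
        ext j
        simp only [hC, scaleBlock, Finset.mem_filter, Finset.mem_univ, true_and]
        omega
      have hτ : 0 < s / 2 ^ k := by positivity
      have hB : ∀ j ∈ scaleBlock σ s k, s / 2 ^ k ≤ 2 * σ j := fun j hj => by
        have hj' : scaleIndex σ s j = k := by simpa [scaleBlock] using hj
        rw [← hj']
        exact (scaleIndex_spec hσ hs j).2
      rw [hCB]
      refine (block_quadratic_le hn hσ hτ hB (hw k hk) h).trans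
        (mul_le_mul_of_nonneg_right (mul_le_mul_of_nonneg_left (Real.sqrt_le_sqrt ?_)
          (by norm_num)) (sq_nonneg _))
      have h1 : s / 2 ^ k * (scaleBlock σ s k).card ≤ 2 * ∑ j, σ j := by
        rw [mul_comm, ← nsmul_eq_mul, ← Finset.sum_const, Finset.mul_sum]
        exact (Finset.sum_le_sum hB).trans (Finset.sum_le_sum_of_subset_of_nonneg
          (Finset.subset_univ _) fun j _ _ => by have := hσ j; positivity)
      have h2 : s / 2 ^ k ≤ s := div_le_self hs0.le (one_le_pow₀ (by norm_num))
      have h3 : s / 2 ^ k * (2 * n + l) ≤ s * ((2 + l) * n) := by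
        refine mul_le_mul h2 ?_ (by positivity) hs0.le
        nlinarith
      rw [div_le_iff₀ hn0, add_mul, div_mul_cancel₀ _ hn0.ne']
      linarith
  have hsplit : ∀ i, ⟪a i, h⟫ = ∑ k ∈ Finset.range (K + 1), ∑ j ∈ C k, ⟪a i, b j⟫ * ⟪b j, h⟫ :=
    fun i => by
      rw [← b.sum_inner_mul_inner (a i) h]
      exact (Finset.sum_fiberwise_of_maps_to (fun j _ => Finset.mem_range.2
        (Nat.lt_succ_of_le (min_le_left K (scaleIndex σ s j)))) _).symm
  -- One factor K + 1 comes from Cauchy–Schwarz over the blocks, the other from summing the block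
  -- bounds.
  calc (1 / (n : ℝ)) * ∑ i, ⟪a i, h⟫ ^ 2 / √(v i)
      ≤ (1 / (n : ℝ)) * ∑ i, ((K + 1 : ℝ) * ∑ k ∈ Finset.range (K + 1),
          (∑ j ∈ C k, ⟪a i, b j⟫ * ⟪b j, h⟫) ^ 2) / √(v i) := by
        gcongr with i
        rw [hsplit i]
        have := sq_sum_le_card_mul_sum_sq (s := Finset.range (K + 1))
          (f := fun k => ∑ j ∈ C k, ⟪a i, b j⟫ * ⟪b j, h⟫)
        simpa using this
    _ = (K + 1 : ℝ) * ∑ k ∈ Finset.range (K + 1),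
          (1 / (n : ℝ)) * ∑ i, (∑ j ∈ C k, ⟪a i, b j⟫ * ⟪b j, h⟫) ^ 2 / √(v i) := by
        rw [← Finset.mul_sum, Finset.sum_comm, mul_left_comm, Finset.mul_sum (a := (K + 1 : ℝ))]
        congr 1
        refine Finset.sum_congr rfl fun i _ => ?_
        rw [mul_div_assoc, Finset.sum_div]
    _ ≤ (K + 1 : ℝ) * ∑ _k ∈ Finset.range (K + 1), 4 * X * ‖h‖ ^ 2 := by
        exact mul_le_mul_of_nonneg_left (Finset.sum_le_sum hblock) (by positivity)
    _ = _ := by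
        rw [Finset.sum_const, Finset.card_range, nsmul_eq_mul]
        push_cast
        ring

end Blocks

/-! ### The smoothing distribution in the eigenbasis of the covariance matrix -/

section Spectral

variable {d : ℕ}

lemma dotProduct_mulVec_eq_sum (A : Matrix (Fin d) (Fin d) ℝ)
    (b : OrthonormalBasis (Fin d) ℝ (Vec d)) {e : Fin d → ℝ}
    (hA : ∀ j, A.mulVec (b j).ofLp = e j • (b j).ofLp) (x : Vec d) :
    dotProduct x.ofLp (A.mulVec x.ofLp) = ∑ j, e j * ⟪b j, x⟫ ^ 2 := by
  have h1 : ∀ y : Vec d, dotProduct x.ofLp (A.mulVec y.ofLp) = ⟪x, A.toEuclideanLin y⟫ :=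
    fun y => by
      rw [EuclideanSpace.inner_eq_star_dotProduct, dotProduct_comm]
      simp
  have h2 : ∀ j, A.toEuclideanLin (b j) = e j • b j := fun j => by
    refine WithLp.ofLp_injective 2 ?_
    simpa using hA j
  rw [h1]
  conv_lhs => rw [← b.sum_repr' x]
  simp only [map_sum, map_smul, h2]
  rw [b.sum_repr' x, inner_sum]
  refine Finset.sum_congr rfl fun j _ => ?_
  rw [real_inner_smul_right, real_inner_smul_right, real_inner_comm]
  ring

/-- For T = √S and an eigenvector v with S v = s² v, s > 0, the vector w = Tv − sv satisfies Tw =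
−sw. Since T is positive semidefinite, w must vanish. -/
lemma sqrt_mulVec_eigenvectorBasis {S : Matrix (Fin d) (Fin d) ℝ} (hS : S.PosDef) (j : Fin d) :
    (CFC.sqrt S).mulVec (hS.isHermitian.eigenvectorBasis j).ofLp
      = √(hS.isHermitian.eigenvalues j) • (hS.isHermitian.eigenvectorBasis j).ofLp := by
  set T := CFC.sqrt S with hT
  set v := (hS.isHermitian.eigenvectorBasis j).ofLp with hv
  set s := √(hS.isHermitian.eigenvalues j) with hs
  have hs0 : 0 < s := Real.sqrt_pos.2 (hS.eigenvalues_pos j)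
  have hss : s * s = hS.isHermitian.eigenvalues j := Real.mul_self_sqrt (hS.eigenvalues_pos j).le
  have hTp : T.PosSemidef := Matrix.nonneg_iff_posSemidef.1 (CFC.sqrt_nonneg S)
  have hTT : T * T = S := CFC.sqrt_mul_sqrt_self S (Matrix.nonneg_iff_posSemidef.2 hS.posSemidef)
  have hSv : T.mulVec (T.mulVec v) = (s * s) • v := by
    rw [Matrix.mulVec_mulVec, hTT, hss]
    exact hS.isHermitian.mulVec_eigenvectorBasis j
  set w := T.mulVec v - s • v with hw
  have hTw : T.mulVec w = -(s • w) := by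
    rw [hw, Matrix.mulVec_sub, hSv, Matrix.mulVec_smul, smul_sub, smul_smul]
    abel
  have h1 : 0 ≤ dotProduct w (T.mulVec w) := by simpa using hTp.dotProduct_mulVec_nonneg w
  rw [hTw, dotProduct_neg, dotProduct_smul, smul_eq_mul] at h1
  have h2 : 0 ≤ dotProduct w w := by simpa using dotProduct_star_self_nonneg w
  have h3 : dotProduct w w = 0 := by nlinarith
  exact sub_eq_zero.1 (dotProduct_self_eq_zero.1 h3)

lemma map_inner_multivariateGaussian {A : Matrix (Fin d) (Fin d) ℝ} (hA : A.PosSemidef)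
    (a : Vec d) :
    (multivariateGaussian 0 A).map (fun Z => ⟪a, Z⟫)
      = gaussianReal 0 (dotProduct a.ofLp (A.mulVec a.ofLp)).toNNReal := by
  have h := IsGaussian.map_eq_gaussianReal (μ := multivariateGaussian 0 A) (innerSL ℝ a)
  have h1 : (multivariateGaussian 0 A)[innerSL ℝ a] = 0 := by
    rw [(innerSL ℝ a).integral_comp_id_comm IsGaussian.integrable_id]
    simp
  have h2 : Var[innerSL ℝ a; multivariateGaussian 0 A]
      = dotProduct a.ofLp (A.mulVec a.ofLp) := by
    rw [← covarianceBilin_multivariateGaussian (μ := 0) hA,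
      covarianceBilin_self IsGaussian.memLp_two_id]
    rfl
  rw [h1, h2] at h
  exact h

end Spectral

/-- Subgaussian tails along arbitrary directions, in an eigenbasis of the covariance matrix. -/
lemma IsSubgaussianVec.tail_le {d : ℕ} {Ω : Type*} [MeasurableSpace Ω] {P : Measure Ω}
    {S : Matrix (Fin d) (Fin d) ℝ} {a : Ω → Vec d} (h : IsSubgaussianVec P S a)
    (b : OrthonormalBasis (Fin d) ℝ (Vec d)) {e : Fin d → ℝ}
    (hS : ∀ j, S.mulVec (b j).ofLp = e j • (b j).ofLp) (g : Vec d) {t : ℝ} (ht : 0 < t) :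
    P.real {ω | t < |⟪a ω, g⟫|}
      ≤ 2 * Real.exp (-(1 / 2) * (t ^ 2 / ∑ j, e j * ⟪b j, g⟫ ^ 2)) := by
  rcases eq_or_ne g 0 with rfl | hg
  · have : {ω | t < |⟪a ω, (0 : Vec d)⟫|} = ∅ := by
      ext ω
      simp [ht.le]
    rw [this, measureReal_empty]
    positivity
  have hg0 : 0 < ‖g‖ := norm_pos_iff.2 hg
  have h1 := h (t / ‖g‖) (by positivity) (‖g‖⁻¹ • g) (by
    rw [norm_smul, norm_inv, norm_norm, inv_mul_cancel₀ hg0.ne'])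
  rw [dotProduct_mulVec_eq_sum S b hS] at h1
  have e1 : {ω | t / ‖g‖ < |⟪a ω, ‖g‖⁻¹ • g⟫|} = {ω | t < |⟪a ω, g⟫|} := by
    ext ω
    rw [Set.mem_ofPred_eq, Set.mem_ofPred_eq, real_inner_smul_right, abs_mul, abs_inv, abs_norm,
      inv_mul_eq_div, div_lt_div_iff_of_pos_right hg0]
  have e2 : (t / ‖g‖) ^ 2 / ∑ j, e j * ⟪b j, ‖g‖⁻¹ • g⟫ ^ 2
      = t ^ 2 / ∑ j, e j * ⟪b j, g⟫ ^ 2 := by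
    have : ∑ j, e j * ⟪b j, ‖g‖⁻¹ • g⟫ ^ 2 = (‖g‖ ^ 2)⁻¹ * ∑ j, e j * ⟪b j, g⟫ ^ 2 := by
      rw [Finset.mul_sum]
      refine Finset.sum_congr rfl fun j _ => ?_
      rw [real_inner_smul_right]
      ring
    rw [this, div_pow, inv_mul_eq_div, div_div_div_cancel_right₀ (by positivity)]
  rwa [e1, e2] at h1

/-! ### Effective dimensions -/

section EffDim

variable {d : ℕ} {S : Matrix (Fin d) (Fin d) ℝ} (hS : S.PosDef)

lemma sqrt_eigenvalues_le_sigmaOne (j : Fin d) :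
    √(hS.isHermitian.eigenvalues j) ≤ sigmaOne hS.isHermitian :=
  Real.sqrt_le_sqrt (le_ciSup (Set.finite_range _).bddAbove j)

lemma exists_sqrt_eigenvalues_eq_sigmaOne (hd : 1 ≤ d) :
    ∃ j, √(hS.isHermitian.eigenvalues j) = sigmaOne hS.isHermitian := by
  have : Nonempty (Fin d) := ⟨⟨0, hd⟩⟩
  obtain ⟨j, hj⟩ := exists_eq_ciSup_of_finite (f := hS.isHermitian.eigenvalues)
  exact ⟨j, by rw [sigmaOne, topEig, ← hj]⟩

lemma sigmaOne_pos (hd : 1 ≤ d) : 0 < sigmaOne hS.isHermitian := by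
  obtain ⟨j, hj⟩ := exists_sqrt_eigenvalues_eq_sigmaOne hS hd
  rw [← hj]
  exact Real.sqrt_pos.2 (hS.eigenvalues_pos j)

lemma effDim_one : effDim hS.isHermitian 1
    = ∑ j, (√(hS.isHermitian.eigenvalues j) / sigmaOne hS.isHermitian) ^ 2 := by
  refine Finset.sum_congr rfl fun j _ => ?_
  rw [← Real.rpow_natCast]
  norm_num

lemma effDim_two : effDim hS.isHermitian 2
    = ∑ j, √(hS.isHermitian.eigenvalues j) / sigmaOne hS.isHermitian := by
  refine Finset.sum_congr rfl fun j _ => ?_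
  norm_num

lemma one_le_effDim_one (hd : 1 ≤ d) : 1 ≤ effDim hS.isHermitian 1 := by
  obtain ⟨j, hj⟩ := exists_sqrt_eigenvalues_eq_sigmaOne hS hd
  rw [effDim_one hS]
  refine le_trans (le_of_eq ?_)
    (Finset.single_le_sum (fun _ _ => sq_nonneg _) (Finset.mem_univ j))
  rw [hj, div_self (sigmaOne_pos hS hd).ne', one_pow]

lemma div_sigmaOne_mem (hd : 1 ≤ d) (j : Fin d) :
    0 ≤ √(hS.isHermitian.eigenvalues j) / sigmaOne hS.isHermitian ∧
      √(hS.isHermitian.eigenvalues j) / sigmaOne hS.isHermitian ≤ 1 :=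
  ⟨by have := sigmaOne_pos hS hd; positivity,
    (div_le_one (sigmaOne_pos hS hd)).2 (sqrt_eigenvalues_le_sigmaOne hS j)⟩

lemma effDim_one_le_two (hd : 1 ≤ d) : effDim hS.isHermitian 1 ≤ effDim hS.isHermitian 2 := by
  rw [effDim_one hS, effDim_two hS]
  refine Finset.sum_le_sum fun j _ => ?_
  obtain ⟨h0, h1⟩ := div_sigmaOne_mem hS hd j
  nlinarith

lemma sum_sqrt_eigenvalues (hd : 1 ≤ d) : ∑ j, √(hS.isHermitian.eigenvalues j)
    = sigmaOne hS.isHermitian * effDim hS.isHermitian 2 := by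
  have := sigmaOne_pos hS hd
  rw [effDim_two hS, ← Finset.sum_div]
  field_simp

lemma sum_sqrt_eigenvalues_pow_three_le (hd : 1 ≤ d) :
    ∑ j, √(hS.isHermitian.eigenvalues j) ^ 3
      ≤ sigmaOne hS.isHermitian ^ 3 * effDim hS.isHermitian 1 := by
  have h0 := sigmaOne_pos hS hd
  rw [effDim_one hS, Finset.mul_sum]
  refine Finset.sum_le_sum fun j _ => ?_
  have h1 := mul_le_mul_of_nonneg_right (sqrt_eigenvalues_le_sigmaOne hS j)
    (sq_nonneg √(hS.isHermitian.eigenvalues j))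
  calc √(hS.isHermitian.eigenvalues j) ^ 3
      ≤ sigmaOne hS.isHermitian * √(hS.isHermitian.eigenvalues j) ^ 2 := by linarith
    _ = _ := by field_simp

end EffDim

/-! ### The numerical estimates -/

lemma effDim_one_le {d : ℕ} {S : Matrix (Fin d) (Fin d) ℝ} (hS : S.PosDef) (hd : 1 ≤ d) :
    effDim hS.isHermitian 1 ≤ d := by
  rw [effDim_one hS]
  calc _ ≤ ∑ _j : Fin d, (1 : ℝ) := Finset.sum_le_sum fun j _ => by
        obtain ⟨h0, h1⟩ := div_sigmaOne_mem hS hd j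
        exact pow_le_one₀ h0 h1
    _ = d := by simp

lemma log_one_div_nonneg {δ : ℝ} (hδ : 0 < δ) (hδ1 : δ < 1) : 0 ≤ Real.log (1 / δ) :=
  Real.log_nonneg ((one_le_div hδ).2 hδ1.le)

lemma one_le_logFactor {d : ℕ} (hd : 1 ≤ d) {δ : ℝ} (hδ : 0 < δ) (hδ1 : δ < 1) :
    1 ≤ logFactor d δ := by
  have h1 : 0 ≤ Real.log d := Real.log_nonneg (by exact_mod_cast hd)
  have h2 := log_one_div_nonneg hδ hδ1
  unfold logFactor
  linarith

lemma clog_add_one_le {d : ℕ} (hd : 1 ≤ d) {δ : ℝ} (hδ : 0 < δ) (hδ1 : δ < 1) :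
    (Nat.clog 2 d : ℝ) + 1 ≤ 2 * logFactor d δ := by
  have h2 := log_one_div_nonneg hδ hδ1
  unfold logFactor
  rcases hd.eq_or_lt with rfl | hd
  · simp only [Nat.clog_one_right, Nat.cast_zero, Nat.cast_one, Real.log_one]
    linarith
  have h3 : 2 ^ (Nat.clog 2 d).pred < d := Nat.pow_pred_clog_lt_self one_lt_two hd
  have h4 : ((Nat.clog 2 d).pred : ℝ) * Real.log 2 ≤ Real.log d := by
    rw [← Real.log_pow]
    refine Real.log_le_log (by positivity) ?_
    exact_mod_cast h3.le
  have h5 : 0 < Nat.clog 2 d := Nat.clog_pos one_lt_two hd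
  have h6 : ((Nat.clog 2 d).pred : ℝ) + 1 = Nat.clog 2 d := by
    exact_mod_cast Nat.succ_pred_eq_of_pos h5
  have h7 : (0 : ℝ) ≤ (Nat.clog 2 d).pred := Nat.cast_nonneg _
  have := Real.log_two_gt_d9
  nlinarith

/-- With l = 2Λ, exp(−l) = e⁻²(δ/d)², and the at most 4d units are absorbed since e² ≥ 4. The choice
l = Λ would give only 4δ/e by the same count. -/
lemma failure_probability_le {d : ℕ} (hd : 1 ≤ d) {δ : ℝ} (hδ : 0 < δ) (hδ1 : δ < 1) :
    ((Nat.clog 2 d : ℕ) + 3 * (d : ℝ)) * Real.exp (-(2 * logFactor d δ)) ≤ δ := by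
  have hd0 : (0 : ℝ) < d := by exact_mod_cast hd
  have hd1 : (1 : ℝ) ≤ d := by exact_mod_cast hd
  have hK : (Nat.clog 2 d : ℝ) ≤ d := by
    exact_mod_cast Nat.clog_le_of_le_pow Nat.lt_two_pow_self.le
  have e : Real.exp (-(2 * logFactor d δ)) = (Real.exp 1 ^ 2)⁻¹ * (δ / d) ^ 2 := by
    have : -(2 * logFactor d δ) = -((1 + 1) + (Real.log (d / δ) + Real.log (d / δ))) := by
      unfold logFactor
      rw [Real.log_div hd0.ne' hδ.ne', Real.log_div one_ne_zero hδ.ne', Real.log_one]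
      ring
    rw [this, Real.exp_neg, Real.exp_add, Real.exp_add, Real.exp_add, Real.exp_log (by positivity)]
    field_simp
  have h4 : (4 : ℝ) ≤ Real.exp 1 ^ 2 := by
    have := Real.exp_one_gt_d9
    nlinarith
  calc _ ≤ (d + 3 * d : ℝ) * ((Real.exp 1 ^ 2)⁻¹ * (δ / d) ^ 2) := by rw [e]; gcongr
    _ ≤ (d + 3 * d : ℝ) * ((4 : ℝ)⁻¹ * (δ / d) ^ 2) := by gcongr
    _ = δ * (δ / d) := by field_simp; ring
    _ ≤ δ * 1 := by
        gcongr
        rw [div_le_one hd0]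
        linarith
    _ = δ := mul_one δ

lemma sqrt_eight_mul_le {Λ : ℝ} (hΛ : 1 ≤ Λ) : √(8 * Λ) ≤ 3 * Λ :=
  Real.sqrt_le_iff.2 ⟨by linarith, by nlinarith⟩

/-- The curvature constant of the data is dominated by the smoothness parameter. -/
lemma curvature_le {d n : ℕ} (hd : 1 ≤ d) (hn : 1 ≤ n) {S : Matrix (Fin d) (Fin d) ℝ}
    (hS : S.PosDef) {δ L : ℝ} (hδ : 0 < δ) (hδ1 : δ < 1) (hL : 0 ≤ L) :
    4 * L * (4 * ((Nat.clog 2 d : ℕ) + 1 : ℝ) ^ 2 * √(sigmaOne hS.isHermitian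
      * (2 + 2 * logFactor d δ) + 2 * (∑ j, √(hS.isHermitian.eigenvalues j)) / n))
      ≤ modulus hS.isHermitian n δ L (192 * logFactor d δ ^ 3) := by
  have hn0 : (0 : ℝ) < n := by exact_mod_cast hn
  have hn1 : (1 : ℝ) ≤ n := by exact_mod_cast hn
  have hs := sigmaOne_pos hS hd
  have hd1 := one_le_effDim_one hS hd
  have hd12 := effDim_one_le_two hS hd
  have hdd := effDim_one_le hS hd
  have hK := clog_add_one_le hd hδ hδ1
  have hΛ := one_le_logFactor hd hδ hδ1
  have hlog := log_one_div_nonneg hδ hδ1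
  have hlogd : 0 ≤ Real.log d := Real.log_nonneg (by exact_mod_cast hd)
  rw [sum_sqrt_eigenvalues hS hd]
  unfold modulus sampleFactor
  set s := sigmaOne hS.isHermitian
  set d₁ := effDim hS.isHermitian 1
  set d₂ := effDim hS.isHermitian 2
  set Λ := logFactor d δ
  set X := (d₁ * Real.log d + Real.log (1 / δ)) / n with hX
  set ρ := d₂ / d₁ with hρ
  have hd₁0 : 0 < d₁ := by linarith
  have hX0 : 0 ≤ X := by positivity
  have hρ1 : 1 ≤ ρ := (one_le_div hd₁0).2 hd12
  have hd₂ : d₂ = ρ * d₁ := by rw [hρ]; field_simp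
  have hκ : 1 + X ≤ (1 + √X) ^ 2 := by
    have := Real.sq_sqrt hX0
    have := Real.sqrt_nonneg X
    nlinarith
  have hκ1 : 1 ≤ (1 + √X) ^ 2 := by linarith
  -- For d ≥ 2 one has ln d ≥ 1/2. For d = 1 the logarithm vanishes, and the summand 1 covers
  -- d_eff(1) ≤ 1.
  have h1 : d₁ / n ≤ 2 * X + 1 := by
    rw [hX, ← mul_div_assoc, div_add_one hn0.ne', div_le_div_iff_of_pos_right hn0]
    rcases hd.eq_or_lt with rfl | hd2
    · push_cast at hdd
      rw [Nat.cast_one, Real.log_one, mul_zero]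
      linarith
    · have h2 : (1 : ℝ) / 2 ≤ Real.log d := by
        have := Real.log_two_gt_d9
        have h3 : Real.log 2 ≤ Real.log d :=
          Real.log_le_log (by norm_num) (by exact_mod_cast hd2)
        linarith
      nlinarith
  have h2 : s * (2 + 2 * Λ) + 2 * (s * d₂) / n ≤ 8 * Λ * (s * (ρ * (1 + √X)) ^ 2) := by
    -- One factor ρ ≥ 1 is given away to make a perfect square, so that the root below is ρκ.
    have h3 : d₂ / n ≤ ρ ^ 2 * (2 * (1 + √X) ^ 2) := by
      rw [hd₂, mul_div_assoc, sq ρ, mul_assoc]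
      refine mul_le_mul_of_nonneg_left ?_ (by linarith)
      have : d₁ / n ≤ 2 * (1 + √X) ^ 2 := by linarith
      have : 0 ≤ d₁ / n := by positivity
      nlinarith
    have h4 : 1 ≤ ρ ^ 2 * (1 + √X) ^ 2 := one_le_mul_of_one_le_of_one_le (one_le_pow₀ hρ1) hκ1
    have h5 : 2 + 2 * Λ + 2 * (d₂ / n) ≤ 8 * Λ * (ρ * (1 + √X)) ^ 2 := by
      rw [mul_pow]
      nlinarith
    calc _ = s * (2 + 2 * Λ + 2 * (d₂ / n)) := by ring
      _ ≤ s * (8 * Λ * (ρ * (1 + √X)) ^ 2) := by gcongr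
      _ = _ := by ring
  have h6 : √(s * (2 + 2 * Λ) + 2 * (s * d₂) / n) ≤ 3 * Λ * (√s * (ρ * (1 + √X))) := by
    refine (Real.sqrt_le_sqrt h2).trans ?_
    rw [Real.sqrt_mul (by positivity), Real.sqrt_mul hs.le, Real.sqrt_sq (by positivity)]
    gcongr
    exact sqrt_eight_mul_le hΛ
  -- The constant is 4 · 4 · 2² · 3 = 192, with Λ² from the number of blocks and Λ from the square
  -- root.
  calc _ ≤ 4 * L * (4 * (2 * Λ) ^ 2 * (3 * Λ * (√s * (ρ * (1 + √X))))) := by gcongr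
    _ = _ := by ring

/-- The radius is the balance point of the two terms up to powers of Λ: both become multiples of
LRs√κ√(d₂/√d₁)/T, with coefficients 2 · 192 and 4 · 3, whence 396. -/
lemma optimization_terms_le {s d₁ d₂ κ Λ L R E T : ℝ} (hs : 0 < s) (hd₁ : 0 < d₁) (hd₂ : 0 < d₂)
    (hκ : 0 < κ) (hΛ : 1 ≤ Λ) (hL : 0 ≤ L) (hR : 0 < R) (hT : 0 < T)
    (hE : E ≤ √(8 * Λ * (s ^ 3 * d₁))) :
    2 * R ^ 2 * (192 * Λ ^ 3 * L * √s * (d₂ / d₁) * κ)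
        / (R * √(d₂ * κ) / (√s * d₁ ^ (3 / 4 : ℝ)) * T)
      + 4 * (R * √(d₂ * κ) / (√s * d₁ ^ (3 / 4 : ℝ)) * (L * E)) / T
      ≤ 396 * Λ ^ 3 * √κ * (L * R * s * √(d₂ / √d₁) / T) := by
  -- Substituting even powers turns every root in the statement into a monomial.
  obtain ⟨q, hq, rfl⟩ : ∃ q : ℝ, 0 < q ∧ d₁ = q ^ 4 :=
    ⟨√√d₁, by positivity, by
      rw [show (4 : ℕ) = 2 * 2 from rfl, pow_mul, Real.sq_sqrt (Real.sqrt_nonneg _),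
        Real.sq_sqrt hd₁.le]⟩
  obtain ⟨w, hw, rfl⟩ : ∃ w : ℝ, 0 < w ∧ d₂ = w ^ 2 :=
    ⟨√d₂, by positivity, (Real.sq_sqrt hd₂.le).symm⟩
  obtain ⟨k, hk, rfl⟩ : ∃ k : ℝ, 0 < k ∧ κ = k ^ 2 :=
    ⟨√κ, by positivity, (Real.sq_sqrt hκ.le).symm⟩
  obtain ⟨g, hg, rfl⟩ : ∃ g : ℝ, 0 < g ∧ s = g ^ 2 :=
    ⟨√s, by positivity, (Real.sq_sqrt hs.le).symm⟩
  have e1 : (q ^ 4) ^ (3 / 4 : ℝ) = q ^ 3 := by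
    rw [← Real.rpow_natCast, ← Real.rpow_mul hq.le, ← Real.rpow_natCast]
    norm_num
  have e2 : √(q ^ 4) = q ^ 2 := by
    rw [show q ^ 4 = (q ^ 2) ^ 2 by ring, Real.sqrt_sq (by positivity)]
  have e3 : √(w ^ 2 * k ^ 2) = w * k := by rw [← mul_pow, Real.sqrt_sq (by positivity)]
  have e4 : √(w ^ 2 / q ^ 2) = w / q := by rw [← div_pow, Real.sqrt_sq (by positivity)]
  have hE' : E ≤ 3 * Λ ^ 3 * (g ^ 3 * q ^ 2) := by
    refine hE.trans ?_
    rw [Real.sqrt_mul (by positivity), show (g ^ 2) ^ 3 * q ^ 4 = (g ^ 3 * q ^ 2) ^ 2 by ring,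
      Real.sqrt_sq (by positivity)]
    gcongr
    refine (sqrt_eight_mul_le hΛ).trans ?_
    have := le_self_pow₀ hΛ (n := 3) (by norm_num)
    linarith
  rw [e1, e2, e3, e4, Real.sqrt_sq hg.le, Real.sqrt_sq hk.le]
  calc _ ≤ 2 * R ^ 2 * (192 * Λ ^ 3 * L * g * (w ^ 2 / q ^ 4) * k ^ 2)
        / (R * (w * k) / (g * q ^ 3) * T)
      + 4 * (R * (w * k) / (g * q ^ 3) * (L * (3 * Λ ^ 3 * (g ^ 3 * q ^ 2)))) / T := by gcongr
    _ = _ := by field_simp; ring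

end NonIsoSmoothing

/-! ### Conclusion: combining the data event with the expected gap -/

theorem mainTheorem9 :
    ∃ c C : ℝ, ∃ p : ℕ, 0 < c ∧ 0 < C ∧
    ∀ (d n : ℕ), 1 ≤ d → 1 ≤ n →
    ∀ (S : Matrix (Fin d) (Fin d) ℝ) (hS : S.PosDef)
      (Ω : Type*) [MeasurableSpace Ω] (P : Measure Ω) [IsProbabilityMeasure P]
      (a : Fin n → Ω → NonIsoSmoothing.Vec d),
      (∀ i, Measurable (a i)) → iIndepFun a P →
      (∀ i, NonIsoSmoothing.IsSubgaussianVec P S (a i)) →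
    ∀ δ : ℝ, 0 < δ → δ < 1 →
    -- the good event, which depends on the data only
    ∃ G : Set Ω, MeasurableSet G ∧ 1 - δ ≤ P.real G ∧ ∀ ω ∈ G,
    ∀ (L R : ℝ), 0 < L → 0 < R →
    -- convex `L`-Lipschitz losses
    ∀ loss : Fin n → ℝ → ℝ,
      (∀ i, ConvexOn ℝ Set.univ (loss i)) →
      (∀ i s t, |loss i s - loss i t| ≤ L * |s - t|) →
    -- convex regularizer with domain in the ball of radius `R`
    ∀ (D : Set (NonIsoSmoothing.Vec d)) (ψ : NonIsoSmoothing.Vec d → ℝ),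
      D ⊆ Metric.closedBall 0 R → ConvexOn ℝ D ψ → Measurable (fun v : D => ψ v) →
    -- a minimizer of the objective
    ∀ xstar ∈ D,
      IsMinOn (fun v => NonIsoSmoothing.empRisk loss (fun i => a i ω) v + ψ v) D xstar →
    -- a Lipschitz constant of the individual losses
    ∀ L₀ : ℝ, 0 < L₀ →
      (∀ i v w, |NonIsoSmoothing.linLoss loss (fun i => a i ω) i v
        - NonIsoSmoothing.linLoss loss (fun i => a i ω) i w| ≤ L₀ * ‖v - w‖) →
    ∀ m : ℕ, 1 ≤ m →
    -- the step sizes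
    ∀ (u Ls η : ℕ → ℝ),
      (∀ t, u t = NonIsoSmoothing.theta t * NonIsoSmoothing.radius hS.isHermitian n δ R) →
      (∀ t, Ls t = NonIsoSmoothing.modulus hS.isHermitian n δ L
        (c * NonIsoSmoothing.logFactor d δ ^ p) / u t) →
      (∀ t : ℕ, η t = L₀ * √((t : ℝ) + 1) / (R * √(m : ℝ))) →
    -- a run of the algorithm with smoothing distribution `N(0, √S)`
    ∀ (Ω' : Type*) [MeasurableSpace Ω'] (Q : Measure Ω') [IsProbabilityMeasure Q]
      (run : NonIsoSmoothing.Run (multivariateGaussian 0 (CFC.sqrt S))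
        (NonIsoSmoothing.linLoss loss (fun i => a i ω)) D ψ m u Ls η Q),
    ∀ T : ℕ, 1 ≤ T →
      Integrable (fun ω' => NonIsoSmoothing.empRisk loss (fun i => a i ω) (run.x T ω')
        + ψ (run.x T ω')
        - NonIsoSmoothing.empRisk loss (fun i => a i ω) xstar - ψ xstar) Q ∧
      ∫ ω', (NonIsoSmoothing.empRisk loss (fun i => a i ω) (run.x T ω')
        + ψ (run.x T ω')
        - NonIsoSmoothing.empRisk loss (fun i => a i ω) xstar - ψ xstar) ∂Q
      ≤ C * NonIsoSmoothing.logFactor d δ ^ p * √(NonIsoSmoothing.sampleFactor hS.isHermitian n δ)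
          * (L * R * NonIsoSmoothing.sigmaOne hS.isHermitian
            * √(NonIsoSmoothing.effDim hS.isHermitian 2
                / √(NonIsoSmoothing.effDim hS.isHermitian 1)) / T)
        + 5 * L₀ * R / √((T : ℝ) * m) := by
  refine ⟨192, 396, 3, by norm_num, by norm_num, ?_⟩
  intro d n hd hn S hS Ω _ P _ a ha hind hsub δ hδ hδ1
  have : NeZero n := ⟨by omega⟩
  set b := hS.isHermitian.eigenvectorBasis with hb
  set σ : Fin d → ℝ := fun j => √(hS.isHermitian.eigenvalues j) with hσdef
  set s := NonIsoSmoothing.sigmaOne hS.isHermitian with hs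
  have hσ : ∀ j, 0 < σ j := fun j => Real.sqrt_pos.2 (hS.eigenvalues_pos j)
  have hs0 : 0 < s := NonIsoSmoothing.sigmaOne_pos hS hd
  have hσs : ∀ j, σ j ≤ s := NonIsoSmoothing.sqrt_eigenvalues_le_sigmaOne hS
  have hΛ := NonIsoSmoothing.one_le_logFactor hd hδ hδ1
  have hSb : ∀ j, S.mulVec (b j).ofLp = σ j ^ 2 • (b j).ofLp := fun j => by
    rw [hσdef, Real.sq_sqrt (hS.eigenvalues_pos j).le]
    exact hS.isHermitian.mulVec_eigenvectorBasis j
  obtain ⟨G, hG, hPG, hGω⟩ := NonIsoSmoothing.exists_data_event (b := b) ha hind hσ hn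
    (fun i g t ht => (hsub i).tail_le b hSb g ht) (Nat.clog 2 d)
    (B := NonIsoSmoothing.scaleBlock σ s) (τ := fun k => s / 2 ^ k) (fun k => by positivity)
    (fun k j hj => by
      have hj' : NonIsoSmoothing.scaleIndex σ s j = k := by
        simpa [NonIsoSmoothing.scaleBlock] using hj
      rw [← hj']
      exact (NonIsoSmoothing.scaleIndex_spec hσ hσs j).1)
    (2 * NonIsoSmoothing.logFactor d δ)
  have hfail := NonIsoSmoothing.failure_probability_le hd hδ hδ1
  refine ⟨G, hG, by linarith, ?_⟩
  intro ω hω L R hL hR loss hc hl D ψ hD hψ hψm xstar hx hmin L₀ hL₀ hl₀ m hm u Ls η hu hLs hη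
    Ω' _ Q _ run T hT
  obtain ⟨hω1, hω2⟩ := hGω ω hω
  -- This is a_iᵀ√Σ a_i in the eigenbasis, the variance of ⟪a_i, Z⟫. All σ_j are positive, so it
  -- vanishes only if a_i does.
  set v : Fin n → NNReal := fun i => (∑ j, σ j * ⟪b j, a i ω⟫ ^ 2).toNNReal with hvdef
  have hsum0 : ∀ i, 0 ≤ ∑ j, σ j * ⟪b j, a i ω⟫ ^ 2 := fun i =>
    Finset.sum_nonneg fun j _ => mul_nonneg (hσ j).le (sq_nonneg _)
  have hvc : ∀ i, (v i : ℝ) = ∑ j, σ j * ⟪a i ω, b j⟫ ^ 2 := fun i => by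
    rw [hvdef, Real.coe_toNNReal _ (hsum0 i)]
    exact Finset.sum_congr rfl fun j _ => by rw [real_inner_comm]
  have hμ : ∀ i, (multivariateGaussian 0 (CFC.sqrt S)).map (fun Z => ⟪a i ω, Z⟫)
      = gaussianReal 0 (v i) := fun i => by
    rw [NonIsoSmoothing.map_inner_multivariateGaussian
      (Matrix.nonneg_iff_posSemidef.1 (CFC.sqrt_nonneg S)),
      NonIsoSmoothing.dotProduct_mulVec_eq_sum _ b
        (NonIsoSmoothing.sqrt_mulVec_eigenvectorBasis hS)]
  have hv : ∀ i, v i = 0 → a i ω = 0 := fun i hi => by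
    have h0 : ∑ j, σ j * ⟪b j, a i ω⟫ ^ 2 = 0 :=
      le_antisymm (Real.toNNReal_eq_zero.1 hi) (hsum0 i)
    rw [Finset.sum_eq_zero_iff_of_nonneg fun j _ => mul_nonneg (hσ j).le (sq_nonneg _)] at h0
    rw [← b.sum_repr' (a i ω)]
    refine Finset.sum_eq_zero fun j hj => ?_
    have h1 := (mul_eq_zero.1 (h0 j hj)).resolve_left (hσ j).ne'
    rw [pow_eq_zero_iff two_ne_zero] at h1
    rw [h1, zero_smul]
  have hM := fun h => NonIsoSmoothing.quadratic_le (b := b) (a := fun i => a i ω) hn hσ hσs hs0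
    (by linarith : 0 ≤ 2 * NonIsoSmoothing.logFactor d δ) (Nat.le_pow_clog one_lt_two d)
    hω1 hω2 h
  simp only [← hvc] at hM
  have hE := NonIsoSmoothing.avg_norm_le (b := b) (a := fun i => a i ω) hn hσ hω1
  simp only [← hvc] at hE
  have hcurv := NonIsoSmoothing.curvature_le hd hn hS hδ hδ1 hL.le
  have hd1 := NonIsoSmoothing.one_le_effDim_one hS hd
  have hd2 := NonIsoSmoothing.effDim_one_le_two hS hd
  have hd10 : 0 < NonIsoSmoothing.effDim hS.isHermitian 1 := by linarith
  have hd20 : 0 < NonIsoSmoothing.effDim hS.isHermitian 2 := by linarith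
  have hκ : 0 < NonIsoSmoothing.sampleFactor hS.isHermitian n δ := by
    unfold NonIsoSmoothing.sampleFactor
    positivity
  have hr : 0 < NonIsoSmoothing.radius hS.isHermitian n δ R := by
    unfold NonIsoSmoothing.radius
    positivity
  have hB : 0 ≤ NonIsoSmoothing.modulus hS.isHermitian n δ L
      (192 * NonIsoSmoothing.logFactor d δ ^ 3) := by
    unfold NonIsoSmoothing.modulus
    positivity
  obtain ⟨hint, hle⟩ := run.expected_gap_le hψ hψm hL.le hl hc hμ hv hM hL₀ hl₀ hR hD hm hr hB
    hcurv hu hLs hη hx hmin hT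
  refine ⟨hint, hle.trans (add_le_add_left ?_ _)⟩
  have hT0 : (0 : ℝ) < T := by exact_mod_cast hT
  refine NonIsoSmoothing.optimization_terms_le hs0 hd10 hd20 hκ hΛ hL.le hR hT0
    (hE.trans (Real.sqrt_le_sqrt ?_))
  have h3 := mul_le_mul_of_nonneg_left (NonIsoSmoothing.sum_sqrt_eigenvalues_pow_three_le hS hd)
    (by linarith : 0 ≤ 8 * NonIsoSmoothing.logFactor d δ)
  linarith
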